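/- Let $p$ be a prime and let $E$ be a complete discretely valued field whose residue field $k$ is perfect of characteristic $p$; let $\mathfrak{o}_E$ be its ring of integers and $\pi$ a uniformizer. Let $F\subseteq E$ be a complete discretely valued subfield, with ring of integers $\mathfrak{o}_F=F\cap\mathfrak{o}_E$ whose maximal ideal lies in $\pi\mathfrak{o}_E$ (for instance $F=\mathbb{Q}_p$ if $E$ has characteristic $0$, and $F=\mathbb{F}_p((\eta))$ if $E$ has characteristic $p$). Let $(R,R^+)$ be a nonzero perfect uniform adic Banach algebra over $k$: $R$ is a perfect $k$-algebra, complete for a nonarchimedean submultiplicative norm that is equivalent to its spectral seminorm $\alpha(x)=\lim_n\|x^n\|^{1/n}$, and $R^+\subseteq R$ is an open, integrally closed $k$-subalgebra consisting of power-bounded elements. Let $A$ be a reduced affinoid algebra over $F$, presented as $A=F\{T_1,\dots,T_d\}/J$. Let $W_\pi(R)$ be the $\pi$-adic completion of $W(R)\otimes_{W(k)}\mathfrak{o}_E$ (the tensor product is already complete if $E$ has characteristic $0$, and $W_\pi(R)=R[[\pi]]$ if $E$ has characteristic $p$); every element is uniquely $\sum_{j\ge0}\pi^j[x_j]$ with $x_j\in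 R$. Let $B$ be the ring obtained by inverting $\pi$ in the subring of $W_\pi(R)\langle T_1,\dots,T_d\rangle$ (power series whose coefficients tend to $0$ $\pi$-adically) generated by $W_\pi(R^+)\langle T_1,\dots,T_d\rangle$ and the Teichmüller elements $[x]$, $x\in R$. For $t>0$ put on $B$ the Gauss norm $$\Big\|\sum_{i}\sum_{j\gg-\infty}\pi^j[x_{i,j}]T^i\Big\|_{t}=\sup_{i,j}p^{-j}\alpha(x_{i,j})^t .$$ For a closed interval $I\subset(0,\infty)$ let $\widetilde\Pi^I_{R,F\{T_1,\dots,T_d\}}$ be the Fréchet completion of $B$ for the norms $\|\cdot\|_t$, $t\in I$, and let $\widetilde\Pi^I_{R,A}$ be its quotient by the closed ideal generated by $J$. For $I'\subseteq I$ there is a natural restriction map $\widetilde\Pi^I_{R,A}\to\widetilde\Pi^{I'}_{R,A}$. Let $0<s_1\le s_2\le r_1\le r_2$. Then the restriction maps from $\widetilde\Pi^{[s_1,r_1]}_{R,A}$, $\widetilde\Pi^{[s_2,r_2]}_{R,A}$ and $\widetilde\Pi^{[s_1,r_2]}_{R,A}$ to $\widetilde\Pi^{[s_2,r_1]}_{R,A}$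 are injective, and, identifying these rings with their images in $\widetilde\Pi^{[s_2,r_1]}_{R,A}$, $$\widetilde\Pi^{[s_1,r_1]}_{R,A}\cap\widetilde\Pi^{[s_2,r_2]}_{R,A}=\widetilde\Pi^{[s_1,r_2]}_{R,A}.$$ -/

import Mathlib

open scoped TensorProduct

noncomputable section

namespace DeformedRobba

/-! ### Restricted power series and Tate algebras -/

section Restricted

variable {S : Type*} [CommRing S] (π : S) (d : ℕ)

/-- The ring `S⟨T₁, …, T_d⟩` of restricted power series for the `π`-adic topology: for every `n`,
all but finitely many coefficients are divisible by `π ^ n`. -/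
def restrictedSeries : Subring (MvPowerSeries (Fin d) S) where
  carrier := {f | ∀ n : ℕ, {i | MvPowerSeries.coeff i f ∉ Ideal.span {π ^ n}}.Finite}
  zero_mem' n := by simp
  one_mem' n := by
    classical
    refine (Set.finite_singleton (0 : Fin d →₀ ℕ)).subset fun i hi => ?_
    by_contra h
    have h' : i ≠ 0 := h
    simp [MvPowerSeries.coeff_one, h'] at hi
  add_mem' {f g} hf hg n := by
    refine ((hf n).union (hg n)).subset fun i hi => ?_
    by_contra h
    simp only [Set.mem_union, Set.mem_ofPred_eq, not_or, not_not] at h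
    exact hi (by simpa using Ideal.add_mem _ h.1 h.2)
  neg_mem' {f} hf n := by
    refine (hf n).subset fun i hi => ?_
    simpa using hi
  mul_mem' {f g} hf hg n := by
    classical
    refine ((hf n).image2 (fun a b => a + b) (hg n)).subset fun i hi => ?_
    by_contra h
    refine hi ?_
    rw [MvPowerSeries.coeff_mul]
    refine Ideal.sum_mem _ fun ab hab => ?_
    by_cases ha : MvPowerSeries.coeff ab.1 f ∈ Ideal.span {π ^ n}
    · exact Ideal.mul_mem_right _ _ ha
    · by_cases hb : MvPowerSeries.coeff ab.2 g ∈ Ideal.span {π ^ n}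
      · exact Ideal.mul_mem_left _ _ hb
      · exact absurd ⟨ab.1, ha, ab.2, hb, Finset.HasAntidiagonal.mem_antidiagonal.mp hab⟩ h

theorem C_mem_restrictedSeries (a : S) :
    (MvPowerSeries.C a : MvPowerSeries (Fin d) S) ∈ restrictedSeries π d := by
  classical
  intro n
  refine (Set.finite_singleton (0 : Fin d →₀ ℕ)).subset fun i hi => ?_
  by_contra h
  have h' : i ≠ 0 := h
  simp [MvPowerSeries.coeff_C, h'] at hi

/-- The Tate algebra `F{T₁, …, T_d} = S⟨T₁, …, T_d⟩[1/π]` over `F = S[1/π]`, for `S` a complete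
discrete valuation ring with uniformizer `π`. -/
abbrev TateAlgebra : Type _ :=
  Localization.Away (⟨MvPowerSeries.C π, C_mem_restrictedSeries π d π⟩ : restrictedSeries π d)

end Restricted

/-! ### Fréchet completions -/

section Completion

variable {B : Type*} [CommRing B] (N : ℝ → B → ℝ)

/-- Sequences that are simultaneously Cauchy for all `N t`, `t ∈ I`. -/
def IsCauchyOn (I : Set ℝ) (x : ℕ → B) : Prop :=
  ∀ t ∈ I, ∀ ε > 0, ∃ n₀ : ℕ, ∀ m ≥ n₀, ∀ n ≥ n₀, N t (x m - x n) < ε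

/-- Sequences that tend to zero for all `N t`, `t ∈ I`. -/
def IsNullOn (I : Set ℝ) (x : ℕ → B) : Prop :=
  ∀ t ∈ I, Filter.Tendsto (fun n => N t (x n)) Filter.atTop (nhds 0)

/-- The ring of Cauchy sequences.  If the `N t`, `t ∈ I`, are submultiplicative seminorms, as is the
case below, the Cauchy sequences form a subring, and `Subring.closure` adds nothing. -/
def cauchyRing (I : Set ℝ) : Subring (ℕ → B) :=
  Subring.closure {x | IsCauchyOn N I x}

/-- The ideal of null sequences (these form an ideal if the `N t`, `t ∈ I`, are submultiplicative
seminorms, and `Ideal.span` adds nothing). -/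
def nullIdeal (I : Set ℝ) : Ideal (cauchyRing N I) :=
  Ideal.span {x | IsNullOn N I x.1}

/-- The Fréchet completion of `B` with respect to the seminorms `N t`, `t ∈ I`, for an interval `I`:
Cauchy sequences modulo null sequences. -/
def FrechetCompletion (I : Set ℝ) : Type _ := cauchyRing N I ⧸ nullIdeal N I

instance (I : Set ℝ) : CommRing (FrechetCompletion N I) :=
  inferInstanceAs (CommRing (cauchyRing N I ⧸ nullIdeal N I))

/-- The class of a Cauchy sequence in the completion. -/
def FrechetCompletion.mk (I : Set ℝ) : cauchyRing N I →+* FrechetCompletion N I :=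
  Ideal.Quotient.mk (nullIdeal N I)

/-- The closure, in the Fréchet completion, of the ideal generated by the image of an ideal `J`
of `B`: the elements that are limits of (Cauchy) sequences in `J`. -/
def closedIdeal (I : Set ℝ) (J : Ideal B) : Ideal (FrechetCompletion N I) :=
  Ideal.span {z | ∃ y : cauchyRing N I, FrechetCompletion.mk N I y = z ∧ ∀ n, y.1 n ∈ J}

/-- The quotient of the Fréchet completion by the closed ideal generated by `J`. -/
def CompletedQuotient (J : Ideal B) (I : Set ℝ) : Type _ :=
  FrechetCompletion N I ⧸ closedIdeal N I J

instance (J : Ideal B) (I : Set ℝ) : CommRing (CompletedQuotient N J I) :=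
  inferInstanceAs (CommRing (FrechetCompletion N I ⧸ closedIdeal N I J))

variable {I I' : Set ℝ} (h : I' ⊆ I)

theorem cauchyRing_mono {I I' : Set ℝ} (h : I' ⊆ I) : cauchyRing N I ≤ cauchyRing N I' :=
  Subring.closure_mono fun _ hx t ht => hx t (h ht)

theorem nullIdeal_le_comap :
    nullIdeal N I ≤ (nullIdeal N I').comap (Subring.inclusion (cauchyRing_mono N h)) := by
  rw [nullIdeal, Ideal.span_le]
  intro x hx
  rw [Set.mem_ofPred_eq] at hx
  rw [SetLike.mem_coe, Ideal.mem_comap, nullIdeal]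
  refine Ideal.subset_span ?_
  rw [Set.mem_ofPred_eq, Subring.coe_inclusion]
  exact fun t ht => hx t (h ht)

/-- The restriction map between Fréchet completions for `I' ⊆ I`. -/
def FrechetCompletion.restrict : FrechetCompletion N I →+* FrechetCompletion N I' :=
  Ideal.quotientMap _ (Subring.inclusion (cauchyRing_mono N h)) (nullIdeal_le_comap N h)

theorem FrechetCompletion.restrict_mk (y : cauchyRing N I) :
    FrechetCompletion.restrict N h (FrechetCompletion.mk N I y) =
      FrechetCompletion.mk N I' (Subring.inclusion (cauchyRing_mono N h) y) :=
  Ideal.quotientMap_mk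

theorem closedIdeal_le_comap (J : Ideal B) :
    closedIdeal N I J ≤ (closedIdeal N I' J).comap (FrechetCompletion.restrict N h) := by
  rw [closedIdeal, Ideal.span_le]
  intro z hz
  rw [Set.mem_ofPred_eq] at hz
  obtain ⟨y, rfl, hy⟩ := hz
  rw [SetLike.mem_coe, Ideal.mem_comap, closedIdeal]
  refine Ideal.subset_span ?_
  rw [Set.mem_ofPred_eq]
  exact ⟨Subring.inclusion (cauchyRing_mono N h) y, (FrechetCompletion.restrict_mk N h y).symm,
    fun n => by rw [Subring.coe_inclusion]; exact hy n⟩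

/-- The restriction map between completed quotients for `I' ⊆ I`. -/
def CompletedQuotient.restrict (J : Ideal B) :
    CompletedQuotient N J I →+* CompletedQuotient N J I' :=
  Ideal.quotientMap _ (FrechetCompletion.restrict N h) (closedIdeal_le_comap N h J)

end Completion

/-! ### Generalized Witt vectors -/

section GenWitt

/-- `W(R)` as an algebra over `W(k)`. -/
@[reducible] def wittAlgebra (p : ℕ) [Fact p.Prime] (k R : Type*) [CommRing k] [CommRing R]
    [Algebra k R] : Algebra (WittVector p k) (WittVector p R) :=
  (WittVector.map (algebraMap k R)).toAlgebra

attribute [local instance] wittAlgebra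

variable (p : ℕ) [Fact p.Prime] (k : Type*) [CommRing k] {O : Type*} [CommRing O]
  [Algebra (WittVector p k) O] (π : O) (R : Type*) [CommRing R] [Algebra k R]

variable (O) in
/-- The tensor product `W(R) ⊗_{W(k)} O`. -/
def PreWitt : Type _ := WittVector p R ⊗[WittVector p k] O

instance : CommRing (PreWitt p k O R) :=
  inferInstanceAs (CommRing (WittVector p R ⊗[WittVector p k] O))

/-- The map `O → W(R) ⊗_{W(k)} O`, `a ↦ 1 ⊗ a`. -/
def PreWitt.base : O →+* PreWitt p k O R :=
  (Algebra.TensorProduct.includeRight :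
    O →ₐ[WittVector p k] WittVector p R ⊗[WittVector p k] O).toRingHom

variable (O) in
/-- The map `W(R) → W(R) ⊗_{W(k)} O`, `w ↦ w ⊗ 1`. -/
def PreWitt.ofWitt : WittVector p R →+* PreWitt p k O R :=
  Algebra.TensorProduct.includeLeftRingHom

/-- The ideal generated by `π` in `W(R) ⊗_{W(k)} O`. -/
def wittIdeal : Ideal (PreWitt p k O R) :=
  Ideal.span {PreWitt.base p k R π}

/-- The ring `W_π(R)` of generalized Witt vectors: the `π`-adic completion of
`W(R) ⊗_{W(k)} O`.  If `O` has characteristic zero, the tensor product is already complete;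
if `O = k⟦π⟧`, one gets `R⟦π⟧`. -/
def GenWitt : Type _ :=
  AdicCompletion (wittIdeal p k π R) (PreWitt p k O R)

instance : CommRing (GenWitt p k π R) :=
  inferInstanceAs (CommRing (AdicCompletion (wittIdeal p k π R) (PreWitt p k O R)))

/-- The canonical map `W(R) ⊗_{W(k)} O → W_π(R)`. -/
def GenWitt.of : PreWitt p k O R →+* GenWitt p k π R :=
  algebraMap (PreWitt p k O R) (AdicCompletion (wittIdeal p k π R) (PreWitt p k O R))

/-- The projections `W_π(R) → (W(R) ⊗_{W(k)} O) / π ^ n`. -/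
def GenWitt.eval (n : ℕ) : GenWitt p k π R →+* PreWitt p k O R ⧸ wittIdeal p k π R ^ n :=
  (AdicCompletion.evalₐ (wittIdeal p k π R) n).toRingHom

/-- The structure map `O → W_π(R)`. -/
def GenWitt.base : O →+* GenWitt p k π R :=
  (GenWitt.of p k π R).comp (PreWitt.base p k R)

/-- The Teichmüller lift `[x]` in `W_π(R)`. -/
def GenWitt.teich (x : R) : GenWitt p k π R :=
  GenWitt.of p k π R (PreWitt.ofWitt p k O R (WittVector.teichmuller p x))

variable {R} {R' : Type*} [CommRing R'] [Algebra k R']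

/-- `W(f)` as a homomorphism of `W(k)`-algebras. -/
def wittMap (f : R →ₐ[k] R') : WittVector p R →ₐ[WittVector p k] WittVector p R' :=
  { WittVector.map (p := p) f.toRingHom with
    commutes' := fun c => by
      ext n
      simp [RingHom.algebraMap_toAlgebra, WittVector.map_coeff] }

variable (O) in
/-- `W(f) ⊗ O : W(R) ⊗_{W(k)} O → W(R') ⊗_{W(k)} O`. -/
def PreWitt.map (f : R →ₐ[k] R') : PreWitt p k O R →+* PreWitt p k O R' :=
  (Algebra.TensorProduct.map (wittMap p k f) (AlgHom.id (WittVector p k) O)).toRingHom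

theorem PreWitt.map_base (f : R →ₐ[k] R') (a : O) :
    PreWitt.map p k O f (PreWitt.base p k R a) = PreWitt.base p k R' a := by
  change Algebra.TensorProduct.map (wittMap p k f) (AlgHom.id (WittVector p k) O)
    ((1 : WittVector p R) ⊗ₜ[WittVector p k] a) = (1 : WittVector p R') ⊗ₜ[WittVector p k] a
  rw [Algebra.TensorProduct.map_tmul, map_one, AlgHom.id_apply]

theorem wittIdeal_pow_le_comap (f : R →ₐ[k] R') (n : ℕ) :
    wittIdeal p k π R ^ n ≤ (wittIdeal p k π R' ^ n).comap (PreWitt.map p k O f) := by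
  rw [← Ideal.map_le_iff_le_comap, Ideal.map_pow]
  refine Ideal.pow_right_mono ?_ n
  rw [wittIdeal, Ideal.map_span, Set.image_singleton, PreWitt.map_base, wittIdeal]

/-- The reduction `W_π(R) → (W(R') ⊗_{W(k)} O) / π ^ n` of the map induced by `f`. -/
def GenWitt.mapMod (f : R →ₐ[k] R') (n : ℕ) :
    GenWitt p k π R →+* PreWitt p k O R' ⧸ wittIdeal p k π R' ^ n :=
  (Ideal.quotientMap _ (PreWitt.map p k O f) (wittIdeal_pow_le_comap p k π f n)).comp
    (GenWitt.eval p k π R n)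

theorem GenWitt.mapMod_compat (f : R →ₐ[k] R') {m n : ℕ} (hmn : m ≤ n) :
    (Ideal.Quotient.factorPow (wittIdeal p k π R') hmn).comp (GenWitt.mapMod p k π f n) =
      GenWitt.mapMod p k π f m := by
  refine RingHom.ext fun x => ?_
  obtain ⟨a, e⟩ : ∃ a : AdicCompletion.AdicCauchySequence (wittIdeal p k π R) (PreWitt p k O R),
      ∀ l, GenWitt.eval p k π R l x = Ideal.Quotient.mk _ (a.1 l) := by
    obtain ⟨a, ha⟩ := AdicCompletion.mk_surjective (wittIdeal p k π R) (PreWitt p k O R) x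
    exact ⟨a, fun l => ha ▸ AdicCompletion.evalₐ_mk (wittIdeal p k π R) l a⟩
  have h := AdicCompletion.Ideal.mk_eq_mk (wittIdeal p k π R) hmn a
  rw [Ideal.Quotient.mk_eq_mk_iff_sub_mem] at h
  have h' := wittIdeal_pow_le_comap p k π f m h
  rw [Ideal.mem_comap, map_sub, ← Ideal.Quotient.mk_eq_mk_iff_sub_mem] at h'
  rw [RingHom.comp_apply, GenWitt.mapMod, GenWitt.mapMod, RingHom.comp_apply, RingHom.comp_apply,
    e, e, Ideal.quotientMap_mk, Ideal.quotientMap_mk]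
  exact h'

/-- Functoriality `W_π(R) → W_π(R')` of generalized Witt vectors. -/
def GenWitt.map (f : R →ₐ[k] R') : GenWitt p k π R →+* GenWitt p k π R' :=
  AdicCompletion.liftRingHom (wittIdeal p k π R') (GenWitt.mapMod p k π f)
    (GenWitt.mapMod_compat p k π f)

theorem GenWitt.map_base (f : R →ₐ[k] R') (a : O) :
    GenWitt.map p k π f (GenWitt.base p k π R a) = GenWitt.base p k π R' a := by
  refine AdicCompletion.ext_evalₐ fun n => ?_
  refine (AdicCompletion.evalₐ_liftRingHom (wittIdeal p k π R') (GenWitt.mapMod p k π f)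
    (GenWitt.mapMod_compat p k π f) n _).trans ?_
  have e : ∀ y, GenWitt.eval p k π R n (GenWitt.of p k π R y) = Ideal.Quotient.mk _ y :=
    fun y => AdicCompletion.evalₐ_of (wittIdeal p k π R) n y
  rw [GenWitt.mapMod, RingHom.comp_apply, GenWitt.base, RingHom.comp_apply, e,
    Ideal.quotientMap_mk, PreWitt.map_base]
  exact (AdicCompletion.evalₐ_of (wittIdeal p k π R') n (PreWitt.base p k R' a)).symm

end GenWitt

/-! ### The rings `Π̃^I_{R,F{T₁,…,T_d}}` and `Π̃^I_{R,A}` -/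

section Robba

/-- The spectral seminorm `α(x) = inf_n ‖x ^ n‖ ^ (1 / n) = lim_n ‖x ^ n‖ ^ (1 / n)`. -/
def specNorm {R : Type*} [NormedCommRing R] (x : R) : ℝ :=
  smoothingFun (normRingSeminorm R) x

variable (p : ℕ) [Fact p.Prime] {k : Type*} [CommRing k] {O : Type*} [CommRing O]
  [Algebra (WittVector p k) O] (π : O) {R : Type*} [NormedCommRing R] [Algebra k R]
  (Rp : Subalgebra k R) (d : ℕ)

/-- `W_π(R⁺)` as a subring of `W_π(R)`. -/
def GenWitt.plus : Subring (GenWitt p k π R) :=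
  (GenWitt.map p k π Rp.val).range

/-- The ring `W_π(R⁺)_{F{T₁,…,T_d}}[[x] : x ∈ R]`: the subring of `W_π(R)⟨T₁, …, T_d⟩` generated by
`W_π(R⁺)⟨T₁, …, T_d⟩` and the Teichmüller lifts of the elements of `R`. -/
def genRing : Subring (MvPowerSeries (Fin d) (GenWitt p k π R)) :=
  Subring.closure
    ({f | f ∈ restrictedSeries (GenWitt.base p k π R π) d ∧
        ∀ i, MvPowerSeries.coeff i f ∈ GenWitt.plus p π Rp} ∪
      Set.range fun x : R => MvPowerSeries.C (GenWitt.teich p k π R x))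

theorem C_base_mem_genRing (a : O) :
    MvPowerSeries.C (GenWitt.base p k π R a) ∈ genRing p π Rp d := by
  classical
  refine Subring.subset_closure (Or.inl ⟨C_mem_restrictedSeries _ d _, fun i => ?_⟩)
  rw [MvPowerSeries.coeff_C]
  split_ifs
  · exact ⟨GenWitt.base p k π Rp a, GenWitt.map_base p k π Rp.val a⟩
  · exact zero_mem _

/-- The element `π` of the ring `genRing`. -/
def genRingPi : genRing p π Rp d :=
  ⟨MvPowerSeries.C (GenWitt.base p k π R π), C_base_mem_genRing p π Rp d π⟩

/-- The ring `W_π(R⁺)_{F{T₁,…,T_d}}[[x] : x ∈ R][1/π]`. -/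
abbrev GenRingInv : Type _ := Localization.Away (genRingPi p π Rp d)

variable {d}

/-- `w = ∑_j π ^ j [a_j]`, with `π`-adic convergence in `W_π(R)`. -/
def HasTeichExpansion (w : GenWitt p k π R) (a : ℕ → R) : Prop :=
  ∀ n : ℕ, w - ∑ j ∈ Finset.range n, GenWitt.base p k π R π ^ j * GenWitt.teich p k π R (a j) ∈
    Ideal.span {GenWitt.base p k π R π ^ n}

variable {Rp}

/-- The Gauss norm `‖b‖_{α^t} = sup_{i,j} p ^ (n - j) α(a_{i,j}) ^ t` of
`b = π ^ (-n) ∑_i (∑_j π ^ j [a_{i,j}]) T ^ i`.  The value is the same for all such representations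
of `b`, so that the infimum is over a one-element set. -/
def gaussNorm (t : ℝ) (b : GenRingInv p π Rp d) : ℝ :=
  sInf {c | ∃ (n : ℕ) (f : genRing p π Rp d) (a : (Fin d →₀ ℕ) → ℕ → R),
    b * algebraMap (genRing p π Rp d) (GenRingInv p π Rp d) (genRingPi p π Rp d) ^ n =
      algebraMap (genRing p π Rp d) (GenRingInv p π Rp d) f ∧
    (∀ i, HasTeichExpansion p π (MvPowerSeries.coeff i f.1) (a i)) ∧
    c = ⨆ ij : (Fin d →₀ ℕ) × ℕ, (p : ℝ) ^ ((n : ℤ) - (ij.2 : ℤ)) * specNorm (a ij.1 ij.2) ^ t}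

variable (Rp) (d)

/-- `Π̃^I_{R,F{T₁,…,T_d}}`: the Fréchet completion of `W_π(R⁺)_{F{T₁,…,T_d}}[[x] : x ∈ R][1/π]`
with respect to the norms `‖·‖_{α^t}`, `t ∈ I`. -/
abbrev RobbaTate (I : Set ℝ) : Type _ :=
  FrechetCompletion (gaussNorm p π (Rp := Rp) (d := d)) I

variable {O₀ : Type*} [CommRing O₀] [Algebra O₀ O] {ϖ : O₀} {d}

/-- The ideal of `W_π(R⁺)_{F{T₁,…,T_d}}[[x] : x ∈ R][1/π]` generated by the image of the ideal `J`
of `O₀⟨T₁, …, T_d⟩`. -/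
def extendedIdeal (J : Ideal (restrictedSeries ϖ d)) : Ideal (GenRingInv p π Rp d) :=
  Ideal.span {b | ∃ g ∈ J, ∃ f : genRing p π Rp d,
    f.1 = MvPowerSeries.map ((GenWitt.base p k π R).comp (algebraMap O₀ O)) g.1 ∧
    b = algebraMap (genRing p π Rp d) (GenRingInv p π Rp d) f}

/-- The elements of `O₀⟨T₁, …, T_d⟩` in the kernel of `φ : F{T₁, …, T_d} → A`.  They generate the
kernel of `φ`. -/
def integralKer {A : Type*} [CommRing A] (φ : TateAlgebra ϖ d →+* A) :
    Ideal (restrictedSeries ϖ d) :=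
  RingHom.ker (φ.comp (algebraMap (restrictedSeries ϖ d) (TateAlgebra ϖ d)))

/-- `Π̃^I_{R,A}` for an affinoid algebra `A` presented by `φ : F{T₁, …, T_d} ↠ A`: the quotient of
`Π̃^I_{R,F{T₁,…,T_d}}` by the closed ideal generated by the kernel of `φ`. -/
abbrev Robba {A : Type*} [CommRing A] (φ : TateAlgebra ϖ d →+* A) (I : Set ℝ) : Type _ :=
  CompletedQuotient (gaussNorm p π (Rp := Rp) (d := d))
    (extendedIdeal p π Rp (integralKer φ)) I

/-- The restriction map `Π̃^I_{R,A} → Π̃^{I'}_{R,A}` for `I' ⊆ I`. -/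
abbrev restrict {A : Type*} [CommRing A] (φ : TateAlgebra ϖ d →+* A) {I I' : Set ℝ} (h : I' ⊆ I) :
    Robba p π Rp φ I →+* Robba p π Rp φ I' :=
  CompletedQuotient.restrict (gaussNorm p π (Rp := Rp) (d := d)) h
    (extendedIdeal p π Rp (integralKer φ))

end Robba

end DeformedRobba

end

noncomputable section

namespace DeformedRobba

/-! ### The spectral seminorm -/

section SpecNorm

variable {R : Type*} [NormedCommRing R]

/-! Without an ideal, glueing is an interpolation between Gauss norms. Split e ∈ B as u + v, where u
collects the terms π^j[x]T^i with j ≥ 0 and v those with j < 0. Writing a = α(x), the inequality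
p^(-j) a^t ≤ (p^(-j) a^t₀)^(t/t₀) holds if j ≥ 0 and t ≤ t₀, and also if j ≤ 0 and t ≥ t₀
(`gaussNorm_split`). Hence a sequence that is null on [s₂, r₁] is the sum of a sequence u null on
[s₁, r₁] (take t₀ = r₁) and a sequence v null on [s₂, r₂] (take t₀ = s₂). If x and y are Cauchy on
[s₁, r₁] and [s₂, r₂] and x - y = u + v in this way, then x - u = y + v is Cauchy on both intervals,
so on [s₁, r₂]. Injectivity comes from `gaussNorm_closed`: a sequence that is Cauchy for one norm
and null for another is null for the first.

With an ideal J, equality on [s₂, r₁] only says that x - y - j is null there for some sequence j in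
J, and nothing controls j elsewhere. The remedy is an almost canonical choice of representatives.
The integral kernel of φ is saturated, so a maximal set of monomials that is independent modulo the
kernel and ϖ spans a complement of it, ϖ-adically; let T_i be the projection of T^i to this
complement (`exists_monomial_projection`). The partial sums of f ↦ ∑ f_i T_i increase no Gauss norm,
become small on J, and approximate f modulo J. They yield maps P_n with b - P_n b ∈ J that realize,
up to 1/(n+1) and for all t ≤ n at once, the distance to J (`IsApproxProjection`). Replacing x_n by
P_n(x_n) reduces everything to the case without an ideal (`range_inf_range`, `restrict_injective`).

That the Gauss norms are ultrametric and submultiplicative rests on the homogeneity of Witt vector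
addition: in [x] + [y] = ∑ p^i [z_i] the element z_i^(p^i) is homogeneous of degree p^i in x and y,
so α(z_i) ≤ max(α(x), α(y)). Therefore the elements whose Teichmüller coefficients are bounded by a
nondecreasing sequence form a group (`mem_bounded_iff`), and Gauss norm estimates become membership
statements (`gaussNorm_eq`). -/

theorem specNorm_nonneg (x : R) : 0 ≤ specNorm x :=
  Real.iInf_nonneg fun _ => Real.rpow_nonneg (apply_nonneg _ _) _

theorem specNorm_le_rpow (x : R) {n : ℕ} (hn : 0 < n) :
    specNorm x ≤ ‖x ^ n‖ ^ (1 / (n : ℝ)) :=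
  smoothingFun_le (normRingSeminorm R) x ⟨n, hn⟩

/-- The spectral seminorm is at most `c` if the norms of the powers grow at most like `c ^ n` along
some unbounded sequence of exponents. -/
theorem specNorm_le_of_growth {x : R} {c C : ℝ} (hc : 0 ≤ c) {e : ℕ → ℕ}
    (he : Filter.Tendsto e Filter.atTop Filter.atTop) (h : ∀ m, ‖x ^ e m‖ ≤ C * c ^ e m) :
    specNorm x ≤ c := by
  -- The constant is made positive so that its roots of order e m tend to 1.
  have hC : ∀ m, ‖x ^ e m‖ ≤ max C 1 * c ^ e m := fun m =>
    (h m).trans (mul_le_mul_of_nonneg_right (le_max_left _ _) (pow_nonneg hc _))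
  have hlim : Filter.Tendsto (fun m => (max C 1) ^ (1 / (e m : ℝ)) * c) Filter.atTop
      (nhds ((max C 1) ^ (0 : ℝ) * c)) := by
    refine Filter.Tendsto.mul_const _ (Filter.Tendsto.rpow tendsto_const_nhds ?_ (Or.inl ?_))
    · exact tendsto_one_div_atTop_nhds_zero_nat.comp he
    · exact (lt_of_lt_of_le one_pos (le_max_right _ _)).ne'
  rw [Real.rpow_zero, one_mul] at hlim
  refine ge_of_tendsto hlim ?_
  filter_upwards [he.eventually_gt_atTop 0] with m hm
  refine (specNorm_le_rpow x hm).trans ?_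
  have h1 : (0 : ℝ) ≤ max C 1 := zero_le_one.trans (le_max_right _ _)
  calc ‖x ^ e m‖ ^ (1 / (e m : ℝ)) ≤ (max C 1 * c ^ e m) ^ (1 / (e m : ℝ)) :=
        Real.rpow_le_rpow (norm_nonneg _) (hC m) (by positivity)
    _ = _ := by
        rw [Real.mul_rpow h1 (pow_nonneg hc _), one_div, Real.pow_rpow_inv_natCast hc hm.ne']

/-- Some m satisfies ‖x^m‖ ≤ c^m; dividing n by m with remainder leaves only the finitely many
powers x^i, i < m, to be absorbed in the constant. -/
theorem exists_growth {x : R} {c : ℝ} (hc : specNorm x < c) :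
    ∃ C, 0 ≤ C ∧ ∀ n, ‖x ^ n‖ ≤ C * c ^ n := by
  have hc0 : 0 < c := (specNorm_nonneg x).trans_lt hc
  obtain ⟨m, hm⟩ := exists_lt_of_ciInf_lt hc
  have hm' : ‖x ^ (m : ℕ)‖ ≤ c ^ (m : ℕ) := by
    have h := Real.rpow_le_rpow (Real.rpow_nonneg (apply_nonneg _ _) _) hm.le
      (Nat.cast_nonneg (α := ℝ) (m : ℕ))
    rwa [one_div, Real.rpow_natCast, Real.rpow_natCast, show
      (normRingSeminorm R (x ^ (m : ℕ)) ^ ((m : ℕ) : ℝ)⁻¹) ^ (m : ℕ) = ‖x ^ (m : ℕ)‖ from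
        Real.rpow_inv_natCast_pow (apply_nonneg _ _) m.ne_zero] at h
  let D := ∑ i ∈ Finset.range m, ‖x ^ i‖ / c ^ i
  have hD : 0 ≤ D := Finset.sum_nonneg fun i _ => by positivity
  -- The factor `max ‖1‖ 1` serves the quotient 0, since ‖1‖ ≤ 1 is not assumed.
  refine ⟨max ‖(1 : R)‖ 1 * D, by positivity, fun n => ?_⟩
  have hlt : n % m < m := Nat.mod_lt _ m.pos
  have h1 : ‖x ^ (n % m)‖ ≤ D * c ^ (n % m) := by
    rw [← div_le_iff₀ (pow_pos hc0 _)]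
    exact Finset.single_le_sum (f := fun i => ‖x ^ i‖ / c ^ i) (fun i _ => by positivity)
      (Finset.mem_range.mpr hlt)
  have h2 : ∀ q : ℕ, ‖(x ^ (m : ℕ)) ^ q‖ ≤ max ‖(1 : R)‖ 1 * (c ^ (m : ℕ)) ^ q := by
    intro q
    rcases Nat.eq_zero_or_pos q with rfl | hq
    · simp
    · refine (norm_pow_le' _ hq).trans ?_
      calc ‖x ^ (m : ℕ)‖ ^ q ≤ (c ^ (m : ℕ)) ^ q := pow_le_pow_left₀ (norm_nonneg _) hm' _
        _ ≤ _ := le_mul_of_one_le_left (by positivity) (le_max_right _ _)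
  calc ‖x ^ n‖ = ‖(x ^ (m : ℕ)) ^ (n / m) * x ^ (n % m)‖ := by
        rw [← pow_mul, ← pow_add, Nat.div_add_mod]
    _ ≤ (max ‖(1 : R)‖ 1 * (c ^ (m : ℕ)) ^ (n / m)) * (D * c ^ (n % m)) :=
        (norm_mul_le _ _).trans (mul_le_mul (h2 _) h1 (norm_nonneg _) (by positivity))
    _ = max ‖(1 : R)‖ 1 * D * c ^ (m * (n / m) + n % m) := by rw [pow_add, pow_mul]; ring
    _ = _ := by rw [Nat.div_add_mod]

theorem specNorm_zero : specNorm (0 : R) = 0 := by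
  refine le_antisymm ?_ (specNorm_nonneg _)
  simpa using specNorm_le_rpow (0 : R) one_pos

theorem specNorm_le_one {x : R} (h : ∃ C : ℝ, ∀ n : ℕ, ‖x ^ n‖ ≤ C) : specNorm x ≤ 1 := by
  obtain ⟨C, hC⟩ := h
  exact specNorm_le_of_growth (C := C) zero_le_one Filter.tendsto_id fun m => by simpa using hC m

theorem specNorm_neg (x : R) : specNorm (-x) = specNorm x := by
  have h : ∀ n : ℕ, ‖(-x) ^ n‖ = ‖x ^ n‖ := fun n => by
    rw [neg_pow]
    rcases neg_one_pow_eq_or R n with h | h <;> simp [h]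
  exact iInf_congr fun n => congrArg (· ^ (1 / ((n : ℕ) : ℝ))) (h n)

theorem specNorm_mul_le (x y : R) : specNorm (x * y) ≤ specNorm x * specNorm y := by
  have h : ∀ ε > 0, specNorm (x * y) ≤ (specNorm x + ε) * (specNorm y + ε) := by
    intro ε hε
    obtain ⟨C, hC0, hC⟩ := exists_growth (lt_add_of_pos_right (specNorm x) hε)
    obtain ⟨D, hD0, hD⟩ := exists_growth (lt_add_of_pos_right (specNorm y) hε)
    have hx := specNorm_nonneg x
    have hy := specNorm_nonneg y
    refine specNorm_le_of_growth (C := C * D) (by positivity) Filter.tendsto_id fun m => ?_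
    rw [mul_pow, id, mul_pow]
    calc ‖x ^ m * y ^ m‖ ≤ (C * (specNorm x + ε) ^ m) * (D * (specNorm y + ε) ^ m) :=
          (norm_mul_le _ _).trans (mul_le_mul (hC m) (hD m) (norm_nonneg _) (by positivity))
      _ = _ := by ring
  have hlim : Filter.Tendsto (fun ε : ℝ => (specNorm x + ε) * (specNorm y + ε))
      (nhdsWithin 0 (Set.Ioi 0)) (nhds ((specNorm x + 0) * (specNorm y + 0))) :=
    ((by fun_prop : Continuous fun ε : ℝ => (specNorm x + ε) * (specNorm y + ε)).tendsto 0).mono_left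
      nhdsWithin_le_nhds
  rw [add_zero, add_zero] at hlim
  exact ge_of_tendsto hlim (Filter.eventually_of_mem self_mem_nhdsWithin h)

theorem specNorm_pow (x : R) {n : ℕ} (hn : 0 < n) : specNorm (x ^ n) = specNorm x ^ n := by
  refine le_antisymm ?_ ?_
  · induction n, hn using Nat.le_induction with
    | base => simp
    | succ n _ ih =>
      rw [pow_succ, pow_succ]
      exact (specNorm_mul_le _ _).trans (mul_le_mul_of_nonneg_right ih (specNorm_nonneg _))
  · refine le_ciInf fun m => ?_
    refine (pow_le_pow_left₀ (specNorm_nonneg x) (specNorm_le_rpow x (Nat.mul_pos hn m.pos)) n).trans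
      (le_of_eq ?_)
    change _ = ‖(x ^ n) ^ (m : ℕ)‖ ^ (1 / ((m : ℕ) : ℝ))
    rw [← Real.rpow_natCast, ← Real.rpow_mul (norm_nonneg _), pow_mul]
    congr 1
    have : (n : ℝ) ≠ 0 := by positivity
    have : ((m : ℕ) : ℝ) ≠ 0 := by simp
    push_cast
    field_simp

/-- In characteristic p the binomial expansion of (x + y)^(p^m) has only two terms, and the
exponents p^m suffice to bound the spectral seminorm. -/
theorem specNorm_add_le (p : ℕ) [Fact p.Prime] [CharP R p] [IsUltrametricDist R] (x y : R) :
    specNorm (x + y) ≤ max (specNorm x) (specNorm y) := by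
  refine le_of_forall_gt_imp_ge_of_dense fun c hc => ?_
  obtain ⟨hx, hy⟩ := max_lt_iff.mp hc
  obtain ⟨C, hC0, hC⟩ := exists_growth hx
  obtain ⟨D, hD0, hD⟩ := exists_growth hy
  have hc0 : 0 ≤ c := (specNorm_nonneg x).trans hx.le
  refine specNorm_le_of_growth (C := max C D) (e := fun m => p ^ m) hc0
    (tendsto_pow_atTop_atTop_of_one_lt (Fact.out : p.Prime).one_lt) fun m => ?_
  rw [add_pow_char_pow, max_mul_of_nonneg _ _ (pow_nonneg hc0 _)]
  exact (IsUltrametricDist.norm_add_le_max _ _).trans (max_le_max (hC _) (hD _))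

theorem specNorm_sum_le (p : ℕ) [Fact p.Prime] [CharP R p] [IsUltrametricDist R] {ι : Type*}
    (s : Finset ι) (f : ι → R) {c : ℝ} (hc : 0 ≤ c) (h : ∀ i ∈ s, specNorm (f i) ≤ c) :
    specNorm (∑ i ∈ s, f i) ≤ c := by
  classical
  induction s using Finset.induction_on with
  | empty => simpa [specNorm_zero] using hc
  | insert a s ha ih =>
    rw [Finset.sum_insert ha]
    exact (specNorm_add_le p _ _).trans (max_le (h a (Finset.mem_insert_self a s))
      (ih fun i hi => h i (Finset.mem_insert_of_mem hi)))

end SpecNorm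

/-! ### Homogeneity of Witt vector addition -/

section WittHomogeneous

variable {p : ℕ} [Fact p.Prime]

/-- Write w = [w₀] + V(w') and use the projection formula [a] V(w') = V([a^p] w'); summands with
disjoint supports add coefficientwise. -/
theorem teichmuller_mul_coeff {S : Type*} [CommRing S] [CharP S p] (a : S) (w : WittVector p S)
    (n : ℕ) : (WittVector.teichmuller p a * w).coeff n = a ^ p ^ n * w.coeff n := by
  induction n generalizing a w with
  | zero => simp [WittVector.mul_coeff_zero]
  | succ n ih =>
    have hw : w = WittVector.teichmuller p (w.coeff 0) + WittVector.verschiebung (w.shift 1) := by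
      refine WittVector.ext fun m => ?_
      rw [WittVector.coeff_add_of_disjoint]
      · rcases m with _ | m
        · simp
        · rw [WittVector.teichmuller_coeff_pos _ _ _ m.succ_pos,
            WittVector.verschiebung_coeff_succ, WittVector.shift_coeff, zero_add, Nat.add_comm]
      · intro m
        rcases m with _ | m
        · right; simp
        · left; exact WittVector.teichmuller_coeff_pos _ _ _ m.succ_pos
    have hF : WittVector.frobenius (WittVector.teichmuller p a) =
        WittVector.teichmuller p (a ^ p) := by
      rw [WittVector.frobenius_eq_map_frobenius, WittVector.map_teichmuller]
      rfl
    have key : WittVector.teichmuller p a * w = WittVector.teichmuller p (a * w.coeff 0) +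
        WittVector.verschiebung (WittVector.teichmuller p (a ^ p) * w.shift 1) := by
      conv_lhs => rw [hw]
      rw [mul_add, map_mul, ← hF, mul_comm (WittVector.frobenius _),
        WittVector.verschiebung_mul_frobenius, mul_comm (WittVector.verschiebung _)]
    rw [key, WittVector.coeff_add_of_disjoint]
    · rw [WittVector.teichmuller_coeff_pos _ _ _ n.succ_pos, WittVector.verschiebung_coeff_succ, ih,
        WittVector.shift_coeff, zero_add, ← pow_mul, pow_succ', Nat.add_comm 1]
    · intro m
      rcases m with _ | m
      · right; simp
      · left; exact WittVector.teichmuller_coeff_pos _ _ _ m.succ_pos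

/-- The ring of polynomials whose `m`-th coefficient has spectral seminorm at most `c ^ m`. -/
def spectralRees (p : ℕ) [Fact p.Prime] {R : Type*} [NormedCommRing R] [CharP R p]
    [IsUltrametricDist R] (h1 : specNorm (1 : R) ≤ 1) {c : ℝ} (hc : 0 ≤ c) :
    Subring (Polynomial R) where
  carrier := {f | ∀ m, specNorm (f.coeff m) ≤ c ^ m}
  zero_mem' m := by simpa [specNorm_zero] using pow_nonneg hc m
  one_mem' m := by
    rw [Polynomial.coeff_one]
    split_ifs with h
    · simpa [h] using h1
    · simpa [specNorm_zero] using pow_nonneg hc m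
  add_mem' {f g} hf hg m := by
    rw [Polynomial.coeff_add]
    exact (specNorm_add_le p _ _).trans (max_le (hf m) (hg m))
  neg_mem' {f} hf m := by
    rw [Polynomial.coeff_neg, specNorm_neg]
    exact hf m
  mul_mem' {f g} hf hg m := by
    rw [Polynomial.coeff_mul]
    refine specNorm_sum_le p _ _ (pow_nonneg hc m) fun ij hij => ?_
    rw [← Finset.HasAntidiagonal.mem_antidiagonal.mp hij, pow_add]
    exact (specNorm_mul_le _ _).trans
      (mul_le_mul (hf _) (hg _) (specNorm_nonneg _) (pow_nonneg hc _))

/-- The n-th coefficient of [x] + [y] is homogeneous of degree p^n. This is extracted without the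
addition polynomials: [xX] + [yX] = [X]([x] + [y]) has n-th coefficient X^(p^n) times the
coefficient sought, and the left side has coefficients in the Rees ring, whose condition in degree
p^n is the claim. -/
theorem specNorm_coeff_teichmuller_add_le {R : Type*} [NormedCommRing R] [CharP R p]
    [IsUltrametricDist R] (h1 : specNorm (1 : R) ≤ 1) {c : ℝ} {x y : R} (hx : specNorm x ≤ c)
    (hy : specNorm y ≤ c) (n : ℕ) :
    specNorm ((WittVector.teichmuller p x + WittVector.teichmuller p y).coeff n) ≤ c ^ p ^ n := by
  have hc : 0 ≤ c := (specNorm_nonneg x).trans hx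
  let S := spectralRees p h1 hc
  have mem : ∀ z : R, specNorm z ≤ c → Polynomial.C z * Polynomial.X ∈ S := fun z hz m => by
    rw [Polynomial.coeff_C_mul, Polynomial.coeff_X]
    split_ifs with h
    · simpa [← h] using hz
    · simpa [specNorm_zero] using pow_nonneg hc m
  let w : WittVector p S := WittVector.teichmuller p ⟨_, mem x hx⟩ +
    WittVector.teichmuller p ⟨_, mem y hy⟩
  have hw : WittVector.map S.subtype w = WittVector.teichmuller p Polynomial.X *
      WittVector.map Polynomial.C
        (WittVector.teichmuller p x + WittVector.teichmuller p y) := by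
    rw [map_add, map_add, WittVector.map_teichmuller, WittVector.map_teichmuller,
      WittVector.map_teichmuller, WittVector.map_teichmuller, mul_add, ← map_mul, ← map_mul,
      mul_comm Polynomial.X, mul_comm Polynomial.X]
    rfl
  have hn := congrArg (fun v => (WittVector.coeff v n).coeff (p ^ n)) hw
  simp only [WittVector.map_coeff, teichmuller_mul_coeff] at hn
  rw [mul_comm, Polynomial.coeff_C_mul_X_pow, if_pos rfl] at hn
  rw [← hn]
  exact (w.coeff n).2 (p ^ n)

end WittHomogeneous

end DeformedRobba

end

noncomputable section

namespace DeformedRobba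

/-! ### Intersections of Fréchet completions -/

section AbstractIntersection

variable {B : Type*} [CommRing B]

/-- A family of ultrametric submultiplicative seminorms with the two features of Gauss norms that
glueing uses: closed balls for one seminorm are closed for all others, and every element is
a sum of a part controlled from the right and a part controlled from the left. -/
structure IsGaussFamily (N : ℝ → B → ℝ) : Prop where
  nonneg : ∀ {t}, 0 < t → ∀ x, 0 ≤ N t x
  map_zero : ∀ {t}, 0 < t → N t 0 = 0
  sub_le : ∀ {t}, 0 < t → ∀ x y, N t (x - y) ≤ max (N t x) (N t y)
  mul_le : ∀ {t}, 0 < t → ∀ x y, N t (x * y) ≤ N t x * N t y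
  closed : ∀ {t t₀}, 0 < t → 0 < t₀ → ∀ (x : B) (g : ℕ → B) (δ : ℝ),
    Filter.Tendsto (fun m => N t₀ (g m)) Filter.atTop (nhds 0) → (∀ m, N t (x - g m) ≤ δ) →
      N t x ≤ δ
  split : ∀ e : B, ∃ u v, e = u + v ∧
    (∀ t t₀, 0 < t → t ≤ t₀ → N t u ≤ N t₀ e ^ (t / t₀)) ∧
    (∀ t t₀, 0 < t₀ → t₀ ≤ t → N t v ≤ N t₀ e ^ (t / t₀))

/-- Approximate projections away from an ideal that almost realize the quotient seminorms, for
all seminorms of the family at the same time. -/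
structure IsApproxProjection (N : ℝ → B → ℝ) (J : Ideal B) (P : ℕ → B → B) : Prop where
  map_zero : ∀ n, P n 0 = 0
  sub_mem : ∀ n b, b - P n b ∈ J
  le_max : ∀ (t : ℝ) (n m : ℕ), 0 < t → t ≤ n → t ≤ m → ∀ b b', ∀ j ∈ J,
    N t (P n b - P m b') ≤
      max (max (1 / ((n : ℝ) + 1)) (1 / ((m : ℝ) + 1))) (N t (b - b' - j))

namespace IsGaussFamily

variable {N : ℝ → B → ℝ} {I : Set ℝ}

theorem neg_eq (hN : IsGaussFamily N) {t : ℝ} (ht : 0 < t) (x : B) : N t (-x) = N t x := by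
  have h : ∀ y, N t (-y) ≤ N t y := fun y => by
    simpa [hN.map_zero ht, hN.nonneg ht y] using hN.sub_le ht 0 y
  exact le_antisymm (h x) (by simpa using h (-x))

theorem add_le (hN : IsGaussFamily N) {t : ℝ} (ht : 0 < t) (x y : B) :
    N t (x + y) ≤ max (N t x) (N t y) := by
  simpa [hN.neg_eq ht] using hN.sub_le ht x (-y)

theorem isNullOn_add (hN : IsGaussFamily N) (hI : I ⊆ Set.Ioi 0) {x y : ℕ → B}
    (hx : IsNullOn N I x) (hy : IsNullOn N I y) : IsNullOn N I (x + y) := fun t ht => by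
  have h := (hx t ht).max (hy t ht)
  rw [max_self] at h
  exact squeeze_zero (fun n => hN.nonneg (hI ht) _) (fun n => hN.add_le (hI ht) _ _) h

theorem isCauchyOn_of_isNullOn (hN : IsGaussFamily N) (hI : I ⊆ Set.Ioi 0) {x : ℕ → B}
    (hx : IsNullOn N I x) : IsCauchyOn N I x := fun t ht ε hε => by
  obtain ⟨n₀, h⟩ := Filter.eventually_atTop.mp ((hx t ht).eventually_lt_const hε)
  exact ⟨n₀, fun m hm n hn => (hN.sub_le (hI ht) _ _).trans_lt (max_lt (h m hm) (h n hn))⟩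

theorem isCauchyOn_add (hN : IsGaussFamily N) (hI : I ⊆ Set.Ioi 0) {x y : ℕ → B}
    (hx : IsCauchyOn N I x) (hy : IsCauchyOn N I y) : IsCauchyOn N I (x + y) := fun t ht ε hε => by
  obtain ⟨a, ha⟩ := hx t ht ε hε
  obtain ⟨b, hb⟩ := hy t ht ε hε
  refine ⟨max a b, fun m hm n hn => ?_⟩
  rw [Pi.add_apply, Pi.add_apply, add_sub_add_comm]
  exact (hN.add_le (hI ht) _ _).trans_lt (max_lt
    (ha m (le_of_max_le_left hm) n (le_of_max_le_left hn))
    (hb m (le_of_max_le_right hm) n (le_of_max_le_right hn)))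

theorem isCauchyOn_neg (hN : IsGaussFamily N) (hI : I ⊆ Set.Ioi 0) {x : ℕ → B}
    (hx : IsCauchyOn N I x) : IsCauchyOn N I (-x) := fun t ht ε hε => by
  obtain ⟨a, ha⟩ := hx t ht ε hε
  refine ⟨a, fun m hm n hn => ?_⟩
  rw [Pi.neg_apply, Pi.neg_apply, ← neg_sub', hN.neg_eq (hI ht)]
  exact ha m hm n hn

theorem isCauchyOn_const (hN : IsGaussFamily N) (hI : I ⊆ Set.Ioi 0) (b : B) :
    IsCauchyOn N I (fun _ => b) := fun t ht ε hε =>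
  ⟨0, fun _ _ _ _ => by simpa [hN.map_zero (hI ht)] using hε⟩

theorem exists_bound (hN : IsGaussFamily N) (hI : I ⊆ Set.Ioi 0) {x : ℕ → B}
    (hx : IsCauchyOn N I x) {t : ℝ} (ht : t ∈ I) :
    ∃ C > 0, ∃ n₀, ∀ n ≥ n₀, N t (x n) ≤ C := by
  obtain ⟨a, ha⟩ := hx t ht 1 one_pos
  refine ⟨max 1 (N t (x a)), lt_max_of_lt_left one_pos, a, fun n hn => ?_⟩
  have h := hN.add_le (hI ht) (x n - x a) (x a)
  rw [sub_add_cancel] at h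
  exact h.trans (max_le_max (ha n hn a le_rfl).le le_rfl)

theorem isCauchyOn_mul (hN : IsGaussFamily N) (hI : I ⊆ Set.Ioi 0) {x y : ℕ → B}
    (hx : IsCauchyOn N I x) (hy : IsCauchyOn N I y) : IsCauchyOn N I (x * y) := fun t ht ε hε => by
  obtain ⟨C, hC, a, ha⟩ := hN.exists_bound hI hx ht
  obtain ⟨D, hD, b, hb⟩ := hN.exists_bound hI hy ht
  obtain ⟨a', ha'⟩ := hx t ht (ε / D) (by positivity)
  obtain ⟨b', hb'⟩ := hy t ht (ε / C) (by positivity)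
  refine ⟨max (max a b) (max a' b'), fun m hm n hn => ?_⟩
  simp only [ge_iff_le, max_le_iff] at hm hn
  have e : (x * y) m - (x * y) n = x m * (y m - y n) + (x m - x n) * y n := by
    simp only [Pi.mul_apply]; ring
  rw [e]
  refine (hN.add_le (hI ht) _ _).trans_lt (max_lt ?_ ?_)
  · refine (hN.mul_le (hI ht) _ _).trans_lt ?_
    calc N t (x m) * N t (y m - y n) ≤ C * N t (y m - y n) :=
          mul_le_mul_of_nonneg_right (ha m hm.1.1) (hN.nonneg (hI ht) _)
      _ < C * (ε / C) := mul_lt_mul_of_pos_left (hb' m hm.2.2 n hn.2.2) hC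
      _ = ε := mul_div_cancel₀ _ hC.ne'
  · refine (hN.mul_le (hI ht) _ _).trans_lt ?_
    calc N t (x m - x n) * N t (y n) ≤ N t (x m - x n) * D :=
          mul_le_mul_of_nonneg_left (hb n hn.1.2) (hN.nonneg (hI ht) _)
      _ < ε / D * D := mul_lt_mul_of_pos_right (ha' m hm.2.1 n hn.2.1) hD
      _ = ε := div_mul_cancel₀ _ hD.ne'

theorem mem_cauchyRing (hN : IsGaussFamily N) (hI : I ⊆ Set.Ioi 0) {x : ℕ → B} :
    x ∈ cauchyRing N I ↔ IsCauchyOn N I x := by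
  refine ⟨fun h => ?_, fun h => Subring.subset_closure h⟩
  let S : Subring (ℕ → B) :=
    { carrier := {x | IsCauchyOn N I x}
      zero_mem' := hN.isCauchyOn_const hI 0
      one_mem' := hN.isCauchyOn_const hI 1
      add_mem' := hN.isCauchyOn_add hI
      neg_mem' := hN.isCauchyOn_neg hI
      mul_mem' := hN.isCauchyOn_mul hI }
  exact (Subring.closure_le (t := S)).mpr (fun _ h => h) h

theorem mem_nullIdeal (hN : IsGaussFamily N) (hI : I ⊆ Set.Ioi 0) {x : cauchyRing N I} :
    x ∈ nullIdeal N I ↔ IsNullOn N I x.1 := by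
  refine ⟨fun h => ?_, fun h => Ideal.subset_span h⟩
  let S : Ideal (cauchyRing N I) :=
    { carrier := {x | IsNullOn N I x.1}
      zero_mem' := fun t ht => by
        simp [hN.map_zero (hI ht)]
      add_mem' := hN.isNullOn_add hI
      smul_mem' := fun c x hx t ht => by
        obtain ⟨C, hC, a, ha⟩ := hN.exists_bound hI ((hN.mem_cauchyRing hI).mp c.2) ht
        have h := (hx t ht).const_mul C
        rw [mul_zero] at h
        refine squeeze_zero' (Filter.Eventually.of_forall fun n => hN.nonneg (hI ht) _) ?_ h
        filter_upwards [Filter.eventually_ge_atTop a] with n hn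
        exact (hN.mul_le (hI ht) _ _).trans
          (mul_le_mul_of_nonneg_right (ha n hn) (hN.nonneg (hI ht) _)) }
  exact (Ideal.span_le (I := S)).mpr (fun _ h => h) h

end IsGaussFamily

/-- The class of a Cauchy sequence in the completed quotient. -/
def CompletedQuotient.mk (N : ℝ → B → ℝ) (J : Ideal B) (I : Set ℝ) :
    cauchyRing N I →+* CompletedQuotient N J I :=
  (Ideal.Quotient.mk (closedIdeal N I J)).comp (FrechetCompletion.mk N I)

theorem CompletedQuotient.mk_surjective (N : ℝ → B → ℝ) (J : Ideal B) (I : Set ℝ) :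
    Function.Surjective (CompletedQuotient.mk N J I) :=
  Ideal.Quotient.mk_surjective.comp Ideal.Quotient.mk_surjective

theorem CompletedQuotient.restrict_mk (N : ℝ → B → ℝ) (J : Ideal B) {I I' : Set ℝ} (h : I' ⊆ I)
    (x : cauchyRing N I) :
    CompletedQuotient.restrict N h J (CompletedQuotient.mk N J I x) =
      CompletedQuotient.mk N J I' (Subring.inclusion (cauchyRing_mono N h) x) :=
  (Ideal.quotientMap_mk).trans
    (congrArg (Ideal.Quotient.mk (closedIdeal N I' J)) (FrechetCompletion.restrict_mk N h x))

variable {N : ℝ → B → ℝ} {J : Ideal B} {I I' : Set ℝ}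

/-- Classes of Cauchy sequences in J already form an ideal, because multiplication by a Cauchy
sequence is termwise; so the span in `closedIdeal` adds nothing. -/
theorem CompletedQuotient.mk_eq_zero_iff (hN : IsGaussFamily N) (hI : I ⊆ Set.Ioi 0)
    {x : cauchyRing N I} : CompletedQuotient.mk N J I x = 0 ↔
      ∃ j : ℕ → B, (∀ n, j n ∈ J) ∧ IsNullOn N I (x.1 - j) := by
  have key : ∀ z, z ∈ closedIdeal N I J ↔
      ∃ y : cauchyRing N I, FrechetCompletion.mk N I y = z ∧ ∀ n, y.1 n ∈ J := by
    intro z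
    refine ⟨fun h => ?_, fun h => Ideal.subset_span h⟩
    let S : Ideal (FrechetCompletion N I) :=
      { carrier := {z | ∃ y : cauchyRing N I, FrechetCompletion.mk N I y = z ∧ ∀ n, y.1 n ∈ J}
        zero_mem' := ⟨0, map_zero _, fun n => J.zero_mem⟩
        add_mem' := by
          rintro _ _ ⟨y, rfl, hy⟩ ⟨y', rfl, hy'⟩
          exact ⟨y + y', map_add _ _ _, fun n => J.add_mem (hy n) (hy' n)⟩
        smul_mem' := by
          rintro c _ ⟨y, rfl, hy⟩
          obtain ⟨c, rfl⟩ := Ideal.Quotient.mk_surjective c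
          exact ⟨c * y, map_mul _ _ _, fun n => J.mul_mem_left _ (hy n)⟩ }
    exact (Ideal.span_le (I := S)).mpr (fun _ h => h) h
  have hmk : ∀ y : cauchyRing N I, FrechetCompletion.mk N I y = FrechetCompletion.mk N I x ↔
      IsNullOn N I (x.1 - y.1) := fun y => by
    rw [eq_comm]
    exact (Ideal.Quotient.mk_eq_mk_iff_sub_mem x y).trans (hN.mem_nullIdeal hI)
  refine (Ideal.Quotient.eq_zero_iff_mem (I := closedIdeal N I J)).trans ((key _).trans ?_)
  constructor
  · rintro ⟨y, hy, hyJ⟩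
    exact ⟨y.1, hyJ, (hmk y).mp hy⟩
  · rintro ⟨j, hj, hnull⟩
    have hjC : j ∈ cauchyRing N I := by
      rw [← sub_sub_cancel x.1 j]
      exact sub_mem x.2 ((hN.mem_cauchyRing hI).mpr (hN.isCauchyOn_of_isNullOn hI hnull))
    exact ⟨⟨j, hjC⟩, (hmk _).mpr hnull, hj⟩

theorem CompletedQuotient.restrict_mk_eq_iff (hN : IsGaussFamily N) {I₁ I₂ : Set ℝ}
    (hI : I ⊆ Set.Ioi 0) (h₁ : I ⊆ I₁) (h₂ : I ⊆ I₂) (x : cauchyRing N I₁) (y : cauchyRing N I₂) :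
    CompletedQuotient.restrict N h₁ J (CompletedQuotient.mk N J I₁ x) =
        CompletedQuotient.restrict N h₂ J (CompletedQuotient.mk N J I₂ y) ↔
      ∃ j : ℕ → B, (∀ n, j n ∈ J) ∧ IsNullOn N I (x.1 - y.1 - j) := by
  rw [CompletedQuotient.restrict_mk, CompletedQuotient.restrict_mk, ← sub_eq_zero, ← map_sub,
    CompletedQuotient.mk_eq_zero_iff hN hI]
  rfl

/-- For large n all differences x_n - x_m with m large lie in a small ball for t, while x_m tends to
0 for t₀; the ball being closed for t₀, it contains x_n. This replaces injectivity of the map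
between completions. -/
theorem IsGaussFamily.isNullOn_of_isCauchyOn (hN : IsGaussFamily N) (hI : I ⊆ Set.Ioi 0)
    {x : ℕ → B} (hx : IsCauchyOn N I x) {t₀ : ℝ} (ht₀ : 0 < t₀)
    (h : Filter.Tendsto (fun n => N t₀ (x n)) Filter.atTop (nhds 0)) : IsNullOn N I x := by
  intro t ht
  refine Metric.tendsto_atTop.mpr fun ε hε => ?_
  obtain ⟨n₀, hn₀⟩ := hx t ht (ε / 2) (by positivity)
  refine ⟨n₀, fun n hn => ?_⟩
  have hle : N t (x n) ≤ ε / 2 := hN.closed (hI ht) ht₀ (x n) (fun m => x (m + n₀)) (ε / 2)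
    (h.comp (Filter.tendsto_add_atTop_nat n₀))
    fun m => (hn₀ n hn (m + n₀) (Nat.le_add_left _ _)).le
  rw [Real.dist_eq, sub_zero, abs_of_nonneg (hN.nonneg (hI ht) _)]
  linarith

/-! ### Injectivity and glueing from approximate projections -/

namespace IsApproxProjection

variable {P : ℕ → B → B}

theorem tendsto_error : Filter.Tendsto (fun n : ℕ => 1 / ((n : ℝ) + 1)) Filter.atTop (nhds 0) :=
  tendsto_one_div_add_atTop_nhds_zero_nat

theorem isCauchyOn (hP : IsApproxProjection N J P) (hI : I ⊆ Set.Ioi 0) {x : ℕ → B}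
    (hx : IsCauchyOn N I x) : IsCauchyOn N I (fun n => P n (x n)) := fun t ht ε hε => by
  obtain ⟨a, ha⟩ := hx t ht ε hε
  obtain ⟨b, hb⟩ := Filter.eventually_atTop.mp (tendsto_error.eventually_lt_const hε)
  obtain ⟨c, hc⟩ := exists_nat_ge t
  refine ⟨max (max a b) c, fun m hm n hn => ?_⟩
  simp only [ge_iff_le, max_le_iff] at hm hn
  refine (hP.le_max t m n (hI ht) (hc.trans (Nat.cast_le.mpr hm.2))
    (hc.trans (Nat.cast_le.mpr hn.2)) _ _ 0 J.zero_mem).trans_lt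
    (max_lt (max_lt (hb m hm.1.2) (hb n hn.1.2)) ?_)
  rw [sub_zero]
  exact ha m hm.1.1 n hn.1.1

/-- The sequence j disappears from the conclusion because P realizes the distance to J, up to an
error tending to 0. -/
theorem isNullOn_sub (hP : IsApproxProjection N J P) (hN : IsGaussFamily N) (hI : I ⊆ Set.Ioi 0)
    {x y j : ℕ → B} (hj : ∀ n, j n ∈ J) (h : IsNullOn N I (x - y - j)) :
    IsNullOn N I (fun n => P n (x n) - P n (y n)) := fun t ht => by
  obtain ⟨c, hc⟩ := exists_nat_ge t
  have hlim := tendsto_error.max (h t ht)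
  rw [max_self] at hlim
  refine squeeze_zero' (Filter.Eventually.of_forall fun n => hN.nonneg (hI ht) _) ?_ hlim
  filter_upwards [Filter.eventually_ge_atTop c] with n hn
  have hn' := hc.trans (Nat.cast_le.mpr hn)
  simpa using hP.le_max t n n (hI ht) hn' hn' (x n) (y n) (j n) (hj n)

/-- If x vanishes on I', then P_n(x_n) is null there while it is Cauchy on I, hence null on I. So x
differs from the sequence x_n - P_n(x_n) in J by a null sequence. -/
theorem restrict_injective (hP : IsApproxProjection N J P) (hN : IsGaussFamily N)
    (hI : I ⊆ Set.Ioi 0) (h : I' ⊆ I) (hne : I'.Nonempty) :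
    Function.Injective (CompletedQuotient.restrict N h J) := by
  refine (injective_iff_map_eq_zero _).mpr fun z hz => ?_
  obtain ⟨x, rfl⟩ := CompletedQuotient.mk_surjective N J I z
  rw [CompletedQuotient.restrict_mk, CompletedQuotient.mk_eq_zero_iff hN (h.trans hI)] at hz
  obtain ⟨j, hj, hnull⟩ := hz
  rw [Subring.coe_inclusion] at hnull
  obtain ⟨t₀, ht₀⟩ := hne
  have hx : IsCauchyOn N I (fun n => P n (x.1 n)) :=
    hP.isCauchyOn hI ((hN.mem_cauchyRing hI).mp x.2)
  have h0 := hP.isNullOn_sub hN (h.trans hI) (y := 0) hj (by simpa using hnull) t₀ ht₀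
  simp only [Pi.zero_apply, hP.map_zero, sub_zero] at h0
  refine (CompletedQuotient.mk_eq_zero_iff hN hI).mpr
    ⟨fun n => x.1 n - P n (x.1 n), fun n => hP.sub_mem n _, ?_⟩
  convert hN.isNullOn_of_isCauchyOn hI hx (hI (h ht₀)) h0 using 1
  funext n
  simp

theorem range_inf_range (hP : IsApproxProjection N J P) (hN : IsGaussFamily N)
    {s₁ s₂ r₁ r₂ : ℝ} (h0 : 0 < s₁) (h1 : s₁ ≤ s₂) (h2 : s₂ ≤ r₁) (h3 : r₁ ≤ r₂) :
    (CompletedQuotient.restrict N (Set.Icc_subset_Icc_left h1 :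
      Set.Icc s₂ r₁ ⊆ Set.Icc s₁ r₁) J).range ⊓
    (CompletedQuotient.restrict N (Set.Icc_subset_Icc_right h3 :
      Set.Icc s₂ r₁ ⊆ Set.Icc s₂ r₂) J).range =
    (CompletedQuotient.restrict N (Set.Icc_subset_Icc h1 h3 :
      Set.Icc s₂ r₁ ⊆ Set.Icc s₁ r₂) J).range := by
  have pos : ∀ {a b : ℝ}, s₁ ≤ a → Set.Icc a b ⊆ Set.Ioi 0 := fun ha t ht =>
    h0.trans_le (ha.trans ht.1)
  have hs₂ : 0 < s₂ := h0.trans_le h1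
  have hr₁ : 0 < r₁ := hs₂.trans_le h2
  have null : ∀ x : ℕ → B, IsNullOn N (Set.Icc s₂ r₁) (x - x - 0) := fun x t ht => by
    simp [hN.map_zero (pos h1 ht)]
  apply le_antisymm
  · rintro z ⟨⟨z₁, hz₁⟩, ⟨z₂, hz₂⟩⟩
    obtain ⟨x, rfl⟩ := CompletedQuotient.mk_surjective N J _ z₁
    obtain ⟨y, rfl⟩ := CompletedQuotient.mk_surjective N J _ z₂
    have hxC := (hN.mem_cauchyRing (pos le_rfl)).mp x.2
    have hyC := (hN.mem_cauchyRing (pos h1)).mp y.2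
    have heq := hz₁.trans hz₂.symm
    rw [CompletedQuotient.restrict_mk_eq_iff hN (pos h1)] at heq
    obtain ⟨j, hj, hnull⟩ := heq
    have he := hP.isNullOn_sub hN (pos h1) (x := x.1) (y := y.1) hj hnull
    choose u v huv hu hv using hN.split
    let e : ℕ → B := fun n => P n (x.1 n) - P n (y.1 n)
    have hlim : ∀ t t₀, 0 < t → t₀ ∈ Set.Icc s₂ r₁ →
        Filter.Tendsto (fun n => N t₀ (e n) ^ (t / t₀)) Filter.atTop (nhds 0) := by
      intro t t₀ ht ht₀
      have hpos : 0 < t / t₀ := div_pos ht (pos h1 ht₀)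
      have h := (he t₀ ht₀).rpow_const (p := t / t₀) (Or.inr hpos.le)
      rwa [Real.zero_rpow hpos.ne'] at h
    have hu0 : IsNullOn N (Set.Icc s₁ r₁) (fun n => u (e n)) := fun t ht =>
      squeeze_zero (fun n => hN.nonneg (pos le_rfl ht) _)
        (fun n => hu (e n) t r₁ (pos le_rfl ht) ht.2)
        (hlim t r₁ (pos le_rfl ht) ⟨h2, le_rfl⟩)
    have hv0 : IsNullOn N (Set.Icc s₂ r₂) (fun n => v (e n)) := fun t ht =>
      squeeze_zero (fun n => hN.nonneg (pos h1 ht) _)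
        (fun n => hv (e n) t s₂ hs₂ ht.1) (hlim t s₂ (pos h1 ht) ⟨le_rfl, h2⟩)
    -- The common representative: P x - u(e) is Cauchy on the left interval, and it equals P y +
    -- v(e), which is Cauchy on the right one.
    let w : ℕ → B := (fun n => P n (x.1 n)) + -(fun n => u (e n))
    have hw : w = (fun n => P n (y.1 n)) + (fun n => v (e n)) := by
      funext n
      have h := huv (e n)
      simp only [w, e, Pi.add_apply, Pi.neg_apply] at h ⊢
      linear_combination h
    have hw₁ : IsCauchyOn N (Set.Icc s₁ r₁) w :=
      hN.isCauchyOn_add (pos le_rfl) (hP.isCauchyOn (pos le_rfl) hxC)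
        (hN.isCauchyOn_neg (pos le_rfl) (hN.isCauchyOn_of_isNullOn (pos le_rfl) hu0))
    have hw₂ : IsCauchyOn N (Set.Icc s₂ r₂) w := by
      rw [hw]
      exact hN.isCauchyOn_add (pos h1) (hP.isCauchyOn (pos h1) hyC)
        (hN.isCauchyOn_of_isNullOn (pos h1) hv0)
    have hwC : w ∈ cauchyRing N (Set.Icc s₁ r₂) := (hN.mem_cauchyRing (pos le_rfl)).mpr fun t ht =>
      (le_total t r₁).elim (fun h => hw₁ t ⟨ht.1, h⟩) (fun h => hw₂ t ⟨h2.trans h, ht.2⟩)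
    refine ⟨CompletedQuotient.mk N J _ ⟨w, hwC⟩, ?_⟩
    rw [← hz₁, eq_comm]
    -- Here x - w = (x - P x) + u(e), with first summand in J and second summand null.
    refine (CompletedQuotient.restrict_mk_eq_iff hN (pos h1) _ _ _ _).mpr
      ⟨fun n => x.1 n - P n (x.1 n), fun n => hP.sub_mem n _, ?_⟩
    intro t ht
    convert hu0 t ⟨h1.trans ht.1, ht.2⟩ using 3 with n
    simp only [w, Pi.sub_apply, Pi.add_apply, Pi.neg_apply]
    ring
  · rintro _ ⟨z, rfl⟩
    obtain ⟨x, rfl⟩ := CompletedQuotient.mk_surjective N J _ z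
    exact ⟨⟨CompletedQuotient.mk N J _ (Subring.inclusion
        (cauchyRing_mono N (Set.Icc_subset_Icc_right h3)) x),
        (CompletedQuotient.restrict_mk_eq_iff hN (pos h1) _ _ _ _).mpr
          ⟨0, fun _ => J.zero_mem, null _⟩⟩,
      ⟨CompletedQuotient.mk N J _ (Subring.inclusion
        (cauchyRing_mono N (Set.Icc_subset_Icc_left h1)) x),
        (CompletedQuotient.restrict_mk_eq_iff hN (pos h1) _ _ _ _).mpr
          ⟨0, fun _ => J.zero_mem, null _⟩⟩⟩

end IsApproxProjection

end AbstractIntersection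

end DeformedRobba

end

noncomputable section

set_option linter.unusedSectionVars false

namespace DeformedRobba

/-! ### Completions at principal ideals -/

section PrincipalCompletion

variable {A : Type*} [CommRing A]

theorem algebraMap_dvd_of_evalOneₐ_eq_zero (a : A) (w : AdicCompletion (Ideal.span {a}) A)
    (hw : AdicCompletion.evalOneₐ (Ideal.span {a}) w = 0) :
    algebraMap A (AdicCompletion (Ideal.span {a}) A) a ∣ w := by
  have h : w ∈ RingHom.ker (AdicCompletion.evalOneₐ (Ideal.span {a})).toRingHom := hw
  rw [AdicCompletion.ker_evalOneₐ_eq_map _ ⟨{a}, by simp⟩, Ideal.map_span,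
    Set.image_singleton] at h
  exact Ideal.mem_span_singleton.mp h

/-- If a c_(n+1) is divisible by a^(n+1), then c_(n+1) is divisible by a^n. Cancelling a costs one
level, so vanishing at level n is read off from level n + 1. -/
theorem algebraMap_mul_eq_zero {a : A} (ha : ∀ z, a * z = 0 → z = 0)
    (w : AdicCompletion (Ideal.span {a}) A)
    (hw : algebraMap A (AdicCompletion (Ideal.span {a}) A) a * w = 0) : w = 0 := by
  obtain ⟨c, hc⟩ : ∃ c : AdicCompletion.AdicCauchySequence (Ideal.span {a}) A,
      ∀ n, AdicCompletion.evalₐ (Ideal.span {a}) n w = Ideal.Quotient.mk _ (c.1 n) := by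
    obtain ⟨c, hc⟩ := AdicCompletion.mk_surjective (Ideal.span {a}) A w
    exact ⟨c, fun n => hc ▸ AdicCompletion.evalₐ_mk _ n c⟩
  refine AdicCompletion.ext_evalₐ fun n => ?_
  have h := congrArg (AdicCompletion.evalₐ (Ideal.span {a}) (n + 1)) hw
  rw [map_mul, map_zero, hc, show AdicCompletion.evalₐ (Ideal.span {a}) (n + 1)
    (algebraMap A _ a) = Ideal.Quotient.mk _ a from AdicCompletion.evalₐ_of _ _ _, ← map_mul,
    Ideal.Quotient.eq_zero_iff_mem, Ideal.span_singleton_pow, Ideal.mem_span_singleton] at h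
  obtain ⟨y, hy⟩ := h
  have hy' : c.1 (n + 1) = a ^ n * y := by
    rw [← sub_eq_zero]
    refine ha _ ?_
    rw [mul_sub, hy]
    ring
  rw [map_zero, hc, ← AdicCompletion.Ideal.mk_eq_mk _ n.le_succ c,
    Ideal.Quotient.eq_zero_iff_mem, hy']
  exact Ideal.mul_mem_right _ _ (Ideal.pow_mem_pow (Ideal.mem_span_singleton_self _) n)

end PrincipalCompletion

/-! ### The structure of generalized Witt vectors -/

section GenWittStructure

attribute [local instance] wittAlgebra

variable {p : ℕ} [Fact p.Prime] {k : Type*} [Field k] [CharP k p] [PerfectRing k p]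
  {O : Type*} [CommRing O] [IsDomain O] [IsDiscreteValuationRing O] [Algebra (WittVector p k) O]
  {π : O} {R : Type*} [CommRing R] [Algebra k R] [CharP R p] [PerfectRing R p]

theorem exists_eq_teichmuller_add_mul {S : Type*} [CommRing S] [CharP S p] [PerfectRing S p]
    (w : WittVector p S) : ∃ w', w = WittVector.teichmuller p (w.coeff 0) + p * w' := by
  have h : (w - WittVector.teichmuller p (w.coeff 0)).coeff 0 = 0 := by
    refine (map_sub (WittVector.constantCoeff (p := p) (R := S)) _ _).trans (sub_eq_zero.mpr ?_)
    exact (WittVector.teichmuller_coeff_zero p _).symm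
  rw [← WittVector.mem_span_p_iff_coeff_zero_eq_zero, Ideal.mem_span_singleton] at h
  obtain ⟨w', h⟩ := h
  exact ⟨w', by rw [← h]; ring⟩

theorem ker_residue_comp_algebraMap
    (hk : Function.Surjective ((IsLocalRing.residue O).comp (algebraMap (WittVector p k) O))) :
    RingHom.ker ((IsLocalRing.residue O).comp (algebraMap (WittVector p k) O)) =
      RingHom.ker (WittVector.constantCoeff (p := p) (R := k)) := by
  exact (IsLocalRing.eq_maximalIdeal (RingHom.ker_isMaximal_of_surjective _ hk)).trans
    (IsLocalRing.eq_maximalIdeal (RingHom.ker_isMaximal_of_surjective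
      (WittVector.constantCoeff (p := p) (R := k)) (WittVector.constantCoeff_surjective p))).symm

theorem exists_natCast_eq_mul
    (hk : Function.Surjective ((IsLocalRing.residue O).comp (algebraMap (WittVector p k) O)))
    (hπ : Irreducible π) : ∃ q : O, (p : O) = π * q := by
  have h : (p : WittVector p k) ∈ RingHom.ker (WittVector.constantCoeff (p := p) (R := k)) := by
    rw [RingHom.mem_ker, map_natCast, CharP.cast_eq_zero]
  rw [← ker_residue_comp_algebraMap hk, RingHom.mem_ker, RingHom.comp_apply, map_natCast,
    IsLocalRing.residue_eq_zero_iff, hπ.maximalIdeal_eq, Ideal.mem_span_singleton] at h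
  exact h

theorem exists_eq_algebraMap_teichmuller_add
    (hk : Function.Surjective ((IsLocalRing.residue O).comp (algebraMap (WittVector p k) O)))
    (hπ : Irreducible π) (a : O) :
    ∃ (c : k) (a' : O),
      a = algebraMap (WittVector p k) O (WittVector.teichmuller p c) + π * a' := by
  obtain ⟨w, hw⟩ := hk (IsLocalRing.residue O a)
  obtain ⟨w', hw'⟩ := exists_eq_teichmuller_add_mul w
  obtain ⟨q, hq⟩ := exists_natCast_eq_mul hk hπ
  rw [RingHom.comp_apply, eq_comm, ← sub_eq_zero, ← map_sub, IsLocalRing.residue_eq_zero_iff,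
    hπ.maximalIdeal_eq, Ideal.mem_span_singleton] at hw
  obtain ⟨b, hb⟩ := hw
  refine ⟨w.coeff 0, b + q * algebraMap (WittVector p k) O w', ?_⟩
  have h := congrArg (algebraMap (WittVector p k) O) hw'
  rw [map_add, map_mul, map_natCast, hq] at h
  linear_combination hb + h

theorem PreWitt.ofWitt_map (w : WittVector p k) :
    PreWitt.ofWitt p k O R (WittVector.map (algebraMap k R) w) =
      PreWitt.base p k R (algebraMap (WittVector p k) O w) := by
  change (algebraMap (WittVector p k) (WittVector p R) w) ⊗ₜ[WittVector p k] (1 : O) =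
    (1 : WittVector p R) ⊗ₜ[WittVector p k] (algebraMap (WittVector p k) O w)
  rw [Algebra.algebraMap_eq_smul_one, Algebra.algebraMap_eq_smul_one, TensorProduct.smul_tmul]

/-- Modulo π a scalar b ∈ O is a Teichmüller element [c] with c ∈ k, which moves across the tensor
sign; this leaves an element of W(R), which is Teichmüller modulo p, and p is a multiple of π. -/
theorem PreWitt.exists_eq_ofWitt_teichmuller_add
    (hk : Function.Surjective ((IsLocalRing.residue O).comp (algebraMap (WittVector p k) O)))
    (hπ : Irreducible π) (z : PreWitt p k O R) :
    ∃ (x : R) (z' : PreWitt p k O R),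
      z = PreWitt.ofWitt p k O R (WittVector.teichmuller p x) + PreWitt.base p k R π * z' := by
  have key : ∃ (a : WittVector p R) (z' : PreWitt p k O R),
      z = PreWitt.ofWitt p k O R a + PreWitt.base p k R π * z' := by
    induction z using TensorProduct.induction_on with
    | zero => exact ⟨0, 0, by rw [map_zero, mul_zero, add_zero]; rfl⟩
    | tmul a b =>
      obtain ⟨c, b', hb⟩ := exists_eq_algebraMap_teichmuller_add hk hπ b
      have e : ∀ b : O, (a ⊗ₜ[WittVector p k] b : WittVector p R ⊗[WittVector p k] O) =
          (PreWitt.ofWitt p k O R a * PreWitt.base p k R b : PreWitt p k O R) := fun b => by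
        change _ = (a ⊗ₜ[WittVector p k] (1 : O)) * ((1 : WittVector p R) ⊗ₜ[WittVector p k] b)
        rw [Algebra.TensorProduct.tmul_mul_tmul, mul_one, one_mul]
      refine ⟨a * WittVector.map (algebraMap k R) (WittVector.teichmuller p c),
        PreWitt.ofWitt p k O R a * PreWitt.base p k R b', ?_⟩
      suffices h : PreWitt.ofWitt p k O R a * PreWitt.base p k R b =
          PreWitt.ofWitt p k O R (a * WittVector.map (algebraMap k R)
            (WittVector.teichmuller p c)) +
          PreWitt.base p k R π * (PreWitt.ofWitt p k O R a * PreWitt.base p k R b') from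
        (e b).trans h
      rw [map_mul, PreWitt.ofWitt_map, hb, map_add, map_mul (PreWitt.base p k R) π b']
      ring
    | add z₁ z₂ h₁ h₂ =>
      obtain ⟨a₁, z₁', h₁⟩ := h₁
      obtain ⟨a₂, z₂', h₂⟩ := h₂
      refine ⟨a₁ + a₂, z₁' + z₂', ?_⟩
      rw [map_add, mul_add, add_add_add_comm, ← h₁, ← h₂]
      rfl
  obtain ⟨a, z', hz⟩ := key
  obtain ⟨a', ha⟩ := exists_eq_teichmuller_add_mul a
  obtain ⟨q, hq⟩ := exists_natCast_eq_mul hk hπ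
  refine ⟨a.coeff 0, z' + PreWitt.base p k R q * PreWitt.ofWitt p k O R a', ?_⟩
  have hp : (p : PreWitt p k O R) = PreWitt.base p k R π * PreWitt.base p k R q := by
    rw [← map_mul, ← hq, map_natCast]
  have h := congrArg (PreWitt.ofWitt p k O R) ha
  rw [map_add, map_mul, map_natCast, hp] at h
  rw [hz]
  linear_combination h

/-- The map is w ⊗ a ↦ w₀ θ(a), where θ is the reduction O → k through the residue field. It is
W(k)-bilinear because θ restricts to the constant coefficient on W(k). -/
theorem PreWitt.exists_reduction
    (hk : Function.Surjective ((IsLocalRing.residue O).comp (algebraMap (WittVector p k) O)))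
    (hπ : Irreducible π) :
    ∃ f : PreWitt p k O R →+* R,
      (∀ x, f (PreWitt.ofWitt p k O R (WittVector.teichmuller p x)) = x) ∧
      f (PreWitt.base p k R π) = 0 := by
  let ψ := (IsLocalRing.residue O).comp (algebraMap (WittVector p k) O)
  let θ : O →+* k := (RingHom.liftOfSurjective ψ hk
    ⟨WittVector.constantCoeff, (ker_residue_comp_algebraMap hk).le⟩).comp (IsLocalRing.residue O)
  have hθ : ∀ w, θ (algebraMap (WittVector p k) O w) = WittVector.constantCoeff w := fun w =>
    RingHom.liftOfSurjective_comp_apply ψ hk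
      ⟨WittVector.constantCoeff, (ker_residue_comp_algebraMap hk).le⟩ w
  let _ : Algebra (WittVector p k) R :=
    ((algebraMap k R).comp WittVector.constantCoeff).toAlgebra
  let f₁ : WittVector p R →ₐ[WittVector p k] R :=
    { WittVector.constantCoeff with commutes' := fun w => WittVector.map_coeff _ _ _ }
  let f₂ : O →ₐ[WittVector p k] R :=
    { (algebraMap k R).comp θ with commutes' := fun w => congrArg (algebraMap k R) (hθ w) }
  refine ⟨(Algebra.TensorProduct.productMap f₁ f₂).toRingHom, fun x => ?_, ?_⟩
  · change Algebra.TensorProduct.productMap f₁ f₂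
      ((WittVector.teichmuller p x) ⊗ₜ[WittVector p k] (1 : O)) = x
    rw [Algebra.TensorProduct.productMap_apply_tmul, map_one, mul_one]
    exact WittVector.teichmuller_coeff_zero p x
  · change Algebra.TensorProduct.productMap f₁ f₂
      ((1 : WittVector p R) ⊗ₜ[WittVector p k] π) = 0
    rw [Algebra.TensorProduct.productMap_apply_tmul, map_one, one_mul]
    have hres : IsLocalRing.residue O π = 0 := by
      rw [IsLocalRing.residue_eq_zero_iff]
      exact hπ.not_isUnit
    have hθπ : θ π = 0 := by
      simp only [θ, RingHom.comp_apply, hres, map_zero]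
    exact (congrArg (algebraMap k R) hθπ).trans (map_zero _)

/-- Every nonzero element of W(k) is a unit times a power of p, and p is regular on W(R) for perfect
R. So W(R) is torsion-free, hence flat, over W(k), and tensoring preserves injectivity of
multiplication by π on O. -/
theorem PreWitt.base_mul_eq_zero (hπ : π ≠ 0) {z : PreWitt p k O R}
    (hz : PreWitt.base p k R π * z = 0) : z = 0 := by
  have : Module.IsTorsionFree (WittVector p k) (WittVector p R) := by
    refine Module.IsTorsionFree.of_smul_eq_zero fun r x h => ?_
    by_contra! hne
    obtain ⟨m, b, hb⟩ := WittVector.exists_eq_pow_p_mul' r hne.1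
    have h' : (p : WittVector p R) ^ m * x = 0 := by
      have e : (p : WittVector p R) ^ m *
          (algebraMap (WittVector p k) (WittVector p R) b * x) = 0 := by
        rw [← mul_assoc, ← map_natCast (algebraMap (WittVector p k) (WittVector p R)), ← map_pow,
          ← map_mul, ← hb, ← Algebra.smul_def]
        exact h
      have hu : IsUnit (algebraMap (WittVector p k) (WittVector p R) b) := b.isUnit.map _
      refine hu.mul_left_cancel ?_
      rw [mul_zero, ← e]
      ring
    have hpow : ∀ (m : ℕ) (x : WittVector p R), (p : WittVector p R) ^ m * x = 0 → x = 0 := by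
      intro m
      induction m with
      | zero => intro x hx; simpa using hx
      | succ m ih =>
        intro x hx
        refine WittVector.eq_zero_of_p_mul_eq_zero x (ih _ ?_)
        rw [← hx]
        ring
    exact hne.2 (hpow m x h')
  let μ : O →ₗ[WittVector p k] O := LinearMap.mulLeft (WittVector p k) π
  have hμ : Function.Injective μ := mul_right_injective₀ hπ
  have hinj := Module.Flat.lTensor_preserves_injective_linearMap (M := WittVector p R) μ hμ
  have e : ∀ z : PreWitt p k O R, LinearMap.lTensor (WittVector p R) μ z =
      PreWitt.base p k R π * z := by
    intro z
    induction z using TensorProduct.induction_on with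
    | zero => exact (map_zero _).trans (mul_zero _).symm
    | tmul a b =>
      refine (LinearMap.lTensor_tmul _ _ _ _).trans ?_
      change _ = ((1 : WittVector p R) ⊗ₜ[WittVector p k] π) * (a ⊗ₜ[WittVector p k] b)
      rw [Algebra.TensorProduct.tmul_mul_tmul, one_mul]
      rfl
    | add z₁ z₂ h₁ h₂ =>
      refine (map_add _ _ _).trans ?_
      rw [h₁, h₂]
      exact (mul_add (PreWitt.base p k R π) (z₁ : PreWitt p k O R) z₂).symm
  exact hinj (((e z).trans hz).trans (map_zero (LinearMap.lTensor (WittVector p R) μ)).symm)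

/-- Reduction modulo `π` identifies `W_π(R)/π` with `R`, compatibly with Teichmüller lifts. -/
theorem GenWitt.exists_reduction
    (hk : Function.Surjective ((IsLocalRing.residue O).comp (algebraMap (WittVector p k) O)))
    (hπ : Irreducible π) :
    ∃ f : GenWitt p k π R →+* R, (∀ x, f (GenWitt.teich p k π R x) = x) ∧
      ∀ w, f w = 0 ↔ GenWitt.base p k π R π ∣ w := by
  obtain ⟨f, hf, hf0⟩ := PreWitt.exists_reduction (R := R) hk hπ
  let I := wittIdeal p k π R
  have hI : ∀ z ∈ I, f z = 0 := by
    intro z hz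
    obtain ⟨y, rfl⟩ := Ideal.mem_span_singleton.mp hz
    rw [map_mul, hf0, zero_mul]
  let g : GenWitt p k π R →+* R :=
    (Ideal.Quotient.lift I f hI).comp (AdicCompletion.evalOneₐ I).toRingHom
  have hg : ∀ z, g (GenWitt.of p k π R z) = f z := fun z => rfl
  refine ⟨g, fun x => (hg _).trans (hf x), fun w => ⟨fun hw => ?_, ?_⟩⟩
  · refine algebraMap_dvd_of_evalOneₐ_eq_zero (PreWitt.base p k R π) w ?_
    obtain ⟨z, hz⟩ := Ideal.Quotient.mk_surjective ((AdicCompletion.evalOneₐ I).toRingHom w)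
    have hfz : f z = 0 := by
      rw [← hw]
      change f z = Ideal.Quotient.lift I f hI ((AdicCompletion.evalOneₐ I).toRingHom w)
      rw [← hz, Ideal.Quotient.lift_mk]
    obtain ⟨x, z', hz'⟩ := PreWitt.exists_eq_ofWitt_teichmuller_add hk hπ z
    have hx : x = 0 := by
      rw [hz', map_add, map_mul, hf, hf0, zero_mul, add_zero] at hfz
      exact hfz
    refine Eq.trans hz.symm (Ideal.Quotient.eq_zero_iff_mem.mpr ?_)
    rw [hz', hx,
      WittVector.teichmuller_zero, map_zero, zero_add]
    exact Ideal.mul_mem_right _ _ (Ideal.mem_span_singleton_self _)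
  · rintro ⟨y, rfl⟩
    rw [map_mul, show g (GenWitt.base p k π R π) = 0 from hf0, zero_mul]

theorem GenWitt.base_mul_eq_zero (hπ : π ≠ 0) {w : GenWitt p k π R}
    (hw : GenWitt.base p k π R π * w = 0) : w = 0 := by
  exact algebraMap_mul_eq_zero (fun _ => PreWitt.base_mul_eq_zero hπ) w hw

theorem GenWitt.base_teichmuller (c : k) :
    GenWitt.base p k π R (algebraMap (WittVector p k) O (WittVector.teichmuller p c)) =
      GenWitt.teich p k π R (algebraMap k R c) := by
  rw [GenWitt.base, RingHom.comp_apply, ← PreWitt.ofWitt_map, WittVector.map_teichmuller]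
  rfl

theorem GenWitt.teich_mul (x y : R) :
    GenWitt.teich p k π R (x * y) = GenWitt.teich p k π R x * GenWitt.teich p k π R y := by
  simp only [GenWitt.teich, map_mul]

theorem GenWitt.teich_zero : GenWitt.teich p k π R (0 : R) = 0 := by
  simp only [GenWitt.teich, WittVector.teichmuller_zero, map_zero]

theorem GenWitt.teich_one : GenWitt.teich p k π R (1 : R) = 1 := by
  simp only [GenWitt.teich, map_one]

/-- The sum of two Teichmüller lifts is the Teichmüller series of the Witt vector sum. -/
theorem GenWitt.teich_add_teich (x y : R) (n : ℕ) :
    ∃ w, GenWitt.teich p k π R x + GenWitt.teich p k π R y =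
      ∑ i ∈ Finset.range (n + 1), (p : GenWitt p k π R) ^ i * GenWitt.teich p k π R
        ((((frobeniusEquiv R p).symm) ^ i)
          ((WittVector.teichmuller p x + WittVector.teichmuller p y).coeff i)) +
      (p : GenWitt p k π R) ^ (n + 1) * w := by
  obtain ⟨v, hv⟩ := WittVector.dvd_sub_sum_teichmuller_iterateFrobeniusEquiv_coeff
    (WittVector.teichmuller p x + WittVector.teichmuller p y) n
  refine ⟨GenWitt.of p k π R (PreWitt.ofWitt p k O R v), ?_⟩
  have h := congrArg (fun u => GenWitt.of p k π R (PreWitt.ofWitt p k O R u)) hv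
  simp only [map_sub, map_add, map_mul, map_pow, map_natCast, map_sum] at h
  rw [sub_eq_iff_eq_add'] at h
  rw [← Nat.range_succ_eq_Iic] at h
  refine Eq.trans h (congrArg₂ (· + ·) (Finset.sum_congr rfl fun i _ => mul_comm _ _) rfl)

end GenWittStructure

end DeformedRobba

end

noncomputable section

set_option linter.unusedSectionVars false

namespace DeformedRobba

/-! ### Teichmüller expansions and bounds on their coefficients -/

section Teichmuller

variable {R : Type*} [NormedCommRing R] {W : Type*} [CommRing W] (ϖ : W) (τ : R → W)

/-- `w = ∑_j ϖ ^ j τ(a_j)`, with `ϖ`-adic convergence. -/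
def IsExpansion (w : W) (a : ℕ → R) : Prop :=
  ∀ n : ℕ, ϖ ^ n ∣ w - ∑ j ∈ Finset.range n, ϖ ^ j * τ (a j)

/-- The additive group generated by the elements `ϖ ^ j τ(x)` with `α(x) ≤ r_j`. -/
def boundedSums (r : ℕ → ℝ) : AddSubgroup W :=
  AddSubgroup.closure {w | ∃ (j : ℕ) (x : R), specNorm x ≤ r j ∧ w = ϖ ^ j * τ x}

/-- The `ϖ`-adic closure of `boundedSums`. -/
def bounded (r : ℕ → ℝ) : AddSubgroup W where
  carrier := {w | ∀ n : ℕ, ∃ g ∈ boundedSums ϖ τ r, ϖ ^ n ∣ w - g}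
  zero_mem' _ := ⟨0, zero_mem _, by simp⟩
  add_mem' {v w} hv hw n := by
    obtain ⟨g, hg, hg'⟩ := hv n
    obtain ⟨h, hh, hh'⟩ := hw n
    exact ⟨g + h, add_mem hg hh, by rw [add_sub_add_comm]; exact dvd_add hg' hh'⟩
  neg_mem' {v} hv n := by
    obtain ⟨g, hg, hg'⟩ := hv n
    exact ⟨-g, neg_mem hg, by rw [← neg_sub']; exact hg'.neg_right⟩

/-- A multiplicative section `τ` of the reduction `W → W/ϖ = R` that is additive modulo `ϖ`, with an
error that is as small as the summands. -/
structure IsTeichmuller : Prop where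
  exists_reduction : ∃ f : W →+* R, (∀ x, f (τ x) = x) ∧ ∀ w, f w = 0 ↔ ϖ ∣ w
  regular : ∀ w, ϖ * w = 0 → w = 0
  map_mul : ∀ x y, τ (x * y) = τ x * τ y
  map_zero : τ 0 = 0
  map_one : τ 1 = 1
  map_add : ∀ (c : ℝ) (x y : R), specNorm x ≤ c → specNorm y ≤ c → ∀ n : ℕ,
    ∃ g ∈ boundedSums ϖ τ (fun _ => c), ϖ ^ n ∣ τ x + τ y - τ (x + y) - ϖ * g

variable {ϖ τ} {r r' : ℕ → ℝ}

theorem mul_mem_boundedSums {j : ℕ} {x : R} (h : specNorm x ≤ r j) :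
    ϖ ^ j * τ x ∈ boundedSums ϖ τ r := AddSubgroup.subset_closure ⟨j, x, h, rfl⟩

theorem boundedSums_le_bounded : boundedSums ϖ τ r ≤ bounded ϖ τ r := fun g hg _ =>
  ⟨g, hg, by simp⟩

theorem mul_mem_bounded {j : ℕ} {x : R} (h : specNorm x ≤ r j) :
    ϖ ^ j * τ x ∈ bounded ϖ τ r := boundedSums_le_bounded (mul_mem_boundedSums h)

theorem pow_mul_mem_boundedSums (m : ℕ) (h : ∀ j, r j ≤ r' (m + j)) {g : W}
    (hg : g ∈ boundedSums ϖ τ r) : ϖ ^ m * g ∈ boundedSums ϖ τ r' := by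
  induction hg using AddSubgroup.closure_induction with
  | mem g hg =>
    obtain ⟨j, x, hx, rfl⟩ := hg
    rw [← mul_assoc, ← pow_add]
    exact mul_mem_boundedSums (hx.trans (h j))
  | zero => rw [mul_zero]; exact zero_mem _
  | add g g' _ _ ih ih' => rw [mul_add]; exact add_mem ih ih'
  | neg g _ ih => rw [mul_neg]; exact neg_mem ih

theorem pow_mul_mem_bounded (m : ℕ) (h : ∀ j, r j ≤ r' (m + j)) {w : W}
    (hw : w ∈ bounded ϖ τ r) : ϖ ^ m * w ∈ bounded ϖ τ r' := fun n => by
  obtain ⟨g, hg, hg'⟩ := hw n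
  refine ⟨ϖ ^ m * g, pow_mul_mem_boundedSums m h hg, ?_⟩
  rw [← mul_sub]
  exact hg'.mul_left _

theorem bounded_mono (h : ∀ j, r j ≤ r' j) : bounded ϖ τ r ≤ bounded ϖ τ r' := fun w hw => by
  simpa using pow_mul_mem_bounded (r := r) (r' := r') 0 (by simpa using h) hw

theorem specNorm_sub_le (p : ℕ) [Fact p.Prime] [CharP R p] [IsUltrametricDist R] (x y : R) :
    specNorm (x - y) ≤ max (specNorm x) (specNorm y) := by
  rw [sub_eq_add_neg, ← specNorm_neg y]
  exact specNorm_add_le p _ _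

variable (ϖ τ) in
/-- The coefficients of the Teichmüller expansion of `w`. -/
def teichCoeff (w : W) : ℕ → R := by
  classical exact if h : ∃ a, IsExpansion ϖ τ w a then h.choose else 0

namespace IsTeichmuller

/-- Reduction modulo ϖ identifies the leading coefficients; subtracting them and cancelling the
regular element ϖ gives an induction on n. -/
theorem eq_of_dvd (hτ : IsTeichmuller ϖ τ) {a b : ℕ → R} {n : ℕ} (h : ϖ ^ n ∣
    ∑ j ∈ Finset.range n, ϖ ^ j * τ (a j) - ∑ j ∈ Finset.range n, ϖ ^ j * τ (b j)) :
    ∀ j < n, a j = b j := by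
  obtain ⟨f, hf, hf0⟩ := hτ.exists_reduction
  induction n generalizing a b with
  | zero => intro j hj; exact absurd hj (Nat.not_lt_zero j)
  | succ n ih =>
    have e : ∀ c : ℕ → R, ∑ j ∈ Finset.range (n + 1), ϖ ^ j * τ (c j) =
        τ (c 0) + ϖ * ∑ j ∈ Finset.range n, ϖ ^ j * τ (c (j + 1)) := fun c => by
      rw [Finset.sum_range_succ', Finset.mul_sum, add_comm, pow_zero, one_mul]
      refine congrArg _ (Finset.sum_congr rfl fun j _ => ?_)
      ring
    rw [e, e] at h
    have h0 : a 0 = b 0 := by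
      have h1 := (hf0 _).mpr (dvd_trans (dvd_pow_self ϖ n.succ_ne_zero) h)
      rw [map_sub, _root_.map_add, _root_.map_add, _root_.map_mul, _root_.map_mul, (hf0 ϖ).mpr dvd_rfl, zero_mul,
        zero_mul, hf, hf, add_zero, add_zero, sub_eq_zero] at h1
      exact h1
    rw [h0, add_sub_add_left_eq_sub, ← mul_sub] at h
    obtain ⟨y, hy⟩ := h
    have h' : ϖ ^ n ∣ ∑ j ∈ Finset.range n, ϖ ^ j * τ (a (j + 1)) -
        ∑ j ∈ Finset.range n, ϖ ^ j * τ (b (j + 1)) := by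
      refine ⟨y, sub_eq_zero.mp (hτ.regular _ ?_)⟩
      rw [mul_sub, hy]
      ring
    intro j hj
    rcases j with _ | j
    · exact h0
    · exact ih h' j (Nat.lt_of_succ_lt_succ hj)

theorem exists_eq_add (hτ : IsTeichmuller ϖ τ) (w : W) : ∃ (x : R) (w' : W), w = τ x + ϖ * w' := by
  obtain ⟨f, hf, hf0⟩ := hτ.exists_reduction
  obtain ⟨w', hw'⟩ := (hf0 (w - τ (f w))).mp (by rw [map_sub, hf, sub_self])
  exact ⟨f w, w', by rw [← hw']; ring⟩

theorem exists_isExpansion (hτ : IsTeichmuller ϖ τ) (w : W) : ∃ a, IsExpansion ϖ τ w a := by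
  choose x s hs using hτ.exists_eq_add
  -- The map s sends w to the remainder (w - τ(x))/ϖ, and its iterates carry the successive
  -- remainders.
  refine ⟨fun j => x (s^[j] w), fun n => ⟨s^[n] w, ?_⟩⟩
  induction n with
  | zero => simp
  | succ n ih =>
    rw [Finset.sum_range_succ, Function.iterate_succ_apply', ← sub_sub, ih]
    have h := hs (s^[n] w)
    rw [pow_succ]
    linear_combination ϖ ^ n * h

theorem isExpansion_teichCoeff (hτ : IsTeichmuller ϖ τ) (w : W) :
    IsExpansion ϖ τ w (teichCoeff ϖ τ w) := by
  rw [teichCoeff, dif_pos (hτ.exists_isExpansion w)]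
  exact (hτ.exists_isExpansion w).choose_spec

theorem teichCoeff_eq_of_dvd (hτ : IsTeichmuller ϖ τ) {w : W} {a : ℕ → R} {n : ℕ}
    (h : ϖ ^ n ∣ w - ∑ j ∈ Finset.range n, ϖ ^ j * τ (a j)) :
    ∀ j < n, teichCoeff ϖ τ w j = a j := by
  refine hτ.eq_of_dvd ?_
  have h' := dvd_sub h (hτ.isExpansion_teichCoeff w n)
  rwa [sub_sub_sub_cancel_left] at h'

theorem teichCoeff_eq (hτ : IsTeichmuller ϖ τ) {w : W} {a : ℕ → R} (h : IsExpansion ϖ τ w a) :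
    teichCoeff ϖ τ w = a :=
  funext fun j => hτ.teichCoeff_eq_of_dvd (h (j + 1)) j j.lt_succ_self

theorem teichCoeff_pow_mul (hτ : IsTeichmuller ϖ τ) (m : ℕ) (w : W) :
    teichCoeff ϖ τ (ϖ ^ m * w) = fun j => if j < m then 0 else teichCoeff ϖ τ w (j - m) := by
  refine hτ.teichCoeff_eq fun n => ?_
  rcases le_total n m with h | h
  · rw [Finset.sum_eq_zero, sub_zero]
    · exact (pow_dvd_pow ϖ h).mul_right _
    · intro j hj
      rw [if_pos ((Finset.mem_range.mp hj).trans_le h), hτ.map_zero, mul_zero]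
  · obtain ⟨l, rfl⟩ := Nat.exists_eq_add_of_le h
    rw [Finset.sum_range_add, Finset.sum_eq_zero, zero_add, pow_add]
    · have e : ∑ x ∈ Finset.range l, ϖ ^ (m + x) *
          τ (if m + x < m then 0 else teichCoeff ϖ τ w (m + x - m)) =
          ϖ ^ m * ∑ x ∈ Finset.range l, ϖ ^ x * τ (teichCoeff ϖ τ w x) := by
        rw [Finset.mul_sum]
        refine Finset.sum_congr rfl fun x _ => ?_
        rw [if_neg (by omega), Nat.add_sub_cancel_left, pow_add, mul_assoc]
      rw [e, ← mul_sub]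
      exact mul_dvd_mul_left _ (hτ.isExpansion_teichCoeff w l)
    · intro j hj
      rw [if_pos (Finset.mem_range.mp hj), hτ.map_zero, mul_zero]

theorem teichCoeff_sub_sum (hτ : IsTeichmuller ϖ τ) (m : ℕ) (w : W) :
    teichCoeff ϖ τ (w - ∑ j ∈ Finset.range m, ϖ ^ j * τ (teichCoeff ϖ τ w j)) =
      fun j => if j < m then 0 else teichCoeff ϖ τ w j := by
  refine hτ.teichCoeff_eq fun n => ?_
  rcases le_total n m with h | h
  · rw [Finset.sum_eq_zero (s := Finset.range n), sub_zero]
    · exact (pow_dvd_pow ϖ h).trans (hτ.isExpansion_teichCoeff w m)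
    · intro j hj
      rw [if_pos ((Finset.mem_range.mp hj).trans_le h), hτ.map_zero, mul_zero]
  · obtain ⟨l, rfl⟩ := Nat.exists_eq_add_of_le h
    have hw := hτ.isExpansion_teichCoeff w (m + l)
    rw [Finset.sum_range_add] at hw ⊢
    rw [Finset.sum_eq_zero (s := Finset.range m) (f := fun j => ϖ ^ j *
      τ (if j < m then 0 else teichCoeff ϖ τ w j)), zero_add, sub_sub]
    · convert hw using 5
      rw [if_neg (by omega)]
    · intro j hj
      rw [if_pos (Finset.mem_range.mp hj), hτ.map_zero, mul_zero]

/-- The coefficient of `ϖ ^ m` of an element with a known expansion up to there. -/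
theorem teichCoeff_sum_add (hτ : IsTeichmuller ϖ τ) {f : W →+* R} (hf : ∀ x, f (τ x) = x)
    (hf0 : ∀ w, f w = 0 ↔ ϖ ∣ w) (m : ℕ) (a : ℕ → R) (y : W) :
    teichCoeff ϖ τ (∑ j ∈ Finset.range m, ϖ ^ j * τ (a j) + ϖ ^ m * y) m = f y := by
  obtain ⟨x, y', hy⟩ := hτ.exists_eq_add y
  have hfy : f y = x := by
    rw [hy, _root_.map_add, _root_.map_mul, hf, (hf0 ϖ).mpr dvd_rfl, zero_mul, add_zero]
  rw [hfy]
  refine (hτ.teichCoeff_eq_of_dvd (a := Function.update a m x) (n := m + 1) ?_ m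
    m.lt_succ_self).trans (Function.update_self _ _ _)
  refine ⟨y', ?_⟩
  have e : ∑ j ∈ Finset.range m, ϖ ^ j * τ (Function.update a m x j) =
      ∑ j ∈ Finset.range m, ϖ ^ j * τ (a j) := Finset.sum_congr rfl fun j hj => by
    rw [Function.update_of_ne (Finset.mem_range.mp hj).ne]
  rw [Finset.sum_range_succ, Function.update_self, e, hy]
  ring

/-! ### Groups cut out by bounds on Teichmüller coefficients -/

section Bounds

variable [IsUltrametricDist R]

/-- The error of additivity of τ is ϖ times sums with the bound r 0 in every degree. As r is
nondecreasing, they satisfy the shifted bounds r (j + 1) and can be passed on to g'. -/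
theorem exists_leading (hτ : IsTeichmuller ϖ τ) (p : ℕ) [Fact p.Prime] [CharP R p] (hr : Monotone r) (hr0 : ∀ j, 0 ≤ r j) {g : W}
    (hg : g ∈ boundedSums ϖ τ r) (n : ℕ) : ∃ x : R, specNorm x ≤ r 0 ∧
      ∃ g' ∈ boundedSums ϖ τ (fun j => r (j + 1)), ϖ ^ n ∣ g - τ x - ϖ * g' := by
  have hshift : boundedSums ϖ τ (fun _ => r 0) ≤ boundedSums ϖ τ (fun j => r (j + 1)) :=
    fun g hg => by
      simpa using pow_mul_mem_boundedSums (r := fun _ => r 0) (r' := fun j => r (j + 1)) 0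
        (fun j => hr (Nat.zero_le _)) hg
  induction hg using AddSubgroup.closure_induction with
  | mem g hg =>
    obtain ⟨j, x, hx, rfl⟩ := hg
    rcases j with _ | j
    · exact ⟨x, hx, 0, zero_mem _, by simp⟩
    · exact ⟨0, by simpa [specNorm_zero] using hr0 0, ϖ ^ j * τ x, mul_mem_boundedSums hx,
        by rw [hτ.map_zero, pow_succ', mul_assoc]; simp⟩
  | zero => exact ⟨0, by simpa [specNorm_zero] using hr0 0, 0, zero_mem _, by simp [hτ.map_zero]⟩
  | add g g' _ _ ih ih' =>
    obtain ⟨x, hx, y, hy, u, hu⟩ := ih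
    obtain ⟨x', hx', y', hy', u', hu'⟩ := ih'
    obtain ⟨z, hz, v, hv⟩ := hτ.map_add (r 0) x x' hx hx' n
    refine ⟨x + x', (specNorm_add_le p _ _).trans (max_le hx hx'), y + y' + z,
      add_mem (add_mem hy hy') (hshift hz), u + u' + v, ?_⟩
    linear_combination hu + hu' + hv
  | neg g _ ih =>
    obtain ⟨x, hx, y, hy, u, hu⟩ := ih
    -- For p = 2 the elements τ(-x) and -τ(x) may differ; their difference is again an error of
    -- additivity, that of x + (-x) = 0.
    obtain ⟨z, hz, v, hv⟩ := hτ.map_add (r 0) x (-x) hx (by rwa [specNorm_neg]) n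
    rw [add_neg_cancel, hτ.map_zero] at hv
    refine ⟨-x, by rwa [specNorm_neg], -y - z, sub_mem (neg_mem hy) (hshift hz), -u - v, ?_⟩
    linear_combination -hu - hv

theorem exists_approx (hτ : IsTeichmuller ϖ τ) (p : ℕ) [Fact p.Prime] [CharP R p] (hr : Monotone r)
    (hr0 : ∀ j, 0 ≤ r j) {g : W} (hg : g ∈ boundedSums ϖ τ r) (n : ℕ) :
    ∃ a : ℕ → R, (∀ j, specNorm (a j) ≤ r j) ∧
      ϖ ^ n ∣ g - ∑ j ∈ Finset.range n, ϖ ^ j * τ (a j) := by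
  induction n generalizing r g with
  | zero => exact ⟨0, fun j => by simpa [specNorm_zero] using hr0 j, by simp⟩
  | succ n ih =>
    obtain ⟨x, hx, g', hg', u, hu⟩ := hτ.exists_leading p hr hr0 hg (n + 1)
    obtain ⟨a, ha, v, hv⟩ := ih (r := fun j => r (j + 1))
      (fun i j hij => hr (Nat.succ_le_succ hij)) (fun j => hr0 _) hg'
    refine ⟨fun j => Nat.casesOn j x a, fun j => ?_, u + v, ?_⟩
    · rcases j with _ | j
      · exact hx
      · exact ha j
    · have e : ∑ j ∈ Finset.range n, ϖ ^ (j + 1) * τ (a j) =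
          ϖ * ∑ j ∈ Finset.range n, ϖ ^ j * τ (a j) := by
        rw [Finset.mul_sum]
        exact Finset.sum_congr rfl fun j _ => by ring
      rw [Finset.sum_range_succ', e]
      simp only [pow_zero, one_mul]
      rw [pow_succ] at hu ⊢
      linear_combination hu + ϖ * hv

/-- Peeling off leading coefficients turns a finite sum of bounded terms into an expansion with the
same bounds, and expansions are unique. The left side is visibly an additive group, so
coefficientwise bounds are stable under addition although the coefficients are not additive. -/
theorem mem_bounded_iff (hτ : IsTeichmuller ϖ τ) (p : ℕ) [Fact p.Prime] [CharP R p]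
    (hr : Monotone r) (hr0 : ∀ j, 0 ≤ r j) {w : W} :
    w ∈ bounded ϖ τ r ↔ ∀ j, specNorm (teichCoeff ϖ τ w j) ≤ r j := by
  refine ⟨fun h j => ?_, fun h n => ?_⟩
  · obtain ⟨g, hg, hg'⟩ := h (j + 1)
    obtain ⟨a, ha, ha'⟩ := hτ.exists_approx p hr hr0 hg (j + 1)
    have hw := dvd_add hg' ha'
    rw [sub_add_sub_cancel] at hw
    rw [hτ.teichCoeff_eq_of_dvd hw j j.lt_succ_self]
    exact ha j
  · exact ⟨_, sum_mem fun j _ => mul_mem_boundedSums (h j), hτ.isExpansion_teichCoeff w n⟩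

theorem mul_mem_bounded (hτ : IsTeichmuller ϖ τ) {r'' : ℕ → ℝ}
    (h : ∀ i j, 0 ≤ r i → 0 ≤ r' j → r i * r' j ≤ r'' (i + j))
    {v w : W} (hv : v ∈ bounded ϖ τ r) (hw : w ∈ bounded ϖ τ r') : v * w ∈ bounded ϖ τ r'' := by
  intro n
  obtain ⟨g, hg, a, ha⟩ := hv n
  obtain ⟨g', hg', b, hb⟩ := hw n
  refine ⟨g * g', ?_, a * w + g * b, by linear_combination w * ha + g * hb⟩
  clear ha hb
  induction hg using AddSubgroup.closure_induction with
  | zero => rw [zero_mul]; exact zero_mem _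
  | add g₁ g₂ _ _ ih₁ ih₂ => rw [add_mul]; exact add_mem ih₁ ih₂
  | neg g _ ih => rw [neg_mul]; exact neg_mem ih
  | mem g hg =>
    obtain ⟨i, x, hx, rfl⟩ := hg
    induction hg' using AddSubgroup.closure_induction with
    | zero => rw [mul_zero]; exact zero_mem _
    | add g₁ g₂ _ _ ih₁ ih₂ => rw [mul_add]; exact add_mem ih₁ ih₂
    | neg g _ ih => rw [mul_neg]; exact neg_mem ih
    | mem g hg =>
      obtain ⟨j, y, hy, rfl⟩ := hg
      have e : ϖ ^ i * τ x * (ϖ ^ j * τ y) = ϖ ^ (i + j) * τ (x * y) := by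
        rw [hτ.map_mul, pow_add]; ring
      have hx0 := (specNorm_nonneg x).trans hx
      rw [e]
      exact mul_mem_boundedSums ((specNorm_mul_le x y).trans
        ((mul_le_mul hx hy (specNorm_nonneg y) hx0).trans
          (h i j hx0 ((specNorm_nonneg y).trans hy))))

/-- Small perturbations for one family of bounds do not affect another family of bounds. -/
theorem specNorm_teichCoeff_le_of_sub (hτ : IsTeichmuller ϖ τ) (p : ℕ) [Fact p.Prime] [CharP R p]
    (hr : Monotone r) (hr0 : ∀ j, 0 ≤ r j) (hr' : Monotone r') (hr0' : ∀ j, 0 ≤ r' j) {w g : W}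
    (h : w - g ∈ bounded ϖ τ r) (hg : g ∈ bounded ϖ τ r') {n : ℕ}
    (hn : ∀ j < n, teichCoeff ϖ τ w j = 0 ∨ r' j ≤ r j) :
    ∀ j < n, specNorm (teichCoeff ϖ τ w j) ≤ r j := by
  obtain ⟨f, hf, hf0⟩ := hτ.exists_reduction
  intro j
  induction j using Nat.strong_induction_on with
  | _ j ih =>
  intro hj
  rcases hn j hj with h0 | hle
  · rw [h0, specNorm_zero]
    exact hr0 j
  obtain ⟨y, hy⟩ := hτ.isExpansion_teichCoeff w j
  obtain ⟨z, hz⟩ := hτ.isExpansion_teichCoeff (-g) j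
  rw [sub_eq_iff_eq_add'] at hy hz
  have hw : teichCoeff ϖ τ w j = f y := by
    conv_lhs => rw [hy]
    exact hτ.teichCoeff_sum_add hf hf0 j _ y
  have hg' : teichCoeff ϖ τ (-g) j = f z := by
    conv_lhs => rw [hz]
    exact hτ.teichCoeff_sum_add hf hf0 j _ z
  -- By induction the subtracted terms obey r, hence so does u. Also u = -g + ϖ^j y, and below index
  -- j it agrees with -g; at index j reduction modulo ϖ is additive, which expresses w_j by u_j and
  -- (-g)_j.
  let u := w - g - ∑ l ∈ Finset.range j, ϖ ^ l * τ (teichCoeff ϖ τ w l)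
  have hu : u ∈ bounded ϖ τ r := sub_mem h (sum_mem fun l hl =>
    DeformedRobba.mul_mem_bounded (ih l (Finset.mem_range.mp hl)
      ((Finset.mem_range.mp hl).trans hj)))
  have hu' : teichCoeff ϖ τ u j = f (y + z) := by
    have e : u = ∑ l ∈ Finset.range j, ϖ ^ l * τ (teichCoeff ϖ τ (-g) l) + ϖ ^ j * (y + z) := by
      simp only [u]
      linear_combination hy + hz
    rw [e]
    exact hτ.teichCoeff_sum_add hf hf0 j _ _
  have key : teichCoeff ϖ τ w j = teichCoeff ϖ τ u j - teichCoeff ϖ τ (-g) j := by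
    rw [hw, hg', hu', _root_.map_add, add_sub_cancel_right]
  rw [key]
  exact (specNorm_sub_le p _ _).trans (max_le ((hτ.mem_bounded_iff p hr hr0).mp hu j)
    (((hτ.mem_bounded_iff p hr' hr0').mp (neg_mem hg) j).trans hle))

end Bounds

end IsTeichmuller

end Teichmuller

end DeformedRobba

end

noncomputable section

set_option linter.unusedSectionVars false

namespace DeformedRobba

/-! ### Teichmüller expansions in generalized Witt vectors -/

section GenWittTeichmuller

attribute [local instance] wittAlgebra

variable {p : ℕ} [Fact p.Prime] {k : Type*} [Field k] [CharP k p] [PerfectRing k p]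
  {O : Type*} [CommRing O] [IsDomain O] [IsDiscreteValuationRing O] [Algebra (WittVector p k) O]
  {π : O}

/-- The scalar a expands into π^j [e] with e ∈ k, and elements of k have spectral seminorm at most
1. -/
theorem GenWitt.base_mul_teich_mem
    (hk : Function.Surjective ((IsLocalRing.residue O).comp (algebraMap (WittVector p k) O)))
    (hπ : Irreducible π) {R : Type*} [NormedCommRing R] [Algebra k R] [CharP R p]
    [PerfectRing R p] (hα : ∀ c : k, specNorm (algebraMap k R c) ≤ 1) {c : ℝ} {x : R} (hx : specNorm x ≤ c) (a : O) :
    GenWitt.base p k π R a * GenWitt.teich p k π R x ∈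
      bounded (GenWitt.base p k π R π) (GenWitt.teich p k π R) (fun _ => c) := by
  intro n
  induction n generalizing a with
  | zero => exact ⟨0, zero_mem _, by simp⟩
  | succ n ih =>
    obtain ⟨e, a', ha⟩ := exists_eq_algebraMap_teichmuller_add hk hπ a
    obtain ⟨g, hg, u, hu⟩ := ih a'
    refine ⟨GenWitt.base p k π R π ^ 0 * GenWitt.teich p k π R (algebraMap k R e * x) +
      GenWitt.base p k π R π ^ 1 * g, add_mem (mul_mem_boundedSums ?_)
        (pow_mul_mem_boundedSums 1 (fun _ => le_rfl) hg), u, ?_⟩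
    · exact (specNorm_mul_le _ _).trans
        ((mul_le_of_le_one_left (specNorm_nonneg x) (hα e)).trans hx)
    · rw [ha, map_add, map_mul, GenWitt.base_teichmuller, GenWitt.teich_mul]
      linear_combination GenWitt.base p k π R π * hu

theorem GenWitt.isTeichmuller
    (hk : Function.Surjective ((IsLocalRing.residue O).comp (algebraMap (WittVector p k) O)))
    (hπ : Irreducible π) {R : Type*} [NormedCommRing R] [IsUltrametricDist R] [Algebra k R]
    [CharP R p] [PerfectRing R p] (hα : ∀ c : k, specNorm (algebraMap k R c) ≤ 1) :
    IsTeichmuller (GenWitt.base p k π R π) (GenWitt.teich p k π R) where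
  exists_reduction := GenWitt.exists_reduction hk hπ
  regular _ := GenWitt.base_mul_eq_zero hπ.ne_zero
  map_mul := GenWitt.teich_mul
  map_zero := GenWitt.teich_zero
  map_one := GenWitt.teich_one
  map_add c x y hx hy n := by
    obtain ⟨w, hw⟩ := GenWitt.teich_add_teich (p := p) (k := k) (π := π) x y n
    obtain ⟨q, hq⟩ := exists_natCast_eq_mul hk hπ
    have hp : (p : GenWitt p k π R) = GenWitt.base p k π R π * GenWitt.base p k π R q := by
      rw [← map_mul, ← hq, map_natCast]
    have h1 : specNorm (1 : R) ≤ 1 := by simpa using hα 1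
    -- [x] + [y] = ∑ p^i [z i]. The i-th Witt coefficient is bounded by c^(p^i), so its root of
    -- order p^i is bounded by c.
    let z : ℕ → R := fun i => (((frobeniusEquiv R p).symm) ^ i)
      ((WittVector.teichmuller p x + WittVector.teichmuller p y).coeff i)
    have hz : ∀ i, specNorm (z i) ≤ c := fun i => by
      have e : z i ^ p ^ i =
          (WittVector.teichmuller p x + WittVector.teichmuller p y).coeff i := by
        change (((frobeniusEquiv R p).symm) ^ i) _ ^ p ^ i = _
        rw [← iterateFrobeniusEquiv_symm, ← iterateFrobeniusEquiv_def, RingEquiv.apply_symm_apply]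
      have h := specNorm_coeff_teichmuller_add_le h1 hx hy i
      rw [← e, specNorm_pow _ (pow_pos (Fact.out : p.Prime).pos i)] at h
      exact (pow_le_pow_iff_left₀ (specNorm_nonneg _) ((specNorm_nonneg x).trans hx)
        (pow_pos (Fact.out : p.Prime).pos i).ne').mp h
    have hz0 : z 0 = x + y := by
      simp [z, WittVector.add_coeff_zero]
    -- Since p = π q, the terms with i ≥ 1 are π times these; the scalars q (π q)^i lie in O and are
    -- expanded by the previous lemma.
    have hmem : ∑ i ∈ Finset.range n, GenWitt.base p k π R (q * (π * q) ^ i) *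
        GenWitt.teich p k π R (z (i + 1)) ∈
        bounded (GenWitt.base p k π R π) (GenWitt.teich p k π R) (fun _ => c) :=
      sum_mem fun i _ => GenWitt.base_mul_teich_mem hk hπ hα (hz _) _
    obtain ⟨g, hg, u, hu⟩ := hmem n
    refine ⟨g, hg, GenWitt.base p k π R π * u +
      GenWitt.base p k π R π * GenWitt.base p k π R q ^ (n + 1) * w, ?_⟩
    have hsum : ∑ i ∈ Finset.range (n + 1), (p : GenWitt p k π R) ^ i *
        GenWitt.teich p k π R (z i) = GenWitt.teich p k π R (x + y) + GenWitt.base p k π R π *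
          ∑ i ∈ Finset.range n, GenWitt.base p k π R (q * (π * q) ^ i) *
            GenWitt.teich p k π R (z (i + 1)) := by
      rw [Finset.sum_range_succ', Finset.mul_sum, add_comm, pow_zero, one_mul, hz0]
      refine congrArg _ (Finset.sum_congr rfl fun i _ => ?_)
      rw [hp, map_mul, map_pow, map_mul]
      ring
    rw [hw, hsum, hp]
    linear_combination GenWitt.base p k π R π * hu

theorem GenWitt.map_teich {R R' : Type*} [CommRing R] [CommRing R'] [Algebra k R] [Algebra k R']
    (f : R →ₐ[k] R') (x : R) :
    GenWitt.map p k π f (GenWitt.teich p k π R x) = GenWitt.teich p k π R' (f x) := by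
  refine AdicCompletion.ext_evalₐ fun n => ?_
  refine (AdicCompletion.evalₐ_liftRingHom (wittIdeal p k π R') (GenWitt.mapMod p k π f)
    (GenWitt.mapMod_compat p k π f) n _).trans ?_
  have e : ∀ y, GenWitt.eval p k π R n (GenWitt.of p k π R y) = Ideal.Quotient.mk _ y :=
    fun y => AdicCompletion.evalₐ_of (wittIdeal p k π R) n y
  have h : PreWitt.map p k O f (PreWitt.ofWitt p k O R (WittVector.teichmuller p x)) =
      PreWitt.ofWitt p k O R' (WittVector.teichmuller p (f x)) := by
    change Algebra.TensorProduct.map (wittMap p k f) (AlgHom.id (WittVector p k) O)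
      (WittVector.teichmuller p x ⊗ₜ[WittVector p k] (1 : O)) =
        WittVector.teichmuller p (f x) ⊗ₜ[WittVector p k] (1 : O)
    rw [Algebra.TensorProduct.map_tmul, AlgHom.id_apply]
    exact congrArg (· ⊗ₜ[WittVector p k] (1 : O)) (WittVector.map_teichmuller p f.toRingHom x)
  rw [GenWitt.mapMod, RingHom.comp_apply, GenWitt.teich, e, Ideal.quotientMap_mk, h]
  exact (AdicCompletion.evalₐ_of (wittIdeal p k π R') n _).symm

variable {R : Type*} [NormedCommRing R] [Algebra k R] [CharP R p] [PerfectRing R p]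
  {Rp : Subalgebra k R}

theorem charP_subalgebra (Rp : Subalgebra k R) : CharP Rp p :=
  RingHom.charP Rp.val.toRingHom Subtype.val_injective p

/-- A p-th root in R of an element of R⁺ is integral over R⁺, hence in R⁺. -/
theorem perfectRing_subalgebra (hint : ∀ x : R, IsIntegral Rp x → x ∈ Rp) :
    haveI : CharP Rp p := charP_subalgebra Rp
    PerfectRing Rp p := by
  have : CharP Rp p := charP_subalgebra Rp
  refine ⟨fun x y h => Subtype.ext ((PerfectRing.bijective_frobenius (R := R) (p := p)).1 ?_),
    fun x => ?_⟩
  · exact congrArg Subtype.val h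
  · obtain ⟨y, hy⟩ := (PerfectRing.bijective_frobenius (R := R) (p := p)).2 (x : R)
    have hy' : y ^ p = algebraMap Rp R x := hy
    have hi : IsIntegral Rp y :=
      IsIntegral.of_pow (Fact.out : p.Prime).pos (hy' ▸ isIntegral_algebraMap)
    exact ⟨⟨y, hint y hi⟩, Subtype.ext hy⟩

/-- Expansions are taken in W_π(R⁺), where R⁺ is again perfect, and transported to W_π(R);
power-bounded coefficients have spectral seminorm at most 1. -/
theorem GenWitt.plus_le_bounded
    (hk : Function.Surjective ((IsLocalRing.residue O).comp (algebraMap (WittVector p k) O)))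
    (hπ : Irreducible π) (hbdd : ∀ x ∈ Rp, ∃ C : ℝ, ∀ n : ℕ, ‖x ^ n‖ ≤ C)
    (hint : ∀ x : R, IsIntegral Rp x → x ∈ Rp) {w : GenWitt p k π R}
    (hw : w ∈ GenWitt.plus p π Rp) :
    w ∈ bounded (GenWitt.base p k π R π) (GenWitt.teich p k π R) (fun _ => 1) := by
  have : CharP Rp p := charP_subalgebra Rp
  have : PerfectRing Rp p := perfectRing_subalgebra hint
  obtain ⟨v, rfl⟩ := hw
  obtain ⟨f, hf, hf0⟩ := GenWitt.exists_reduction (R := Rp) hk hπ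
  intro n
  induction n generalizing v with
  | zero => exact ⟨0, zero_mem _, by simp⟩
  | succ n ih =>
    obtain ⟨v', hv'⟩ := (hf0 (v - GenWitt.teich p k π Rp (f v))).mp (by rw [map_sub, hf, sub_self])
    obtain ⟨g, hg, u, hu⟩ := ih v'
    refine ⟨GenWitt.base p k π R π ^ 0 * GenWitt.teich p k π R (f v : R) +
      GenWitt.base p k π R π ^ 1 * g, add_mem (mul_mem_boundedSums (specNorm_le_one
        (hbdd _ (f v).2))) (pow_mul_mem_boundedSums 1 (fun _ => le_rfl) hg), u, ?_⟩
    have h := congrArg (GenWitt.map p k π Rp.val) hv'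
    rw [map_sub, GenWitt.map_teich, map_mul, GenWitt.map_base] at h
    rw [Subalgebra.coe_val] at h
    linear_combination h + GenWitt.base p k π R π * hu

end GenWittTeichmuller

end DeformedRobba

end

noncomputable section

set_option linter.unusedSectionVars false

namespace DeformedRobba

theorem IsTeichmuller.eq_zero_of_pow_mul {R W : Type*} [NormedCommRing R] [CommRing W] {ϖ : W}
    {τ : R → W} (hτ : IsTeichmuller ϖ τ) (m : ℕ) {w : W} (h : ϖ ^ m * w = 0) : w = 0 := by
  induction m with
  | zero => simpa using h
  | succ m ih => exact ih (hτ.regular _ (by rw [← h, pow_succ']; ring))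

/-! ### Bounded power series -/

section BoundedSeries

variable {R : Type*} [NormedCommRing R] {W : Type*} [CommRing W] (ϖ : W) (τ : R → W) {d : ℕ}

/-- Power series all of whose coefficients have Teichmüller expansions bounded by `r`. -/
def boundedSeries (d : ℕ) (r : ℕ → ℝ) : AddSubgroup (MvPowerSeries (Fin d) W) where
  carrier := {f | ∀ i, MvPowerSeries.coeff i f ∈ bounded ϖ τ r}
  zero_mem' i := by simp [zero_mem]
  add_mem' {f g} hf hg i := by rw [map_add]; exact add_mem (hf i) (hg i)
  neg_mem' {f} hf i := by rw [map_neg]; exact neg_mem (hf i)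

variable {ϖ τ} {r r' r'' : ℕ → ℝ}

theorem mul_mem_boundedSeries [IsUltrametricDist R] (hτ : IsTeichmuller ϖ τ)
    (h : ∀ i j, 0 ≤ r i → 0 ≤ r' j → r i * r' j ≤ r'' (i + j))
    {f g : MvPowerSeries (Fin d) W} (hf : f ∈ boundedSeries ϖ τ d r)
    (hg : g ∈ boundedSeries ϖ τ d r') : f * g ∈ boundedSeries ϖ τ d r'' := fun i => by
  classical
  rw [MvPowerSeries.coeff_mul]
  exact sum_mem fun ab _ => hτ.mul_mem_bounded h (hf _) (hg _)

theorem boundedSeries_mono (h : ∀ j, r j ≤ r' j) :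
    boundedSeries ϖ τ d r ≤ boundedSeries ϖ τ d r' := fun _ hf i => bounded_mono h (hf i)

theorem C_mem_boundedSeries {w : W} (hw : w ∈ bounded ϖ τ r) :
    (MvPowerSeries.C w : MvPowerSeries (Fin d) W) ∈ boundedSeries ϖ τ d r := fun i => by
  classical
  rw [MvPowerSeries.coeff_C]
  split_ifs
  · exact hw
  · exact zero_mem _

end BoundedSeries

/-! ### Numerical bounds -/

section GaussBound

variable (p : ℕ) [Fact p.Prime]

/-- The bound on the coefficient of `π ^ j` expressing `‖π ^ (-n) w‖_t ≤ c`. -/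
def gaussBound (t c : ℝ) (n j : ℕ) : ℝ := (c * (p : ℝ) ^ ((j : ℤ) - n)) ^ t⁻¹

variable {p} {t c c' : ℝ} {n : ℕ}

theorem natCast_pos_of_prime : (0 : ℝ) < p := Nat.cast_pos.mpr (Fact.out : p.Prime).pos

theorem one_le_natCast_of_prime : (1 : ℝ) ≤ p :=
  Nat.one_le_cast.mpr (Fact.out : p.Prime).one_lt.le

theorem gaussBound_nonneg (hc : 0 ≤ c) (j : ℕ) : 0 ≤ gaussBound p t c n j :=
  Real.rpow_nonneg (mul_nonneg hc (zpow_pos natCast_pos_of_prime _).le) _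

theorem gaussBound_monotone (ht : 0 < t) (hc : 0 ≤ c) : Monotone (gaussBound p t c n) :=
  fun _ _ hij => Real.rpow_le_rpow (mul_nonneg hc (zpow_pos natCast_pos_of_prime _).le)
    (mul_le_mul_of_nonneg_left (zpow_le_zpow_right₀ one_le_natCast_of_prime
      (sub_le_sub_right (Nat.cast_le.mpr hij) _)) hc) (inv_nonneg.mpr ht.le)

theorem gaussBound_le (ht : 0 < t) (hc : 0 ≤ c) (h : c ≤ c') (j : ℕ) :
    gaussBound p t c n j ≤ gaussBound p t c' n j :=
  Real.rpow_le_rpow (mul_nonneg hc (zpow_pos natCast_pos_of_prime _).le)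
    (mul_le_mul_of_nonneg_right h (zpow_pos natCast_pos_of_prime _).le) (inv_nonneg.mpr ht.le)

theorem gaussBound_add (t c : ℝ) (n m j : ℕ) :
    gaussBound p t c (n + m) (m + j) = gaussBound p t c n j := by
  rw [gaussBound, gaussBound]
  congr 3
  push_cast
  ring

theorem gaussBound_mul (hc : 0 ≤ c) (hc' : 0 ≤ c') (n m i j : ℕ) :
    gaussBound p t c n i * gaussBound p t c' m j = gaussBound p t (c * c') (n + m) (i + j) := by
  rw [gaussBound, gaussBound, gaussBound, ← Real.mul_rpow
    (mul_nonneg hc (zpow_pos natCast_pos_of_prime _).le)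
    (mul_nonneg hc' (zpow_pos natCast_pos_of_prime _).le)]
  congr 1
  rw [show ((i + j : ℕ) : ℤ) - ((n + m : ℕ) : ℤ) = ((i : ℤ) - n) + ((j : ℤ) - m) by push_cast; ring,
    zpow_add₀ natCast_pos_of_prime.ne']
  ring

theorem le_gaussBound_iff (ht : 0 < t) (hc : 0 ≤ c) {x : ℝ} (hx : 0 ≤ x) (j : ℕ) :
    x ≤ gaussBound p t c n j ↔ (p : ℝ) ^ ((n : ℤ) - (j : ℤ)) * x ^ t ≤ c := by
  have hp := zpow_pos (natCast_pos_of_prime (p := p)) ((j : ℤ) - n)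
  rw [gaussBound, Real.le_rpow_inv_iff_of_pos hx (mul_nonneg hc hp.le) ht,
    show (n : ℤ) - (j : ℤ) = -((j : ℤ) - n) by ring, zpow_neg, inv_mul_le_iff₀ hp, mul_comm c]

/-- The two sides are c^(1/t₀) p^((j-n)/t₀) and c^(1/t₀) p^((j-n)/t), so only the sign of j - n and
the order of t and t₀ matter. This is the numerical core of the splitting. -/
theorem gaussBound_le_of_le {t₀ : ℝ} (ht : 0 < t) (ht₀ : 0 < t₀) (hc : 0 ≤ c) {j : ℕ}
    (h : (t ≤ t₀ ∧ n ≤ j) ∨ (t₀ ≤ t ∧ j ≤ n)) :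
    gaussBound p t₀ c n j ≤ gaussBound p t (c ^ (t / t₀)) n j := by
  have hp := zpow_pos (natCast_pos_of_prime (p := p)) ((j : ℤ) - n)
  rw [gaussBound, gaussBound, Real.mul_rpow hc hp.le, Real.mul_rpow (Real.rpow_nonneg hc _) hp.le,
    ← Real.rpow_mul hc, show t / t₀ * t⁻¹ = t₀⁻¹ by field_simp]
  refine mul_le_mul_of_nonneg_left ?_ (Real.rpow_nonneg hc _)
  rcases h with ⟨h, hj⟩ | ⟨h, hj⟩
  · refine Real.rpow_le_rpow_of_exponent_le (one_le_zpow₀ one_le_natCast_of_prime ?_)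
      (inv_anti₀ ht h)
    exact sub_nonneg.mpr (Nat.cast_le.mpr hj)
  · refine Real.rpow_le_rpow_of_exponent_ge hp (zpow_le_one_of_nonpos₀ one_le_natCast_of_prime ?_)
      (inv_anti₀ ht₀ h)
    exact sub_nonpos.mpr (Nat.cast_le.mpr hj)

theorem tendsto_gaussBound (ht : 0 < t) (n j : ℕ) :
    Filter.Tendsto (fun c => gaussBound p t c n j) (nhds 0) (nhds 0) := by
  have h : Filter.Tendsto (fun c : ℝ => c * (p : ℝ) ^ ((j : ℤ) - n)) (nhds 0) (nhds 0) := by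
    simpa using (Filter.tendsto_id (x := nhds (0 : ℝ))).mul_const ((p : ℝ) ^ ((j : ℤ) - n))
  have h' := h.rpow_const (p := t⁻¹) (Or.inr (inv_nonneg.mpr ht.le))
  rwa [Real.zero_rpow (inv_ne_zero ht.ne')] at h'

end GaussBound

/-! ### The Gauss norms -/

section GaussNorm

variable {p : ℕ} [Fact p.Prime] {k : Type*} [CommRing k] {O : Type*} [CommRing O]
  [Algebra (WittVector p k) O] {π : O} {R : Type*} [NormedCommRing R] [Algebra k R]
  {Rp : Subalgebra k R} {d : ℕ}

theorem X_pow_mem_genRing (i : Fin d →₀ ℕ) :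
    MvPowerSeries.monomial i (1 : GenWitt p k π R) ∈ genRing p π Rp d := by
  classical
  refine Subring.subset_closure (Or.inl ⟨fun n => ?_, fun j => ?_⟩)
  · refine (Set.finite_singleton i).subset fun j hj => ?_
    by_contra h
    exact hj (by rw [MvPowerSeries.coeff_monomial_ne h]; exact zero_mem _)
  · rw [MvPowerSeries.coeff_monomial]
    split_ifs
    · exact one_mem _
    · exact zero_mem _

theorem C_coeff_mem_genRing {f : MvPowerSeries (Fin d) (GenWitt p k π R)}
    (hf : f ∈ genRing p π Rp d) (i : Fin d →₀ ℕ) :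
    MvPowerSeries.C (MvPowerSeries.coeff i f) ∈ genRing p π Rp d := by
  classical
  have hC : ∀ w : GenWitt p k π R, MvPowerSeries.C w ∈ genRing p π Rp d → ∀ i : Fin d →₀ ℕ,
      MvPowerSeries.C (MvPowerSeries.coeff i (MvPowerSeries.C w)) ∈ genRing p π Rp d := by
    intro w hw i
    rw [MvPowerSeries.coeff_C]
    split_ifs
    · exact hw
    · rw [map_zero]; exact zero_mem _
  induction hf using Subring.closure_induction generalizing i with
  | mem f hf =>
    rcases hf with ⟨-, hf⟩ | ⟨x, rfl⟩
    · refine Subring.subset_closure (Or.inl ⟨C_mem_restrictedSeries _ d _, fun j => ?_⟩)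
      rw [MvPowerSeries.coeff_C]
      split_ifs
      · exact hf i
      · exact zero_mem _
    · exact hC _ (Subring.subset_closure (Or.inr ⟨x, rfl⟩)) i
  | zero => rw [map_zero, map_zero]; exact zero_mem _
  | one => exact hC 1 (by rw [map_one]; exact one_mem _) i
  | add f g _ _ ih ih' => rw [map_add, map_add]; exact add_mem (ih i) (ih' i)
  | neg f _ ih => rw [map_neg, map_neg]; exact neg_mem (ih i)
  | mul f g _ _ ih ih' =>
    rw [MvPowerSeries.coeff_mul, map_sum]
    exact sum_mem fun ab _ => by rw [map_mul]; exact mul_mem (ih _) (ih' _)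

theorem genRing_le_restrictedSeries :
    genRing p π Rp d ≤ restrictedSeries (GenWitt.base p k π R π) d := by
  refine Subring.closure_le.mpr ?_
  rintro f (hf | ⟨x, rfl⟩)
  · exact hf.1
  · exact C_mem_restrictedSeries _ d _

/-- A uniform bound on the α of all Teichmüller coefficients holds for the generators and passes to
sums and products. It makes the suprema in the Gauss norms finite. -/
theorem exists_mem_boundedSeries [IsUltrametricDist R]
    (hτ : IsTeichmuller (GenWitt.base p k π R π) (GenWitt.teich p k π R))
    (hplus : ∀ w ∈ GenWitt.plus p π Rp,
      w ∈ bounded (GenWitt.base p k π R π) (GenWitt.teich p k π R) (fun _ => 1))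
    {f : MvPowerSeries (Fin d) (GenWitt p k π R)} (hf : f ∈ genRing p π Rp d) :
    ∃ C : ℝ, 0 ≤ C ∧ f ∈ boundedSeries (GenWitt.base p k π R π) (GenWitt.teich p k π R) d
      (fun _ => C) := by
  have hteich : ∀ x : R, MvPowerSeries.C (GenWitt.teich p k π R x) ∈
      boundedSeries (GenWitt.base p k π R π) (GenWitt.teich p k π R) d (fun _ => specNorm x) :=
    fun x => C_mem_boundedSeries (by
      simpa using mul_mem_bounded (ϖ := GenWitt.base p k π R π) (τ := GenWitt.teich p k π R)
        (r := fun _ => specNorm x) (j := 0) (x := x) le_rfl)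
  induction hf using Subring.closure_induction with
  | mem f hf =>
    rcases hf with ⟨-, hf⟩ | ⟨x, rfl⟩
    · exact ⟨1, zero_le_one, fun i => hplus _ (hf i)⟩
    · exact ⟨specNorm x, specNorm_nonneg x, hteich x⟩
  | zero => exact ⟨0, le_rfl, zero_mem _⟩
  | one => exact ⟨specNorm (1 : R), specNorm_nonneg _, by
      have h := hteich 1
      rwa [hτ.map_one, map_one] at h⟩
  | add f g _ _ ih ih' =>
    obtain ⟨C, hC, hf⟩ := ih
    obtain ⟨C', hC', hg⟩ := ih'
    exact ⟨max C C', hC.trans (le_max_left _ _), add_mem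
      (boundedSeries_mono (fun _ => le_max_left C C') hf)
      (boundedSeries_mono (fun _ => le_max_right C C') hg)⟩
  | neg f _ ih =>
    obtain ⟨C, hC, hf⟩ := ih
    exact ⟨C, hC, neg_mem hf⟩
  | mul f g _ _ ih ih' =>
    obtain ⟨C, hC, hf⟩ := ih
    obtain ⟨C', hC', hg⟩ := ih'
    exact ⟨C * C', mul_nonneg hC hC', mul_mem_boundedSeries hτ (fun _ _ _ _ => le_rfl) hf hg⟩

/-- `b = π ^ (-n) f`. -/
def IsRep (b : GenRingInv p π Rp d) (n : ℕ) (f : genRing p π Rp d) : Prop :=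
  b * algebraMap (genRing p π Rp d) (GenRingInv p π Rp d) (genRingPi p π Rp d) ^ n =
    algebraMap (genRing p π Rp d) (GenRingInv p π Rp d) f

theorem exists_isRep (b : GenRingInv p π Rp d) : ∃ n f, IsRep b n f := by
  obtain ⟨n, f, h⟩ := IsLocalization.Away.surj (genRingPi p π Rp d) b
  exact ⟨n, f, h⟩

theorem isRep_algebraMap (f : genRing p π Rp d) :
    IsRep (algebraMap (genRing p π Rp d) (GenRingInv p π Rp d) f) 0 f := by
  rw [IsRep, pow_zero, mul_one]

namespace IsRep

variable {b b' : GenRingInv p π Rp d} {n m : ℕ} {f g : genRing p π Rp d}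

theorem pow_mul (h : IsRep b n f) (m : ℕ) : IsRep b (n + m) (genRingPi p π Rp d ^ m * f) := by
  rw [IsRep, pow_add, ← mul_assoc, h, _root_.map_mul, map_pow, mul_comm]

theorem sub (h : IsRep b n f) (h' : IsRep b' n g) : IsRep (b - b') n (f - g) := by
  rw [IsRep, sub_mul, h, h', map_sub]

theorem mul (h : IsRep b n f) (h' : IsRep b' m g) : IsRep (b * b') (n + m) (f * g) := by
  rw [IsRep, pow_add, mul_mul_mul_comm, h, h', _root_.map_mul]

end IsRep

theorem exists_isRep_pair (b b' : GenRingInv p π Rp d) :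
    ∃ n f g, IsRep b n f ∧ IsRep b' n g := by
  obtain ⟨n, f, hf⟩ := exists_isRep b
  obtain ⟨m, g, hg⟩ := exists_isRep b'
  exact ⟨n + m, _, _, hf.pow_mul m, add_comm m n ▸ hg.pow_mul n⟩

theorem coeff_genRingPi_pow_mul (m : ℕ) (f : genRing p π Rp d) (i : Fin d →₀ ℕ) :
    MvPowerSeries.coeff i (genRingPi p π Rp d ^ m * f).1 =
      GenWitt.base p k π R π ^ m * MvPowerSeries.coeff i f.1 := by
  change MvPowerSeries.coeff i ((MvPowerSeries.C (GenWitt.base p k π R π)) ^ m * f.1) = _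
  rw [← map_pow, MvPowerSeries.coeff_C_mul]

theorem genRingPi_pow_mul_cancel
    (hτ : IsTeichmuller (GenWitt.base p k π R π) (GenWitt.teich p k π R)) (m : ℕ)
    {f : genRing p π Rp d} (h : genRingPi p π Rp d ^ m * f = 0) : f = 0 := by
  refine Subtype.ext (MvPowerSeries.ext fun i => ?_)
  have h' := coeff_genRingPi_pow_mul m f i
  rw [h] at h'
  replace h' : GenWitt.base p k π R π ^ m * MvPowerSeries.coeff i f.1 = 0 := by
    rw [← h']
    exact map_zero (MvPowerSeries.coeff i)
  exact (hτ.eq_zero_of_pow_mul m h').trans (map_zero (MvPowerSeries.coeff i)).symm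

theorem algebraMap_genRing_injective
    (hτ : IsTeichmuller (GenWitt.base p k π R π) (GenWitt.teich p k π R)) :
    Function.Injective (algebraMap (genRing p π Rp d) (GenRingInv p π Rp d)) := by
  refine IsLocalization.injective (M := Submonoid.powers (genRingPi p π Rp d)) _ ?_
  rintro _ ⟨m, rfl⟩
  refine mem_nonZeroDivisors_iff_left.mpr fun f hf => genRingPi_pow_mul_cancel hτ m hf

/-! ### Gauss norms in terms of bounded power series -/

section Bounds

variable [IsUltrametricDist R] [CharP R p]

theorem hasTeichExpansion_iff
    (hτ : IsTeichmuller (GenWitt.base p k π R π) (GenWitt.teich p k π R)) {w : GenWitt p k π R}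
    {a : ℕ → R} : HasTeichExpansion p π w a ↔
      a = teichCoeff (GenWitt.base p k π R π) (GenWitt.teich p k π R) w := by
  have e : HasTeichExpansion p π w a ↔
      IsExpansion (GenWitt.base p k π R π) (GenWitt.teich p k π R) w a :=
    forall_congr' fun _ => Ideal.mem_span_singleton
  rw [e]
  exact ⟨fun h => (hτ.teichCoeff_eq h).symm, fun h => h ▸ hτ.isExpansion_teichCoeff w⟩

theorem mem_boundedSeries_gaussBound
    (hτ : IsTeichmuller (GenWitt.base p k π R π) (GenWitt.teich p k π R))
    {t c : ℝ} (ht : 0 < t) (hc : 0 ≤ c) {n : ℕ} {f : MvPowerSeries (Fin d) (GenWitt p k π R)} :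
    f ∈ boundedSeries (GenWitt.base p k π R π) (GenWitt.teich p k π R) d (gaussBound p t c n) ↔
      ∀ (i : Fin d →₀ ℕ) (j : ℕ), (p : ℝ) ^ ((n : ℤ) - (j : ℤ)) *
        specNorm (teichCoeff (GenWitt.base p k π R π) (GenWitt.teich p k π R)
          (MvPowerSeries.coeff i f) j) ^ t ≤ c := by
  refine forall_congr' fun i => ?_
  rw [hτ.mem_bounded_iff p (gaussBound_monotone ht hc) (gaussBound_nonneg hc)]
  exact forall_congr' fun j => le_gaussBound_iff ht hc (specNorm_nonneg _) j

theorem pow_mul_mem_boundedSeries_iff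
    (hτ : IsTeichmuller (GenWitt.base p k π R π) (GenWitt.teich p k π R))
    {t c : ℝ} (ht : 0 < t) (hc : 0 ≤ c) (n m : ℕ) (f : genRing p π Rp d) :
    (genRingPi p π Rp d ^ m * f).1 ∈ boundedSeries (GenWitt.base p k π R π)
        (GenWitt.teich p k π R) d (gaussBound p t c (n + m)) ↔
      f.1 ∈ boundedSeries (GenWitt.base p k π R π) (GenWitt.teich p k π R) d
        (gaussBound p t c n) := by
  refine forall_congr' fun i => ?_
  rw [coeff_genRingPi_pow_mul]
  constructor
  · rw [hτ.mem_bounded_iff p (gaussBound_monotone ht hc) (gaussBound_nonneg hc),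
      hτ.mem_bounded_iff p (gaussBound_monotone ht hc) (gaussBound_nonneg hc)]
    intro h j
    have h' := h (m + j)
    simp only [hτ.teichCoeff_pow_mul] at h'
    rwa [if_neg (by omega), Nat.add_sub_cancel_left, gaussBound_add] at h'
  · exact fun h => pow_mul_mem_bounded m (fun j => (gaussBound_add t c n m j).ge) h

/-- The supremum formed from a representation does not depend on it, because π^m shifts Teichmüller
coefficients and bounds alike; the infimum in `gaussNorm` is then over one element. All later
estimates go through this criterion. -/
theorem gaussNorm_eq
    (hτ : IsTeichmuller (GenWitt.base p k π R π) (GenWitt.teich p k π R))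
    (hplus : ∀ w ∈ GenWitt.plus p π Rp,
      w ∈ bounded (GenWitt.base p k π R π) (GenWitt.teich p k π R) (fun _ => 1))
    {t : ℝ} (ht : 0 < t) {b : GenRingInv p π Rp d} {n : ℕ} {f : genRing p π Rp d}
    (h : IsRep b n f) : 0 ≤ gaussNorm p π t b ∧ ∀ c, 0 ≤ c → (gaussNorm p π t b ≤ c ↔
      f.1 ∈ boundedSeries (GenWitt.base p k π R π) (GenWitt.teich p k π R) d
        (gaussBound p t c n)) := by
  let S : ℕ → genRing p π Rp d → ℝ := fun n f => ⨆ ij : (Fin d →₀ ℕ) × ℕ,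
    (p : ℝ) ^ ((n : ℤ) - (ij.2 : ℤ)) * specNorm (teichCoeff (GenWitt.base p k π R π)
      (GenWitt.teich p k π R) (MvPowerSeries.coeff ij.1 f.1) ij.2) ^ t
  have hS0 : ∀ n f, 0 ≤ S n f := fun n f => Real.iSup_nonneg fun ij =>
    mul_nonneg (zpow_pos natCast_pos_of_prime _).le (Real.rpow_nonneg (specNorm_nonneg _) _)
  have hS : ∀ n f c, 0 ≤ c → (S n f ≤ c ↔ f.1 ∈ boundedSeries (GenWitt.base p k π R π)
      (GenWitt.teich p k π R) d (gaussBound p t c n)) := by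
    intro n f c hc
    -- Boundedness matters: an unbounded real supremum has the default value 0.
    have hbdd : BddAbove (Set.range fun ij : (Fin d →₀ ℕ) × ℕ =>
        (p : ℝ) ^ ((n : ℤ) - (ij.2 : ℤ)) * specNorm (teichCoeff (GenWitt.base p k π R π)
          (GenWitt.teich p k π R) (MvPowerSeries.coeff ij.1 f.1) ij.2) ^ t) := by
      obtain ⟨C, hC, hf⟩ := exists_mem_boundedSeries hτ hplus f.2
      refine ⟨(p : ℝ) ^ (n : ℤ) * C ^ t, ?_⟩
      rintro _ ⟨ij, rfl⟩
      refine mul_le_mul (zpow_le_zpow_right₀ one_le_natCast_of_prime (by omega))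
        (Real.rpow_le_rpow (specNorm_nonneg _) ?_ ht.le) (Real.rpow_nonneg (specNorm_nonneg _) _)
        (zpow_pos natCast_pos_of_prime _).le
      exact (hτ.mem_bounded_iff p monotone_const (fun _ => hC)).mp (hf ij.1) ij.2
    rw [mem_boundedSeries_gaussBound hτ ht hc]
    exact (ciSup_le_iff hbdd).trans Prod.forall
  have huniq : ∀ n' f', IsRep b n' f' → S n' f' = S n f := by
    have hle : ∀ {n n' f f'}, IsRep b n f → IsRep b n' f' → S n' f' ≤ S n f := by
      intro n n' f f' h h'
      have e : genRingPi p π Rp d ^ n' * f = genRingPi p π Rp d ^ n * f' := by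
        refine algebraMap_genRing_injective hτ ?_
        rw [← h.pow_mul n', add_comm, h'.pow_mul n]
      rw [hS _ _ _ (hS0 n f), ← pow_mul_mem_boundedSeries_iff hτ ht (hS0 n f) n' n, ← e,
        add_comm, pow_mul_mem_boundedSeries_iff hτ ht (hS0 n f), ← hS _ _ _ (hS0 n f)]
    exact fun n' f' h' => le_antisymm (hle h h') (hle h' h)
  have key : gaussNorm p π t b = S n f := by
    refine Eq.trans (congrArg sInf (Set.ext fun c => ?_)) (csInf_singleton (S n f))
    constructor
    · rintro ⟨n', f', a, h', ha, rfl⟩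
      have ha' : a = fun i => teichCoeff (GenWitt.base p k π R π) (GenWitt.teich p k π R)
        (MvPowerSeries.coeff i f'.1) := funext fun i => (hasTeichExpansion_iff hτ).mp (ha i)
      rw [ha']
      exact huniq n' f' h'
    · rintro rfl
      exact ⟨n, f, _, h, fun i => (hasTeichExpansion_iff hτ).mpr rfl, rfl⟩
  rw [key]
  exact ⟨hS0 n f, hS n f⟩

end Bounds

end GaussNorm

end DeformedRobba

end

noncomputable section

set_option linter.unusedSectionVars false

namespace DeformedRobba

/-! ### The Gauss norms form a Gauss family -/

section GaussFamily

variable {p : ℕ} [Fact p.Prime] {k : Type*} [CommRing k] {O : Type*} [CommRing O]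
  [Algebra (WittVector p k) O] {π : O} {R : Type*} [NormedCommRing R] [Algebra k R]
  {Rp : Subalgebra k R} {d : ℕ} [IsUltrametricDist R] [CharP R p]

theorem gaussBound_pos {t c : ℝ} (hc : 0 < c) (n j : ℕ) : 0 < gaussBound p t c n j :=
  Real.rpow_pos_of_pos (mul_pos hc (zpow_pos natCast_pos_of_prime _)) _

/-- For a fixed index j only the coefficients of index at most j interact, and the t₀-bounds on
these finitely many coefficients of g m tend to 0; so they eventually fall below the t-bounds to be
proved for x. -/
theorem gaussNorm_closed
    (hτ : IsTeichmuller (GenWitt.base p k π R π) (GenWitt.teich p k π R))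
    (hplus : ∀ w ∈ GenWitt.plus p π Rp,
      w ∈ bounded (GenWitt.base p k π R π) (GenWitt.teich p k π R) (fun _ => 1))
    {t t₀ : ℝ} (ht : 0 < t) (ht₀ : 0 < t₀) (x : GenRingInv p π Rp d) (g : ℕ → GenRingInv p π Rp d)
    (δ : ℝ) (h₀ : Filter.Tendsto (fun m => gaussNorm p π t₀ (g m)) Filter.atTop (nhds 0))
    (h : ∀ m, gaussNorm p π t (x - g m) ≤ δ) : gaussNorm p π t x ≤ δ := by
  have hnn : ∀ {t}, 0 < t → ∀ y : GenRingInv p π Rp d, 0 ≤ gaussNorm p π t y := fun ht y => by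
    obtain ⟨n, f, hf⟩ := exists_isRep y
    exact (gaussNorm_eq hτ hplus ht hf).1
  refine le_of_forall_pos_le_add fun ε hε => ?_
  have hδ : 0 ≤ δ := (hnn ht _).trans (h 0)
  -- The slack ε keeps the bounds to be beaten strictly positive when δ = 0.
  have hc : 0 < δ + ε := by positivity
  obtain ⟨n, f, hf⟩ := exists_isRep x
  rw [(gaussNorm_eq hτ hplus ht hf).2 _ hc.le]
  intro i
  rw [hτ.mem_bounded_iff p (gaussBound_monotone ht hc.le) (gaussBound_nonneg hc.le)]
  intro j
  have hev : ∀ᶠ m in Filter.atTop, ∀ l ∈ Finset.range (j + 1),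
      gaussBound p t₀ (gaussNorm p π t₀ (g m)) n l < gaussBound p t (δ + ε) n l :=
    (Filter.eventually_all_finset _).mpr fun l _ =>
      ((tendsto_gaussBound ht₀ n l).comp h₀).eventually_lt_const (gaussBound_pos hc n l)
  obtain ⟨m, hm⟩ := hev.exists
  obtain ⟨n', G, hG⟩ := exists_isRep (g m)
  have hf' := hf.pow_mul n'
  have hG' : IsRep (g m) (n + n') (genRingPi p π Rp d ^ n * G) := add_comm n' n ▸ hG.pow_mul n
  have hη := hnn ht₀ (g m)
  have h1 := ((gaussNorm_eq hτ hplus ht (hf'.sub hG')).2 _ hc.le).mp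
    ((h m).trans (le_add_of_nonneg_right hε.le)) i
  have h2 := ((gaussNorm_eq hτ hplus ht₀ hG').2 _ hη).mp le_rfl i
  have e : MvPowerSeries.coeff i (genRingPi p π Rp d ^ n' * f - genRingPi p π Rp d ^ n * G).1 =
      MvPowerSeries.coeff i (genRingPi p π Rp d ^ n' * f).1 -
        MvPowerSeries.coeff i (genRingPi p π Rp d ^ n * G).1 := map_sub _ _ _
  rw [e] at h1
  -- Over the common denominator π^(n + n') the coefficient j of f sits at index n' + j, and the
  -- coefficients below n' vanish.
  have key := hτ.specNorm_teichCoeff_le_of_sub p (gaussBound_monotone ht hc.le)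
    (gaussBound_nonneg hc.le) (gaussBound_monotone ht₀ hη) (gaussBound_nonneg hη) h1 h2
    (n := n' + j + 1) (fun l hl => ?_) (n' + j) (Nat.lt_succ_self _)
  · rw [coeff_genRingPi_pow_mul, hτ.teichCoeff_pow_mul, gaussBound_add] at key
    simpa using key
  · rw [coeff_genRingPi_pow_mul, hτ.teichCoeff_pow_mul]
    rcases lt_or_ge l n' with hl' | hl'
    · exact Or.inl (if_pos hl')
    · obtain ⟨l, rfl⟩ := Nat.exists_eq_add_of_le hl'
      rw [gaussBound_add, gaussBound_add]
      exact Or.inr (hm l (Finset.mem_range.mpr (by omega))).le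

theorem teichCoeff_eq_zero_of_dvd
    {W : Type*} [CommRing W] {ϖ : W} {τ : R → W} (hτ : IsTeichmuller ϖ τ) {w : W} {n : ℕ}
    (h : ϖ ^ n ∣ w) {j : ℕ} (hj : j < n) : teichCoeff ϖ τ w j = 0 := by
  obtain ⟨y, rfl⟩ := h
  rw [hτ.teichCoeff_pow_mul]
  exact if_pos hj

/-- Splitting off the terms `π ^ j [x] T ^ i` with `j < n`. -/
theorem exists_truncation
    (hτ : IsTeichmuller (GenWitt.base p k π R π) (GenWitt.teich p k π R)) (f : genRing p π Rp d)
    (n : ℕ) : ∃ v : genRing p π Rp d, ∀ i, MvPowerSeries.coeff i v.1 =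
      ∑ j ∈ Finset.range n, GenWitt.base p k π R π ^ j * GenWitt.teich p k π R
        (teichCoeff (GenWitt.base p k π R π) (GenWitt.teich p k π R)
          (MvPowerSeries.coeff i f.1) j) := by
  classical
  -- For all but finitely many i the coefficient f_i is divisible by π^n and its truncation is 0. So
  -- the truncation is a polynomial in T built from π, Teichmüller elements and monomials, and lies
  -- in `genRing`.
  have hfin := genRing_le_restrictedSeries f.2 n
  let s : (Fin d →₀ ℕ) → GenWitt p k π R := fun i =>
    ∑ j ∈ Finset.range n, GenWitt.base p k π R π ^ j * GenWitt.teich p k π R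
        (teichCoeff (GenWitt.base p k π R π) (GenWitt.teich p k π R)
          (MvPowerSeries.coeff i f.1) j)
  have hs : ∀ i, MvPowerSeries.C (s i) ∈ genRing p π Rp d := fun i => by
    rw [map_sum]
    refine sum_mem fun j _ => ?_
    rw [map_mul, map_pow]
    exact mul_mem (pow_mem (C_base_mem_genRing p π Rp d π) j)
      (Subring.subset_closure (Or.inr ⟨_, rfl⟩))
  refine ⟨⟨∑ i ∈ hfin.toFinset, MvPowerSeries.C (s i) * MvPowerSeries.monomial i 1,
    sum_mem fun i _ => mul_mem (hs i) (X_pow_mem_genRing i)⟩, fun i => ?_⟩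
  rw [map_sum]
  simp only [MvPowerSeries.coeff_C_mul, MvPowerSeries.coeff_monomial, mul_ite, mul_one, mul_zero]
  rw [Finset.sum_ite_eq]
  split_ifs with hi
  · rfl
  · rw [Set.Finite.mem_toFinset, Set.mem_ofPred_eq, not_not, Ideal.mem_span_singleton] at hi
    refine (Finset.sum_eq_zero fun j hj => ?_).symm
    rw [teichCoeff_eq_zero_of_dvd hτ hi (Finset.mem_range.mp hj), hτ.map_zero, mul_zero]

theorem gaussNorm_split
    (hτ : IsTeichmuller (GenWitt.base p k π R π) (GenWitt.teich p k π R))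
    (hplus : ∀ w ∈ GenWitt.plus p π Rp,
      w ∈ bounded (GenWitt.base p k π R π) (GenWitt.teich p k π R) (fun _ => 1))
    (e : GenRingInv p π Rp d) : ∃ u v, e = u + v ∧
    (∀ t t₀, 0 < t → t ≤ t₀ → gaussNorm p π t u ≤ gaussNorm p π t₀ e ^ (t / t₀)) ∧
    (∀ t t₀, 0 < t₀ → t₀ ≤ t → gaussNorm p π t v ≤ gaussNorm p π t₀ e ^ (t / t₀)) := by
  obtain ⟨n, f, hf⟩ := exists_isRep e
  obtain ⟨g, hg⟩ := exists_truncation hτ f n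
  -- With e = π^(-n) f, truncating f below index n collects exactly the negative powers of π in e.
  let v : GenRingInv p π Rp d := algebraMap _ _ g * IsLocalization.Away.invSelf
    (genRingPi p π Rp d) ^ n
  have hv : IsRep v n g := by
    rw [IsRep, mul_assoc, ← mul_pow, mul_comm (IsLocalization.Away.invSelf _),
      IsLocalization.Away.mul_invSelf, one_pow, mul_one]
  have hcoef : ∀ t₀, 0 < t₀ → ∀ i j, specNorm (teichCoeff (GenWitt.base p k π R π)
      (GenWitt.teich p k π R) (MvPowerSeries.coeff i f.1) j) ≤
        gaussBound p t₀ (gaussNorm p π t₀ e) n j := fun t₀ ht₀ i j => by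
    have h := gaussNorm_eq hτ hplus ht₀ hf
    exact (hτ.mem_bounded_iff p (gaussBound_monotone ht₀ h.1) (gaussBound_nonneg h.1)).mp
      ((h.2 _ h.1).mp le_rfl i) j
  have hnn : ∀ t₀, 0 < t₀ → 0 ≤ gaussNorm p π t₀ e := fun t₀ ht₀ =>
    (gaussNorm_eq hτ hplus ht₀ hf).1
  refine ⟨e - v, v, (sub_add_cancel e v).symm, fun t t₀ ht h => ?_, fun t t₀ ht₀ h => ?_⟩
  · have ht₀ := ht.trans_le h
    have hc : 0 ≤ gaussNorm p π t₀ e ^ (t / t₀) := Real.rpow_nonneg (hnn t₀ ht₀) _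
    rw [(gaussNorm_eq hτ hplus ht (hf.sub hv)).2 _ hc]
    intro i
    have e' : MvPowerSeries.coeff i (f - g).1 =
        MvPowerSeries.coeff i f.1 - MvPowerSeries.coeff i g.1 := map_sub _ _ _
    rw [hτ.mem_bounded_iff p (gaussBound_monotone ht hc) (gaussBound_nonneg hc), e', hg,
      hτ.teichCoeff_sub_sum]
    intro j
    dsimp only
    split_ifs with hj
    · rw [specNorm_zero]; exact gaussBound_nonneg hc j
    · exact (hcoef t₀ ht₀ i j).trans
        (gaussBound_le_of_le ht ht₀ (hnn t₀ ht₀) (Or.inl ⟨h, not_lt.mp hj⟩))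
  · have ht := ht₀.trans_le h
    have hc : 0 ≤ gaussNorm p π t₀ e ^ (t / t₀) := Real.rpow_nonneg (hnn t₀ ht₀) _
    rw [(gaussNorm_eq hτ hplus ht hv).2 _ hc]
    intro i
    rw [hg]
    exact sum_mem fun j hj => mul_mem_bounded ((hcoef t₀ ht₀ i j).trans
      (gaussBound_le_of_le ht ht₀ (hnn t₀ ht₀) (Or.inr ⟨h, (Finset.mem_range.mp hj).le⟩)))

theorem isGaussFamily_gaussNorm
    (hτ : IsTeichmuller (GenWitt.base p k π R π) (GenWitt.teich p k π R))
    (hplus : ∀ w ∈ GenWitt.plus p π Rp,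
      w ∈ bounded (GenWitt.base p k π R π) (GenWitt.teich p k π R) (fun _ => 1)) :
    IsGaussFamily (gaussNorm p π (Rp := Rp) (d := d)) where
  nonneg ht x := by
    obtain ⟨n, f, hf⟩ := exists_isRep x
    exact (gaussNorm_eq hτ hplus ht hf).1
  map_zero ht := by
    have h := gaussNorm_eq hτ hplus ht (b := (0 : GenRingInv p π Rp d))
      (n := 0) (f := 0) (by rw [IsRep, map_zero, zero_mul])
    exact le_antisymm ((h.2 0 le_rfl).mpr (zero_mem _)) h.1
  sub_le ht x y := by
    obtain ⟨n, f, g, hf, hg⟩ := exists_isRep_pair x y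
    have hx := gaussNorm_eq hτ hplus ht hf
    have hy := gaussNorm_eq hτ hplus ht hg
    rw [(gaussNorm_eq hτ hplus ht (hf.sub hg)).2 _ (hx.1.trans (le_max_left _ _))]
    exact sub_mem
      (boundedSeries_mono (gaussBound_le ht hx.1 (le_max_left _ _)) ((hx.2 _ hx.1).mp le_rfl))
      (boundedSeries_mono (gaussBound_le ht hy.1 (le_max_right _ _)) ((hy.2 _ hy.1).mp le_rfl))
  mul_le ht x y := by
    obtain ⟨n, f, hf⟩ := exists_isRep x
    obtain ⟨m, g, hg⟩ := exists_isRep y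
    have hx := gaussNorm_eq hτ hplus ht hf
    have hy := gaussNorm_eq hτ hplus ht hg
    rw [(gaussNorm_eq hτ hplus ht (hf.mul hg)).2 _ (mul_nonneg hx.1 hy.1)]
    exact mul_mem_boundedSeries hτ (fun i j _ _ => (gaussBound_mul hx.1 hy.1 n m i j).le)
      ((hx.2 _ hx.1).mp le_rfl) ((hy.2 _ hy.1).mp le_rfl)
  closed := gaussNorm_closed hτ hplus
  split := gaussNorm_split hτ hplus

end GaussFamily

end DeformedRobba

end

noncomputable section

set_option linter.unusedSectionVars false

namespace DeformedRobba

/-! ### Orthogonal complements of saturated ideals of restricted power series -/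

section Complement

variable {S : Type*} [CommRing S] {ϖ : S} {d : ℕ}

variable (ϖ d) in
/-- The constants in `S⟨T₁, …, T_d⟩`. -/
def restrictedC : S →+* restrictedSeries ϖ d :=
  (MvPowerSeries.C : S →+* MvPowerSeries (Fin d) S).codRestrict (restrictedSeries ϖ d)
    (C_mem_restrictedSeries ϖ d)

/-- The coefficients of a restricted power series. -/
def restrictedCoeff (i : Fin d →₀ ℕ) : restrictedSeries ϖ d →+ S :=
  (MvPowerSeries.coeff i).toAddMonoidHom.comp (restrictedSeries ϖ d).subtype.toAddMonoidHom

theorem restrictedSeries_ext {f g : restrictedSeries ϖ d}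
    (h : ∀ i, restrictedCoeff i f = restrictedCoeff i g) : f = g :=
  Subtype.ext (MvPowerSeries.ext h)

@[simp]
theorem restrictedCoeff_C_mul (a : S) (f : restrictedSeries ϖ d) (i : Fin d →₀ ℕ) :
    restrictedCoeff i (restrictedC ϖ d a * f) = a * restrictedCoeff i f :=
  MvPowerSeries.coeff_C_mul _ _ _

theorem finite_not_dvd_restrictedCoeff (f : restrictedSeries ϖ d) (n : ℕ) :
    {i | ¬ ϖ ^ n ∣ restrictedCoeff i f}.Finite := by
  have h := f.2 n
  simp only [Ideal.mem_span_singleton] at h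
  exact h

theorem exists_restrictedCoeff_eq {f : (Fin d →₀ ℕ) → S}
    (h : ∀ n, {i | ¬ ϖ ^ n ∣ f i}.Finite) :
    ∃ g : restrictedSeries ϖ d, ∀ i, restrictedCoeff i g = f i :=
  ⟨⟨fun i => f i, fun n => by simp only [Ideal.mem_span_singleton]; exact h n⟩, fun _ => rfl⟩

variable (ϖ) in
/-- The monomials in `S⟨T₁, …, T_d⟩`. -/
def restrictedMonomial (i : Fin d →₀ ℕ) : restrictedSeries ϖ d :=
  ⟨MvPowerSeries.monomial i 1, fun n => by
    classical
    refine (Set.finite_singleton i).subset fun j hj => ?_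
    by_contra h
    exact hj (by rw [MvPowerSeries.coeff_monomial_ne h]; exact zero_mem _)⟩

theorem restrictedCoeff_monomial [DecidableEq (Fin d →₀ ℕ)] (i j : Fin d →₀ ℕ) :
    restrictedCoeff j (restrictedMonomial ϖ i) = if j = i then 1 else 0 := by
  classical
  exact (MvPowerSeries.coeff_monomial j i 1).trans (by congr)

theorem restrictedCoeff_sum_monomial [DecidableEq (Fin d →₀ ℕ)] (F : Finset (Fin d →₀ ℕ))
    (a : (Fin d →₀ ℕ) → S) (j : Fin d →₀ ℕ) :
    restrictedCoeff j (∑ i ∈ F, restrictedC ϖ d (a i) * restrictedMonomial ϖ i) =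
      if j ∈ F then a j else 0 := by
  rw [map_sum]
  simp only [restrictedCoeff_C_mul, restrictedCoeff_monomial, mul_ite, mul_one, mul_zero]
  rw [Finset.sum_ite_eq]

section Domain

variable [IsDomain S]

theorem exists_pow_mul_eq (hϖ : ϖ ≠ 0) {f : restrictedSeries ϖ d} {n : ℕ}
    (h : ∀ i, ϖ ^ n ∣ restrictedCoeff i f) : ∃ g, restrictedC ϖ d (ϖ ^ n) * g = f := by
  choose a ha using h
  obtain ⟨g, hg⟩ := exists_restrictedCoeff_eq (ϖ := ϖ) (f := a) fun m =>
    (finite_not_dvd_restrictedCoeff f (n + m)).subset fun i hi h => hi (by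
      rw [ha, pow_add] at h
      exact (mul_dvd_mul_iff_left (pow_ne_zero n hϖ)).mp h)
  exact ⟨g, restrictedSeries_ext fun i => by rw [restrictedCoeff_C_mul, hg, ha]⟩

theorem exists_sub_sum_monomial (hϖ : ϖ ≠ 0) (f : restrictedSeries ϖ d) {n : ℕ} {G : Finset (Fin d →₀ ℕ)}
    (hG : ∀ i, ¬ ϖ ^ n ∣ restrictedCoeff i f → i ∈ G) :
    ∃ g, restrictedC ϖ d (ϖ ^ n) * g =
      f - ∑ i ∈ G, restrictedC ϖ d (restrictedCoeff i f) * restrictedMonomial ϖ i := by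
  classical
  refine exists_pow_mul_eq hϖ fun i => ?_
  rw [map_sub, restrictedCoeff_sum_monomial]
  split_ifs with h
  · rw [sub_self]; exact dvd_zero _
  · rw [sub_zero]
    by_contra h'
    exact h (hG i h')

end Domain

/-- Adic limits of series of restricted power series. -/
theorem exists_adic_limit (hH : ∀ x : S, (∀ n, ϖ ^ n ∣ x) → x = 0)
    (hC : ∀ s : ℕ → S, (∀ n, ϖ ^ n ∣ s (n + 1) - s n) → ∃ L, ∀ n, ϖ ^ n ∣ L - s n)
    (hϖ : ϖ ≠ 0) [IsDomain S] (v : ℕ → restrictedSeries ϖ d) {s : Set (Fin d →₀ ℕ)}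
    (hv : ∀ n, ∀ i ∉ s, restrictedCoeff i (v n) = 0) :
    ∃ L : restrictedSeries ϖ d, (∀ i ∉ s, restrictedCoeff i L = 0) ∧ ∀ n, ∃ g,
      restrictedC ϖ d (ϖ ^ n) * g = L - ∑ m ∈ Finset.range n, restrictedC ϖ d (ϖ ^ m) * v m := by
  let σ : (Fin d →₀ ℕ) → ℕ → S := fun i n =>
    ∑ m ∈ Finset.range n, ϖ ^ m * restrictedCoeff i (v m)
  have hσ : ∀ i n, restrictedCoeff i
      (∑ m ∈ Finset.range n, restrictedC ϖ d (ϖ ^ m) * v m) = σ i n := fun i n => by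
    rw [map_sum]
    simp only [restrictedCoeff_C_mul]
    rfl
  have key : ∀ i, ∃ l, ∀ n, ϖ ^ n ∣ l - σ i n := fun i => hC (σ i) fun n => by
    simp only [σ]
    rw [Finset.sum_range_succ, add_sub_cancel_left]
    exact dvd_mul_right _ _
  choose l hl using key
  obtain ⟨L, hL⟩ := exists_restrictedCoeff_eq (ϖ := ϖ) (f := l) fun n =>
    (finite_not_dvd_restrictedCoeff
      (∑ m ∈ Finset.range n, restrictedC ϖ d (ϖ ^ m) * v m) n).subset fun i hi h => hi (by
        rw [hσ] at h
        exact (dvd_iff_dvd_of_dvd_sub (hl i n)).mpr h)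
  refine ⟨L, fun i hi => ?_, fun n => exists_pow_mul_eq hϖ fun i => ?_⟩
  · rw [hL]
    refine hH _ fun n => (dvd_iff_dvd_of_dvd_sub (hl i n)).mpr ?_
    refine Finset.dvd_sum fun m _ => ?_
    rw [hv m i hi, mul_zero]
    exact dvd_zero _
  · rw [map_sub, hσ, hL]
    exact hl i n

end Complement

/-! ### Monomial complements over a complete discrete valuation ring -/

section DVR

variable {S : Type*} [CommRing S] [IsDomain S] [IsDiscreteValuationRing S] {ϖ : S} {d : ℕ}

/-- A set of monomials that is a basis of `S⟨T⟩` modulo `J` and `ϖ`. -/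
theorem exists_monomial_basis (hϖ : Irreducible ϖ) (J : Ideal (restrictedSeries ϖ d)) :
    ∃ s : Set (Fin d →₀ ℕ),
      (∀ v : restrictedSeries ϖ d, (∀ i ∉ s, restrictedCoeff i v = 0) → ∀ q ∈ J, ∀ h,
        v = q + restrictedC ϖ d ϖ * h → ∀ i, ϖ ∣ restrictedCoeff i v) ∧
      ∀ f : restrictedSeries ϖ d, ∃ v, (∀ i ∉ s, restrictedCoeff i v = 0) ∧ ∃ q ∈ J, ∃ h,
        f = v + q + restrictedC ϖ d ϖ * h := by
  classical
  have hunit : ∀ x, ¬ ϖ ∣ x → IsUnit x := fun x hx => by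
    by_contra h
    have h' := (IsLocalRing.mem_maximalIdeal x).mpr h
    rw [hϖ.maximalIdeal_eq, Ideal.mem_span_singleton] at h'
    exact hx h'
  let Q : Set (Set (Fin d →₀ ℕ)) := {s | ∀ v : restrictedSeries ϖ d,
    (∀ i ∉ s, restrictedCoeff i v = 0) → ∀ q ∈ J, ∀ h,
      v = q + restrictedC ϖ d ϖ * h → ∀ i, ϖ ∣ restrictedCoeff i v}
  obtain ⟨s, hs⟩ : ∃ s, Maximal (· ∈ Q) s := by
    -- Independence is a finite condition: modulo ϖ a restricted series is a polynomial, so its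
    -- exponents lie in one member of the chain.
    refine zorn_subset Q fun c hcQ hc => ?_
    rcases c.eq_empty_or_nonempty with rfl | hne
    · refine ⟨∅, fun v hv q _ h _ i => ?_, by simp⟩
      rw [hv i (Set.notMem_empty i)]
      exact dvd_zero _
    refine ⟨⋃₀ c, fun v hv q hq h e i => ?_, fun t ht => Set.subset_sUnion_of_mem ht⟩
    have hfin := finite_not_dvd_restrictedCoeff v 1
    rw [pow_one] at hfin
    obtain ⟨t, htc, ht⟩ := hc.directedOn.exists_mem_subset_of_finset_subset_biUnion (s := hfin.toFinset)
      hne (f := fun i => i) (by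
      intro i hi
      rw [Set.Finite.coe_toFinset] at hi
      rw [← Set.sUnion_eq_biUnion]
      by_contra h'
      exact hi (by rw [hv i h']; exact dvd_zero _))
    rw [Set.Finite.coe_toFinset] at ht
    obtain ⟨w, hw⟩ := exists_sub_sum_monomial (n := 1) hϖ.ne_zero v (G := hfin.toFinset)
      fun i hi => by rw [pow_one] at hi; rwa [Set.Finite.mem_toFinset, Set.mem_ofPred_eq]
    rw [pow_one] at hw
    have h1 := hcQ htc (v - restrictedC ϖ d ϖ * w) (fun i hi => ?_) q hq (h - w)
      (by rw [e]; ring) i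
    · rw [map_sub, restrictedCoeff_C_mul] at h1
      exact (dvd_sub_left (dvd_mul_right _ _)).mp h1
    · rw [hw, sub_sub_cancel, restrictedCoeff_sum_monomial, if_neg fun h' => hi (ht ?_)]
      simpa using h'
  refine ⟨s, hs.prop, ?_⟩
  have hmon : ∀ i, ∃ v : restrictedSeries ϖ d, (∀ j ∉ s, restrictedCoeff j v = 0) ∧
      ∃ q ∈ J, ∃ h, restrictedMonomial ϖ i = v + q + restrictedC ϖ d ϖ * h := by
    intro i
    by_cases hi : i ∈ s
    · refine ⟨restrictedMonomial ϖ i, fun j hj => ?_, 0, zero_mem _, 0, by ring⟩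
      rw [restrictedCoeff_monomial, if_neg]
      rintro rfl
      exact hj hi
    have hnot : insert i s ∉ Q := fun h =>
      hi (hs.le_of_ge h (Set.subset_insert i s) (Set.mem_insert i s))
    simp only [Q, Set.mem_ofPred_eq, not_forall] at hnot
    obtain ⟨v, hv, q, hq, h, e, j, hj⟩ := hnot
    have hvi : ∀ l ∉ s, restrictedCoeff l
        (v - restrictedC ϖ d (restrictedCoeff i v) * restrictedMonomial ϖ i) = 0 := fun l hl => by
      rw [map_sub, restrictedCoeff_C_mul, restrictedCoeff_monomial]
      split_ifs with hli
      · rw [hli, mul_one, sub_self]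
      · rw [mul_zero, sub_zero]
        exact hv l fun h' => h'.elim hli hl
    -- If ϖ divided the coefficient at i, dropping that monomial would leave a nontrivial relation
    -- on s. Being a unit, it can be divided out to express T^i by monomials in s.
    have hu : IsUnit (restrictedCoeff i v) := by
      refine hunit _ fun hdvd => hj ?_
      obtain ⟨a, ha⟩ := hdvd
      have h1 := hs.prop _ hvi q hq (h - restrictedC ϖ d a * restrictedMonomial ϖ i) (by
        rw [ha, map_mul, e]; ring) j
      rw [map_sub, restrictedCoeff_C_mul] at h1
      exact (dvd_sub_left (by rw [ha, mul_assoc]; exact dvd_mul_right _ _)).mp h1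
    obtain ⟨u, hu⟩ := hu
    have hu' : restrictedC ϖ d (↑u⁻¹) * restrictedC ϖ d (restrictedCoeff i v) = 1 := by
      rw [← map_mul, ← hu, Units.inv_mul, map_one]
    refine ⟨restrictedC ϖ d (↑u⁻¹) * (restrictedC ϖ d (restrictedCoeff i v) *
      restrictedMonomial ϖ i - v), fun l hl => ?_, restrictedC ϖ d (↑u⁻¹) * q,
      J.mul_mem_left _ hq, restrictedC ϖ d (↑u⁻¹) * h, ?_⟩
    · rw [restrictedCoeff_C_mul, ← neg_sub, map_neg, hvi l hl, neg_zero, mul_zero]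
    · linear_combination (-restrictedMonomial ϖ i) * hu' + restrictedC ϖ d (↑u⁻¹) * e
  choose v hv q hq h e using hmon
  intro f
  have hfin := finite_not_dvd_restrictedCoeff f 1
  rw [pow_one] at hfin
  obtain ⟨w, hw⟩ := exists_sub_sum_monomial (n := 1) hϖ.ne_zero f (G := hfin.toFinset)
    fun i hi => by rw [pow_one] at hi; rwa [Set.Finite.mem_toFinset, Set.mem_ofPred_eq]
  rw [pow_one] at hw
  refine ⟨∑ i ∈ hfin.toFinset, restrictedC ϖ d (restrictedCoeff i f) * v i, fun j hj => ?_,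
    ∑ i ∈ hfin.toFinset, restrictedC ϖ d (restrictedCoeff i f) * q i,
    sum_mem fun i _ => J.mul_mem_left _ (hq i),
    w + ∑ i ∈ hfin.toFinset, restrictedC ϖ d (restrictedCoeff i f) * h i, ?_⟩
  · rw [map_sum]
    refine Finset.sum_eq_zero fun i _ => ?_
    rw [restrictedCoeff_C_mul, hv i j hj, mul_zero]
  · rw [mul_add, hw, Finset.mul_sum]
    have : ∑ i ∈ hfin.toFinset, restrictedC ϖ d (restrictedCoeff i f) * restrictedMonomial ϖ i =
        ∑ i ∈ hfin.toFinset, (restrictedC ϖ d (restrictedCoeff i f) * v i +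
          restrictedC ϖ d (restrictedCoeff i f) * q i + restrictedC ϖ d ϖ *
            (restrictedC ϖ d (restrictedCoeff i f) * h i)) :=
      Finset.sum_congr rfl fun i _ => by rw [e i]; ring
    rw [this, Finset.sum_add_distrib, Finset.sum_add_distrib]
    ring

/-- The images `T i` of the monomials under a bounded projection with kernel the closure of a
saturated ideal. -/
theorem exists_monomial_projection [IsAdicComplete (IsLocalRing.maximalIdeal S) S]
    (hϖ : Irreducible ϖ) (J : Ideal (restrictedSeries ϖ d))
    (hJ : ∀ f, restrictedC ϖ d ϖ * f ∈ J → f ∈ J) :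
    ∃ T : (Fin d →₀ ℕ) → restrictedSeries ϖ d,
      (∀ i n, ∃ q ∈ J, ∃ h,
        restrictedMonomial ϖ i - T i - q = restrictedC ϖ d (ϖ ^ n) * h) ∧
      ∀ g ∈ J, ∀ n, ∃ F : Finset (Fin d →₀ ℕ), ∀ G, F ⊆ G → ∃ h,
        ∑ i ∈ G, restrictedC ϖ d (restrictedCoeff i g) * T i = restrictedC ϖ d (ϖ ^ n) * h := by
  classical
  have hmem : ∀ n (x y : S), x ≡ y [SMOD (IsLocalRing.maximalIdeal S ^ n • ⊤ : Submodule S S)] ↔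
      ϖ ^ n ∣ x - y := fun n x y => by
    rw [SModEq.sub_mem, hϖ.maximalIdeal_eq, Ideal.span_singleton_pow, smul_eq_mul, Ideal.mul_top,
      Ideal.mem_span_singleton]
  have hH : ∀ x : S, (∀ n, ϖ ^ n ∣ x) → x = 0 := fun x hx =>
    IsHausdorff.haus (I := IsLocalRing.maximalIdeal S) inferInstance x fun n =>
      (hmem n x 0).mpr (by rw [sub_zero]; exact hx n)
  have hC : ∀ s : ℕ → S, (∀ n, ϖ ^ n ∣ s (n + 1) - s n) → ∃ L, ∀ n, ϖ ^ n ∣ L - s n := by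
    intro s hs
    obtain ⟨L, hL⟩ := IsPrecomplete.prec (I := IsLocalRing.maximalIdeal S) inferInstance (f := s)
      fun {m n} hmn => by
        rw [hmem]
        induction n, hmn using Nat.le_induction with
        | base => rw [sub_self]; exact dvd_zero _
        | succ n hmn ih =>
          rw [← sub_sub_sub_cancel_right _ _ (s n), ← neg_sub (s n) (s m), ← neg_sub (s m) (s n)]
          have h1 := (pow_dvd_pow ϖ hmn).trans (hs n)
          have h2 := dvd_sub ih h1
          convert h2 using 1
          ring
    exact ⟨L, fun n => by rw [← neg_sub, dvd_neg]; exact (hmem n _ _).mp (hL n)⟩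
  obtain ⟨s, hind, hspan⟩ := exists_monomial_basis hϖ J
  -- Here v is the projection of f: it is supported on s, and f - v lies in the ϖ-adic closure of J.
  let Rel : restrictedSeries ϖ d → restrictedSeries ϖ d → Prop := fun f v =>
    (∀ i ∉ s, restrictedCoeff i v = 0) ∧
      ∀ n, ∃ q ∈ J, ∃ h, f - v - q = restrictedC ϖ d (ϖ ^ n) * h
  have hzero : ∀ v, Rel 0 v → v = 0 := by
    have key : ∀ n v, Rel 0 v → ∀ i, ϖ ^ n ∣ restrictedCoeff i v := by
      intro n
      induction n with
      | zero => exact fun v _ i => by rw [pow_zero]; exact one_dvd _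
      | succ n ih =>
        rintro v ⟨hv, hv'⟩ i
        obtain ⟨q, hq, h, e⟩ := hv' 1
        rw [pow_one] at e
        have h1 := hind v hv (-q) (neg_mem hq) (-h) (by linear_combination -e)
        obtain ⟨w, hw⟩ := exists_pow_mul_eq (n := 1) hϖ.ne_zero
          (fun i => by rw [pow_one]; exact h1 i)
        rw [pow_one] at hw
        have hw0 : Rel 0 w := by
          refine ⟨fun j hj => ?_, fun m => ?_⟩
          · have h2 := hv j hj
            rw [← hw, restrictedCoeff_C_mul] at h2
            exact (mul_eq_zero.mp h2).resolve_left hϖ.ne_zero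
          · obtain ⟨q, hq, h, e⟩ := hv' (m + 1)
            -- Saturation of J lets the factor ϖ of v = ϖ w be cancelled, so that w is again a
            -- projection of 0.
            refine ⟨-w - restrictedC ϖ d (ϖ ^ m) * h, hJ _ ?_, h, by ring⟩
            rw [pow_succ', map_mul] at e
            convert hq using 1
            linear_combination e - hw
        rw [← hw, restrictedCoeff_C_mul, pow_succ']
        exact mul_dvd_mul_left _ (ih w hw0 i)
    exact fun v hv => restrictedSeries_ext fun i => by
      rw [map_zero]; exact hH _ fun n => key n v hv i
  have hsub : ∀ f f' v v', Rel f v → Rel f' v' → Rel (f - f') (v - v') := by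
    rintro f f' v v' ⟨hv, h1⟩ ⟨hv', h2⟩
    refine ⟨fun i hi => by rw [map_sub, hv i hi, hv' i hi, sub_self], fun n => ?_⟩
    obtain ⟨q, hq, h, e⟩ := h1 n
    obtain ⟨q', hq', h', e'⟩ := h2 n
    exact ⟨q - q', sub_mem hq hq', h - h', by linear_combination e - e'⟩
  have huniq : ∀ f v v', Rel f v → Rel f v' → v = v' := fun f v v' h h' =>
    sub_eq_zero.mp (hzero _ (by simpa using hsub f f v v' h h'))
  have hmul : ∀ a f v, Rel f v → Rel (restrictedC ϖ d a * f) (restrictedC ϖ d a * v) := by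
    rintro a f v ⟨hv, h1⟩
    refine ⟨fun i hi => by rw [restrictedCoeff_C_mul, hv i hi, mul_zero], fun n => ?_⟩
    obtain ⟨q, hq, h, e⟩ := h1 n
    exact ⟨restrictedC ϖ d a * q, J.mul_mem_left _ hq, restrictedC ϖ d a * h, by
      linear_combination restrictedC ϖ d a * e⟩
  have hrel0 : ∀ f ∈ J, Rel f 0 := fun f hf =>
    ⟨fun i _ => map_zero _, fun n => ⟨f, hf, 0, by ring⟩⟩
  have hsum : ∀ (G : Finset (Fin d →₀ ℕ)) (f v : (Fin d →₀ ℕ) → restrictedSeries ϖ d),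
      (∀ i, Rel (f i) (v i)) → Rel (∑ i ∈ G, f i) (∑ i ∈ G, v i) := by
    intro G f v h
    induction G using Finset.induction_on with
    | empty => simpa using hrel0 0 (zero_mem _)
    | insert i G hi ih =>
      rw [Finset.sum_insert hi, Finset.sum_insert hi]
      have h1 := hsub _ _ _ _ (h i) (hsub 0 _ 0 _ (hrel0 0 (zero_mem _)) ih)
      simpa using h1
  -- Spanning modulo ϖ is iterated on the remainders h^[n] f, and the resulting series in s
  -- converges by completeness.
  have hex : ∀ f, ∃ v, Rel f v := by
    choose v hv q hq h e using hspan
    intro f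
    let F : ℕ → restrictedSeries ϖ d := fun n => h^[n] f
    have hF : ∀ n, f - ∑ m ∈ Finset.range n, restrictedC ϖ d (ϖ ^ m) * v (F m) -
        ∑ m ∈ Finset.range n, restrictedC ϖ d (ϖ ^ m) * q (F m) =
          restrictedC ϖ d (ϖ ^ n) * F n := by
      intro n
      induction n with
      | zero => simp [F]
      | succ n ih =>
        have h1 : F (n + 1) = h (F n) := Function.iterate_succ_apply' h n f
        rw [Finset.sum_range_succ, Finset.sum_range_succ, h1, pow_succ, map_mul]
        linear_combination ih + restrictedC ϖ d (ϖ ^ n) * e (F n)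
    obtain ⟨L, hL, hL'⟩ := exists_adic_limit hH hC hϖ.ne_zero (fun n => v (F n)) fun n => hv (F n)
    refine ⟨L, hL, fun n => ?_⟩
    obtain ⟨g, hg⟩ := hL' n
    exact ⟨_, sum_mem fun m (_ : m ∈ Finset.range n) => J.mul_mem_left
      (restrictedC ϖ d (ϖ ^ m)) (hq (F m)), F n - g, by linear_combination hF n + hg⟩
  choose P hP using hex
  refine ⟨fun i => P (restrictedMonomial ϖ i), fun i => (hP _).2, fun g hg n => ?_⟩
  refine ⟨(finite_not_dvd_restrictedCoeff g n).toFinset, fun G hG => ?_⟩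
  obtain ⟨w, hw⟩ := exists_sub_sum_monomial (n := n) hϖ.ne_zero g (G := G)
    fun i hi => hG (by rwa [Set.Finite.mem_toFinset, Set.mem_ofPred_eq])
  refine ⟨-P w, ?_⟩
  have h1 := hsum G _ _ fun i => hmul (restrictedCoeff i g) _ _ (hP (restrictedMonomial ϖ i))
  -- ∑_{i ∈ G} g_i T^i = g - ϖ^n w, and g projects to 0; by uniqueness the sum of the g_i P(T^i) is
  -- -ϖ^n P(w).
  have h2 := hsub _ _ _ _ (hrel0 g hg) (hmul (ϖ ^ n) _ _ (hP w))
  rw [hw, sub_sub_cancel] at h2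
  rw [huniq _ _ _ h1 h2]
  ring

end DVR

/-- The element ϖ is a unit in the Tate algebra, so the integral kernel is saturated. -/
theorem mem_integralKer_of_mul {S : Type*} [CommRing S] {ϖ : S} {d : ℕ} {A : Type*} [CommRing A]
    (φ : TateAlgebra ϖ d →+* A) (f : restrictedSeries ϖ d)
    (h : restrictedC ϖ d ϖ * f ∈ integralKer φ) : f ∈ integralKer φ := by
  rw [integralKer, RingHom.mem_ker, map_mul] at h
  rw [integralKer, RingHom.mem_ker]
  have hu : IsUnit (algebraMap (restrictedSeries ϖ d) (TateAlgebra ϖ d) (restrictedC ϖ d ϖ)) :=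
    IsLocalization.Away.algebraMap_isUnit (S := TateAlgebra ϖ d)
      (⟨MvPowerSeries.C ϖ, C_mem_restrictedSeries ϖ d ϖ⟩ : restrictedSeries ϖ d)
  exact (hu.map φ).mul_right_eq_zero.mp h

end DeformedRobba

end

noncomputable section

set_option linter.unusedSectionVars false

namespace DeformedRobba

/-! ### Approximate projections -/

/-- P n b is an element of b + J close to U_G b for all large G. The contractions U_G are additive
and nearly kill each j, so P n b - P m b' is controlled by U_G (b - b' - j). -/
theorem exists_isApproxProjection {B ι : Type*} [CommRing B] {N : ℝ → B → ℝ}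
    (hN : IsGaussFamily N) {J : Ideal B} (U : Finset ι → B →+ B)
    (hU : ∀ {t}, 0 < t → ∀ G b, N t (U G b) ≤ N t b)
    (hJ : ∀ j ∈ J, ∀ t, 0 < t → ∀ δ, 0 < δ → ∃ F, ∀ G, F ⊆ G → N t (U G j) ≤ δ)
    (hP : ∀ (n : ℕ) (b : B), ∃ b', b - b' ∈ J ∧
      ∃ F, ∀ G, F ⊆ G → ∀ t : ℝ, 0 < t → t ≤ n → N t (b' - U G b) ≤ 1 / ((n : ℝ) + 1)) :
    ∃ P, IsApproxProjection N J P := by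
  classical
  have hP' : ∀ (n : ℕ) (b : B), ∃ b', (b = 0 → b' = 0) ∧ b - b' ∈ J ∧
      ∃ F, ∀ G, F ⊆ G → ∀ t : ℝ, 0 < t → t ≤ n → N t (b' - U G b) ≤ 1 / ((n : ℝ) + 1) := by
    intro n b
    by_cases hb : b = 0
    · refine ⟨0, fun _ => rfl, by rw [hb, sub_zero]; exact zero_mem _, ∅, fun G _ t ht _ => ?_⟩
      rw [hb, map_zero, sub_zero, hN.map_zero ht]
      positivity
    · obtain ⟨b', h⟩ := hP n b
      exact ⟨b', fun h' => absurd h' hb, h⟩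
  choose P h0 hmem F hF using hP'
  refine ⟨P, fun n => h0 n 0 rfl, hmem, fun t n m ht hn hm b b' j hj => ?_⟩
  obtain ⟨E, hE⟩ := hJ j hj t ht (1 / ((n : ℝ) + 1)) (by positivity)
  let G := F n b ∪ F m b' ∪ E
  have e : P n b - P m b' = ((P n b - U G b) - (P m b' - U G b')) +
      (U G (b - b' - j) + U G j) := by
    rw [map_sub, map_sub]; ring
  have h1 := hF n b G (Finset.subset_union_left.trans Finset.subset_union_left) t ht hn
  have h2 := hF m b' G (Finset.subset_union_right.trans Finset.subset_union_left) t ht hm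
  have h3 := hE G Finset.subset_union_right
  rw [e]
  refine (hN.add_le ht _ _).trans (max_le ((hN.sub_le ht _ _).trans ?_)
    ((hN.add_le ht _ _).trans (max_le ?_ ?_)))
  · exact (max_le_max h1 h2).trans (le_max_left _ _)
  · exact (hU ht G _).trans (le_max_right _ _)
  · exact h3.trans ((le_max_left _ _).trans (le_max_left _ _))

/-- Power series with all coefficients divisible by `a`. -/
def dvdSeries {W : Type*} [CommRing W] (a : W) (d : ℕ) : Ideal (MvPowerSeries (Fin d) W) where
  carrier := {f | ∀ i, a ∣ MvPowerSeries.coeff i f}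
  zero_mem' i := by simp
  add_mem' {f g} hf hg i := by rw [map_add]; exact dvd_add (hf i) (hg i)
  smul_mem' f g hg i := by
    classical
    rw [smul_eq_mul, MvPowerSeries.coeff_mul]
    exact Finset.dvd_sum fun ab _ => (hg ab.2).mul_left _

theorem C_mem_dvdSeries {W : Type*} [CommRing W] {a w : W} {d : ℕ} (h : a ∣ w) :
    (MvPowerSeries.C w : MvPowerSeries (Fin d) W) ∈ dvdSeries a d := fun i => by
  classical
  rw [MvPowerSeries.coeff_C]
  split_ifs
  · exact h
  · exact dvd_zero _

/-! ### Substituting elements for monomials -/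

section GenRing

variable {p : ℕ} [Fact p.Prime] {k : Type*} [CommRing k] {O : Type*} [CommRing O]
  [Algebra (WittVector p k) O] {π : O} {R : Type*} [NormedCommRing R] [Algebra k R]
  {Rp : Subalgebra k R} {d : ℕ}

/-- The constant coefficient series `f ↦ f_i` on `genRing`. -/
def genCoeff (i : Fin d →₀ ℕ) : genRing p π Rp d →+ genRing p π Rp d where
  toFun f := ⟨MvPowerSeries.C (MvPowerSeries.coeff i f.1), C_coeff_mem_genRing f.2 i⟩
  map_zero' := Subtype.ext (by
    change MvPowerSeries.C (MvPowerSeries.coeff i 0) = 0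
    rw [map_zero, map_zero])
  map_add' f g := Subtype.ext (by
    change MvPowerSeries.C (MvPowerSeries.coeff i (f.1 + g.1)) = _
    rw [map_add, map_add]
    rfl)

/-- The monomials in `genRing`. -/
def genMonomial (i : Fin d →₀ ℕ) : genRing p π Rp d :=
  ⟨MvPowerSeries.monomial i 1, X_pow_mem_genRing i⟩

/-- The map `f ↦ ∑_{i ∈ G} f_i Y_i`, which replaces monomials by the elements `Y_i`. -/
def genSubst (Y : (Fin d →₀ ℕ) → genRing p π Rp d) (G : Finset (Fin d →₀ ℕ)) :
    genRing p π Rp d →+ genRing p π Rp d :=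
  ∑ i ∈ G, (AddMonoidHom.mulRight (Y i)).comp (genCoeff i)

theorem genSubst_apply (Y : (Fin d →₀ ℕ) → genRing p π Rp d) (G : Finset (Fin d →₀ ℕ))
    (f : genRing p π Rp d) : genSubst Y G f = ∑ i ∈ G, genCoeff i f * Y i := by
  rw [genSubst, AddMonoidHom.finsetSum_apply]
  rfl

theorem genCoeff_C_mul {w : GenWitt p k π R} (hw : MvPowerSeries.C w ∈ genRing p π Rp d)
    (i : Fin d →₀ ℕ) (f : genRing p π Rp d) :
    genCoeff i (⟨MvPowerSeries.C w, hw⟩ * f) = ⟨MvPowerSeries.C w, hw⟩ * genCoeff i f :=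
  Subtype.ext (by
    change MvPowerSeries.C (MvPowerSeries.coeff i (MvPowerSeries.C w * f.1)) =
      MvPowerSeries.C w * MvPowerSeries.C (MvPowerSeries.coeff i f.1)
    rw [MvPowerSeries.coeff_C_mul, map_mul])

theorem genSubst_C_mul (Y : (Fin d →₀ ℕ) → genRing p π Rp d) (G : Finset (Fin d →₀ ℕ))
    {w : GenWitt p k π R} (hw : MvPowerSeries.C w ∈ genRing p π Rp d) (f : genRing p π Rp d) :
    genSubst Y G (⟨MvPowerSeries.C w, hw⟩ * f) = ⟨MvPowerSeries.C w, hw⟩ * genSubst Y G f := by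
  rw [genSubst_apply, genSubst_apply, Finset.mul_sum]
  exact Finset.sum_congr rfl fun i _ => by rw [genCoeff_C_mul, mul_assoc]

theorem coe_genSubst_monomial (G : Finset (Fin d →₀ ℕ)) (f : genRing p π Rp d)
    [DecidableEq (Fin d →₀ ℕ)] (i : Fin d →₀ ℕ) :
    MvPowerSeries.coeff i (genSubst genMonomial G f).1 =
      if i ∈ G then MvPowerSeries.coeff i f.1 else 0 := by
  have e : (genSubst genMonomial G f).1 = ∑ j ∈ G, MvPowerSeries.C (MvPowerSeries.coeff j f.1) *
      MvPowerSeries.monomial j 1 := by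
    rw [genSubst_apply, AddSubmonoidClass.coe_finsetSum]
    rfl
  rw [e, map_sum]
  have e' : ∀ j, MvPowerSeries.coeff i (MvPowerSeries.C (MvPowerSeries.coeff j f.1) *
      MvPowerSeries.monomial j (1 : GenWitt p k π R)) =
        if i = j then MvPowerSeries.coeff j f.1 else 0 := fun j => by
    rw [MvPowerSeries.coeff_C_mul, MvPowerSeries.coeff_monomial, mul_ite, mul_one, mul_zero]
    congr
  simp only [e']
  exact Finset.sum_ite_eq G i _

theorem IsRep.eq {b b' : GenRingInv p π Rp d} {n : ℕ} {f : genRing p π Rp d} (h : IsRep b n f)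
    (h' : IsRep b' n f) : b = b' := by
  have hu : IsUnit (algebraMap (genRing p π Rp d) (GenRingInv p π Rp d) (genRingPi p π Rp d) ^ n) :=
    (IsLocalization.Away.algebraMap_isUnit _).pow n
  exact hu.mul_left_injective (h.trans h'.symm)

theorem IsRep.add {b b' : GenRingInv p π Rp d} {n : ℕ} {f g : genRing p π Rp d} (h : IsRep b n f)
    (h' : IsRep b' n g) : IsRep (b + b') n (f + g) := by
  rw [IsRep, add_mul, h, h', map_add]

theorem isRep_mul_invSelf (n : ℕ) (f : genRing p π Rp d) :
    IsRep (algebraMap _ _ f * IsLocalization.Away.invSelf (genRingPi p π Rp d) ^ n) n f := by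
  rw [IsRep, mul_assoc, ← mul_pow, mul_comm (IsLocalization.Away.invSelf _),
    IsLocalization.Away.mul_invSelf, one_pow, mul_one]

/-- Commutation with π makes the numerator-wise definition independent of the representation;
additivity follows over a common denominator. -/
theorem exists_localized_addMonoidHom
    (hτ : IsTeichmuller (GenWitt.base p k π R π) (GenWitt.teich p k π R))
    (u : genRing p π Rp d →+ genRing p π Rp d)
    (hu : ∀ f, u (genRingPi p π Rp d * f) = genRingPi p π Rp d * u f) :
    ∃ U : GenRingInv p π Rp d →+ GenRingInv p π Rp d, ∀ b n f, IsRep b n f →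
      IsRep (U b) n (u f) := by
  have hpow : ∀ n f, u (genRingPi p π Rp d ^ n * f) = genRingPi p π Rp d ^ n * u f := by
    intro n
    induction n with
    | zero => intro f; rw [pow_zero, one_mul, one_mul]
    | succ n ih => intro f; rw [pow_succ, mul_assoc, ih, hu, mul_assoc]
  choose n f hf using exists_isRep (p := p) (π := π) (Rp := Rp) (d := d)
  let U : GenRingInv p π Rp d → GenRingInv p π Rp d := fun b =>
    algebraMap _ _ (u (f b)) * IsLocalization.Away.invSelf (genRingPi p π Rp d) ^ n b
  have hU : ∀ b m g, IsRep b m g → IsRep (U b) m (u g) := by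
    intro b m g hg
    have e : genRingPi p π Rp d ^ m * f b = genRingPi p π Rp d ^ n b * g := by
      refine algebraMap_genRing_injective hτ ?_
      rw [← (hf b).pow_mul m, add_comm, hg.pow_mul (n b)]
    have h1 : IsRep (U b) (n b + m) (genRingPi p π Rp d ^ m * u (f b)) :=
      (isRep_mul_invSelf (n b) (u (f b))).pow_mul m
    rw [← hpow, e, hpow, add_comm] at h1
    have h2 := (isRep_mul_invSelf m (u g)).pow_mul (n b)
    rw [h1.eq h2]
    exact isRep_mul_invSelf m (u g)
  refine ⟨AddMonoidHom.mk' U fun b b' => ?_, hU⟩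
  obtain ⟨m, g, g', hg, hg'⟩ := exists_isRep_pair b b'
  have h1 := hU _ _ _ (hg.add hg')
  rw [map_add] at h1
  exact h1.eq ((hU _ _ _ hg).add (hU _ _ _ hg'))

/-! ### Base change from the Tate algebra -/

section BaseChange

variable {O₀ : Type*} [CommRing O₀] [Algebra O₀ O] {ϖ : O₀} (hdvd : π ∣ algebraMap O₀ O ϖ)

theorem map_mem_restrictedSeries_plus (hdvd : π ∣ algebraMap O₀ O ϖ) (g : restrictedSeries ϖ d) :
    MvPowerSeries.map ((GenWitt.base p k π R).comp (algebraMap O₀ O)) g.1 ∈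
        restrictedSeries (GenWitt.base p k π R π) d ∧
      ∀ i, MvPowerSeries.coeff i (MvPowerSeries.map ((GenWitt.base p k π R).comp
        (algebraMap O₀ O)) g.1) ∈ GenWitt.plus p π Rp := by
  refine ⟨fun n => (g.2 n).subset fun i hi h => hi ?_, fun i => ?_⟩
  · rw [Ideal.mem_span_singleton] at h ⊢
    rw [MvPowerSeries.coeff_map, RingHom.comp_apply, ← map_pow]
    refine map_dvd _ ((pow_dvd_pow_of_dvd hdvd n).trans ?_)
    rw [← map_pow]
    exact map_dvd _ h
  · rw [MvPowerSeries.coeff_map, RingHom.comp_apply]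
    exact ⟨GenWitt.base p k π Rp _, GenWitt.map_base p k π Rp.val _⟩

variable (p k R Rp d) in
/-- The map `O₀⟨T₁, …, T_d⟩ → W_π(R⁺)⟨T₁, …, T_d⟩`, with values in `genRing`. -/
def baseChange : restrictedSeries ϖ d →+* genRing p π Rp d :=
  ((MvPowerSeries.map ((GenWitt.base p k π R).comp (algebraMap O₀ O))).comp
    (restrictedSeries ϖ d).subtype).codRestrict (genRing p π Rp d) fun g =>
      Subring.subset_closure (Or.inl (map_mem_restrictedSeries_plus hdvd g))

theorem coe_baseChange (g : restrictedSeries ϖ d) : (baseChange p k R Rp d hdvd g).1 =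
    MvPowerSeries.map ((GenWitt.base p k π R).comp (algebraMap O₀ O)) g.1 := rfl

theorem coeff_baseChange (g : restrictedSeries ϖ d) (i : Fin d →₀ ℕ) :
    MvPowerSeries.coeff i (baseChange p k R Rp d hdvd g).1 =
      GenWitt.base p k π R (algebraMap O₀ O (restrictedCoeff i g)) := by
  rw [coe_baseChange, MvPowerSeries.coeff_map]
  rfl

theorem genCoeff_baseChange (g : restrictedSeries ϖ d) (i : Fin d →₀ ℕ) :
    genCoeff i (baseChange p k R Rp d hdvd g) =
      baseChange p k R Rp d hdvd (restrictedC ϖ d (restrictedCoeff i g)) :=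
  Subtype.ext (by
    change MvPowerSeries.C (MvPowerSeries.coeff i (baseChange p k R Rp d hdvd g).1) = _
    rw [coeff_baseChange, coe_baseChange]
    exact (MvPowerSeries.map_C (σ := Fin d) ((GenWitt.base p k π R).comp (algebraMap O₀ O))
      (restrictedCoeff i g)).symm)

theorem baseChange_monomial (i : Fin d →₀ ℕ) :
    baseChange p k R Rp d hdvd (restrictedMonomial ϖ i) = genMonomial i :=
  Subtype.ext (by
    rw [coe_baseChange]
    exact (MvPowerSeries.map_monomial _ i 1).trans (by rw [map_one]; rfl))

theorem baseChange_pow_mul_mem (n : ℕ) (h : restrictedSeries ϖ d) :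
    (baseChange p k R Rp d hdvd (restrictedC ϖ d (ϖ ^ n) * h)).1 ∈
      dvdSeries (GenWitt.base p k π R π ^ n) d := fun i => by
  rw [coeff_baseChange, restrictedCoeff_C_mul, ← map_pow]
  refine map_dvd _ ((pow_dvd_pow_of_dvd hdvd n).trans ?_)
  rw [← map_pow]
  exact map_dvd _ (dvd_mul_right _ _)

end BaseChange

end GenRing

end DeformedRobba

end

noncomputable section

set_option linter.unusedSectionVars false

namespace DeformedRobba

/-! ### The approximate projections for the Gauss norms -/

section GaussProjection

variable {p : ℕ} [Fact p.Prime] {k : Type*} [CommRing k] {O : Type*} [CommRing O]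
  [Algebra (WittVector p k) O] {π : O} {R : Type*} [NormedCommRing R] [Algebra k R]
  {Rp : Subalgebra k R} {d : ℕ} [IsUltrametricDist R] [CharP R p]

/-- Bounded series divisible by a high power of `π` are small. -/
theorem exists_dvdSeries_inf_le
    (hτ : IsTeichmuller (GenWitt.base p k π R π) (GenWitt.teich p k π R))
    {C : ℝ} (hC : 0 ≤ C) (T : ℝ) (n : ℕ) {δ : ℝ} (hδ : 0 < δ) :
    ∃ N : ℕ, ∀ f : MvPowerSeries (Fin d) (GenWitt p k π R),
      f ∈ dvdSeries (GenWitt.base p k π R π ^ N) d →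
      f ∈ boundedSeries (GenWitt.base p k π R π) (GenWitt.teich p k π R) d (fun _ => C) →
      ∀ t : ℝ, 0 < t → t ≤ T → f ∈ boundedSeries (GenWitt.base p k π R π) (GenWitt.teich p k π R) d
        (gaussBound p t δ n) := by
  have hp : (1 : ℝ) < p := Nat.one_lt_cast.mpr (Fact.out : p.Prime).one_lt
  have hp0 : (0 : ℝ) < p := natCast_pos_of_prime
  -- Terms of index j ≥ N contribute at most p^(n-N) max(1, C)^T; replacing C by max(1, C) makes
  -- this uniform in t ≤ T.
  obtain ⟨N, hN⟩ := pow_unbounded_of_one_lt ((p : ℝ) ^ n * max 1 C ^ T / δ) hp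
  rw [div_lt_iff₀ hδ] at hN
  refine ⟨N, fun f hf hfC t ht htT i => ?_⟩
  rw [hτ.mem_bounded_iff p (gaussBound_monotone ht hδ.le) (gaussBound_nonneg hδ.le)]
  intro j
  rcases lt_or_ge j N with hj | hj
  · rw [teichCoeff_eq_zero_of_dvd hτ (hf i) hj, specNorm_zero]
    exact gaussBound_nonneg hδ.le j
  · rw [le_gaussBound_iff ht hδ.le (specNorm_nonneg _)]
    have h1 : specNorm (teichCoeff (GenWitt.base p k π R π) (GenWitt.teich p k π R)
        (MvPowerSeries.coeff i f) j) ≤ max 1 C :=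
      ((hτ.mem_bounded_iff p monotone_const (fun _ => hC)).mp (hfC i) j).trans (le_max_right _ _)
    have h2 := (Real.rpow_le_rpow (specNorm_nonneg _) h1 ht.le).trans
      (Real.rpow_le_rpow_of_exponent_le (le_max_left 1 C) htT)
    have h3 : (p : ℝ) ^ ((n : ℤ) - j) ≤ (p : ℝ) ^ ((n : ℤ) - N) :=
      zpow_le_zpow_right₀ hp.le (by omega)
    refine (mul_le_mul h3 h2 (Real.rpow_nonneg (specNorm_nonneg _) _)
      (zpow_pos hp0 _).le).trans ?_
    rw [zpow_sub₀ hp0.ne', zpow_natCast, zpow_natCast, div_mul_eq_mul_div,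
      div_le_iff₀ (pow_pos hp0 N), mul_comm δ]
    exact hN.le

theorem genSubst_mem_boundedSeries
    (hτ : IsTeichmuller (GenWitt.base p k π R π) (GenWitt.teich p k π R))
    {r : ℕ → ℝ} (hr : Monotone r) {Y : (Fin d →₀ ℕ) → genRing p π Rp d}
    (hY : ∀ i, (Y i).1 ∈ boundedSeries (GenWitt.base p k π R π) (GenWitt.teich p k π R) d
      (fun _ => 1)) (G : Finset (Fin d →₀ ℕ)) {f : genRing p π Rp d}
    (hf : f.1 ∈ boundedSeries (GenWitt.base p k π R π) (GenWitt.teich p k π R) d r) :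
    (genSubst Y G f).1 ∈ boundedSeries (GenWitt.base p k π R π) (GenWitt.teich p k π R) d r := by
  rw [genSubst_apply, AddSubmonoidClass.coe_finsetSum]
  refine sum_mem fun i _ => mul_mem_boundedSeries hτ (r := r) (r' := fun _ => 1)
    (fun a b _ _ => ?_) (C_mem_boundedSeries (hf i)) (hY i)
  rw [mul_one]
  exact hr (Nat.le_add_right a b)

theorem genSubst_mem_dvdSeries {a : GenWitt p k π R} (Y : (Fin d →₀ ℕ) → genRing p π Rp d)
    {G : Finset (Fin d →₀ ℕ)} {f : genRing p π Rp d}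
    (hf : ∀ i ∈ G, a ∣ MvPowerSeries.coeff i f.1) : (genSubst Y G f).1 ∈ dvdSeries a d := by
  rw [genSubst_apply, AddSubmonoidClass.coe_finsetSum]
  exact sum_mem fun i hi => Ideal.mul_mem_right _ _ (C_mem_dvdSeries (hf i hi))

variable {O₀ : Type*} [CommRing O₀] [Algebra O₀ O] {ϖ : O₀}

theorem baseChange_mem_boundedSeries
    (hplus : ∀ w ∈ GenWitt.plus p π Rp,
      w ∈ bounded (GenWitt.base p k π R π) (GenWitt.teich p k π R) (fun _ => 1))
    (hdvd : π ∣ algebraMap O₀ O ϖ) (g : restrictedSeries ϖ d) :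
    (baseChange p k R Rp d hdvd g).1 ∈ boundedSeries (GenWitt.base p k π R π)
      (GenWitt.teich p k π R) d (fun _ => 1) := fun i =>
  hplus _ ((map_mem_restrictedSeries_plus hdvd g).2 i)

theorem dvdSeries_sub_genSubst_monomial {n : ℕ} {f : genRing p π Rp d} {G : Finset (Fin d →₀ ℕ)}
    (hG : ∀ i, ¬ GenWitt.base p k π R π ^ n ∣ MvPowerSeries.coeff i f.1 → i ∈ G) :
    (f - genSubst genMonomial G f).1 ∈ dvdSeries (GenWitt.base p k π R π ^ n) d := fun i => by
  classical
  change _ ∣ MvPowerSeries.coeff i (f.1 - (genSubst genMonomial G f).1)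
  rw [map_sub, coe_genSubst_monomial]
  split_ifs with h
  · rw [sub_self]; exact dvd_zero _
  · rw [sub_zero]
    by_contra h'
    exact h (hG i h')

theorem exists_finset_not_dvd (f : genRing p π Rp d) (n : ℕ) :
    ∃ G : Finset (Fin d →₀ ℕ), ∀ i, ¬ GenWitt.base p k π R π ^ n ∣ MvPowerSeries.coeff i f.1 ↔
      i ∈ G := by
  have h := genRing_le_restrictedSeries f.2 n
  refine ⟨h.toFinset, fun i => ?_⟩
  rw [Set.Finite.mem_toFinset, Set.mem_ofPred_eq, Ideal.mem_span_singleton]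

theorem genMonomial_mem_boundedSeries
    (hplus : ∀ w ∈ GenWitt.plus p π Rp,
      w ∈ bounded (GenWitt.base p k π R π) (GenWitt.teich p k π R) (fun _ => 1)) :
    (∀ i : Fin d →₀ ℕ, (genMonomial i : genRing p π Rp d).1 ∈ boundedSeries
      (GenWitt.base p k π R π) (GenWitt.teich p k π R) d (fun _ => 1)) := fun i j => by
  classical
  change MvPowerSeries.coeff j (MvPowerSeries.monomial i 1) ∈ _
  rw [MvPowerSeries.coeff_monomial]
  split_ifs
  · exact hplus _ (one_mem _)
  · exact zero_mem _

theorem genSubst_genCoeff_mul (Y : (Fin d →₀ ℕ) → genRing p π Rp d) (G : Finset (Fin d →₀ ℕ))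
    (i : Fin d →₀ ℕ) (f g : genRing p π Rp d) :
    genSubst Y G (genCoeff i f * g) = genCoeff i f * genSubst Y G g :=
  genSubst_C_mul Y G (C_coeff_mem_genRing f.2 i) g

theorem genSubst_baseChange (hdvd : π ∣ algebraMap O₀ O ϖ)
    (T : (Fin d →₀ ℕ) → restrictedSeries ϖ d) (G : Finset (Fin d →₀ ℕ))
    (g : restrictedSeries ϖ d) :
    genSubst (fun i => baseChange p k R Rp d hdvd (T i)) G (baseChange p k R Rp d hdvd g) =
      baseChange p k R Rp d hdvd
        (∑ i ∈ G, restrictedC ϖ d (restrictedCoeff i g) * T i) := by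
  rw [genSubst_apply, map_sum]
  exact Finset.sum_congr rfl fun i _ => by rw [genCoeff_baseChange, map_mul]

/-- Elements of the extended ideal become small after substitution. -/
theorem exists_genSubst_mul_mem
    (hτ : IsTeichmuller (GenWitt.base p k π R π) (GenWitt.teich p k π R))
    (hplus : ∀ w ∈ GenWitt.plus p π Rp,
      w ∈ bounded (GenWitt.base p k π R π) (GenWitt.teich p k π R) (fun _ => 1))
    (hdvd : π ∣ algebraMap O₀ O ϖ) {J : Ideal (restrictedSeries ϖ d)}
    {T : (Fin d →₀ ℕ) → restrictedSeries ϖ d}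
    (hT : ∀ g ∈ J, ∀ n, ∃ F : Finset (Fin d →₀ ℕ), ∀ G, F ⊆ G → ∃ h,
      ∑ i ∈ G, restrictedC ϖ d (restrictedCoeff i g) * T i = restrictedC ϖ d (ϖ ^ n) * h)
    {g : restrictedSeries ϖ d} (hg : g ∈ J) (f : genRing p π Rp d) (n : ℕ) {t δ : ℝ} (ht : 0 < t)
    (hδ : 0 < δ) :
    ∃ F : Finset (Fin d →₀ ℕ), ∀ G, F ⊆ G →
      (genSubst (fun i => baseChange p k R Rp d hdvd (T i)) G
        (f * baseChange p k R Rp d hdvd g)).1 ∈ boundedSeries (GenWitt.base p k π R π)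
          (GenWitt.teich p k π R) d (gaussBound p t δ n) := by
  classical
  obtain ⟨C, hC, hfC⟩ := exists_mem_boundedSeries hτ hplus f.2
  obtain ⟨N, hN⟩ := exists_dvdSeries_inf_le (d := d) hτ hC t n hδ
  obtain ⟨H, hH⟩ := exists_finset_not_dvd f N
  have hb1 := baseChange_mem_boundedSeries (d := d) hplus hdvd
  have hmono := gaussBound_monotone (p := p) (n := n) ht hδ.le
  choose F hF using fun i => hT _ (J.mul_mem_left (restrictedMonomial ϖ i) hg) N
  refine ⟨H.biUnion F, fun G hG => ?_⟩
  -- Substitution commutes with constants but not with monomials. So f is cut into a part divisible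
  -- by π^N, small in any case, and finitely many f_i T^i, where the monomial is absorbed by T^i g ∈
  -- J.
  have e : f * baseChange p k R Rp d hdvd g =
      (f - genSubst genMonomial H f) * baseChange p k R Rp d hdvd g +
        ∑ i ∈ H, genCoeff i f * baseChange p k R Rp d hdvd (restrictedMonomial ϖ i * g) := by
    rw [sub_mul, genSubst_apply, Finset.sum_mul]
    simp only [map_mul, baseChange_monomial, mul_assoc]
    ring
  rw [e, map_add, map_sum]
  refine add_mem (genSubst_mem_boundedSeries hτ hmono (fun i => hb1 (T i)) G
    (mul_mem_boundedSeries hτ (r := gaussBound p t δ n) (r' := fun _ => 1) (fun a b _ _ => ?_)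
      (hN _ (dvdSeries_sub_genSubst_monomial fun i hi => (hH i).mp hi) ?_ t ht le_rfl) (hb1 g))) ?_
  · rw [mul_one]
    exact hmono (Nat.le_add_right a b)
  · exact sub_mem hfC (genSubst_mem_boundedSeries hτ monotone_const
      (genMonomial_mem_boundedSeries hplus) H hfC)
  · rw [AddSubmonoidClass.coe_finsetSum]
    refine sum_mem fun i hi => ?_
    obtain ⟨h, hh⟩ := hF i G ((Finset.subset_biUnion_of_mem F hi).trans hG)
    have e' : genSubst (fun i => baseChange p k R Rp d hdvd (T i)) G (genCoeff i f *
        baseChange p k R Rp d hdvd (restrictedMonomial ϖ i * g)) =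
        genCoeff i f * baseChange p k R Rp d hdvd (restrictedC ϖ d (ϖ ^ N) * h) := by
      rw [genSubst_genCoeff_mul, genSubst_baseChange, hh]
    rw [e']
    refine hN _ (Ideal.mul_mem_left _ _ (baseChange_pow_mul_mem hdvd N h)) ?_ t ht le_rfl
    exact mul_mem_boundedSeries hτ (r := fun _ => C) (r' := fun _ => 1)
      (fun _ _ _ _ => (mul_one C).le) (C_mem_boundedSeries (hfC i)) (hb1 _)

/-- Write T^i = T_i + q_i + ϖ^N h_i with q_i ∈ J, and take q = ∑ f_i q_i over the finitely many i
with f_i not divisible by π^N. Enlarging G adds only terms divisible by π^N. -/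
theorem exists_approx_genSubst
    (hτ : IsTeichmuller (GenWitt.base p k π R π) (GenWitt.teich p k π R))
    (hplus : ∀ w ∈ GenWitt.plus p π Rp,
      w ∈ bounded (GenWitt.base p k π R π) (GenWitt.teich p k π R) (fun _ => 1))
    (hdvd : π ∣ algebraMap O₀ O ϖ) {J : Ideal (restrictedSeries ϖ d)}
    {T : (Fin d →₀ ℕ) → restrictedSeries ϖ d}
    (hT : ∀ i n, ∃ q ∈ J, ∃ h,
      restrictedMonomial ϖ i - T i - q = restrictedC ϖ d (ϖ ^ n) * h)
    (f : genRing p π Rp d) (m : ℕ) (t₀ : ℝ) {δ : ℝ} (hδ : 0 < δ) :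
    ∃ q ∈ J.map (baseChange p k R Rp d hdvd), ∃ F : Finset (Fin d →₀ ℕ), ∀ G, F ⊆ G →
      ∀ t, 0 < t → t ≤ t₀ →
        (f - q - genSubst (fun i => baseChange p k R Rp d hdvd (T i)) G f).1 ∈
          boundedSeries (GenWitt.base p k π R π) (GenWitt.teich p k π R) d
            (gaussBound p t δ m) := by
  classical
  obtain ⟨C, hC, hfC⟩ := exists_mem_boundedSeries hτ hplus f.2
  obtain ⟨N, hN⟩ := exists_dvdSeries_inf_le (d := d) hτ hC t₀ m hδ
  obtain ⟨H, hH⟩ := exists_finset_not_dvd f N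
  have hb1 := baseChange_mem_boundedSeries (d := d) hplus hdvd
  choose q hq h e using fun i => hT i N
  have e' : ∀ G, H ⊆ G → f - genSubst (fun i => baseChange p k R Rp d hdvd (q i)) H f -
      genSubst (fun i => baseChange p k R Rp d hdvd (T i)) G f =
        (f - genSubst genMonomial H f) +
          genSubst (fun i => baseChange p k R Rp d hdvd (restrictedC ϖ d (ϖ ^ N) * h i)) H f -
          genSubst (fun i => baseChange p k R Rp d hdvd (T i)) (G \ H) f := by
    intro G hG
    have h1 : genSubst genMonomial H f =
        genSubst (fun i => baseChange p k R Rp d hdvd (T i)) H f +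
          genSubst (fun i => baseChange p k R Rp d hdvd (q i)) H f +
          genSubst (fun i => baseChange p k R Rp d hdvd (restrictedC ϖ d (ϖ ^ N) * h i)) H f := by
      simp only [genSubst_apply, ← Finset.sum_add_distrib]
      refine Finset.sum_congr rfl fun i _ => ?_
      rw [← baseChange_monomial hdvd, ← e i, map_sub, map_sub]
      ring
    have h2 : genSubst (fun i => baseChange p k R Rp d hdvd (T i)) G f =
        genSubst (fun i => baseChange p k R Rp d hdvd (T i)) (G \ H) f +
          genSubst (fun i => baseChange p k R Rp d hdvd (T i)) H f := by
      simp only [genSubst_apply]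
      exact (Finset.sum_sdiff hG).symm
    rw [h1, h2]
    ring
  refine ⟨genSubst (fun i => baseChange p k R Rp d hdvd (q i)) H f, ?_, H,
    fun G hG t ht htt => hN _ ?_ ?_ t ht htt⟩
  · rw [genSubst_apply]
    exact sum_mem fun i _ => Ideal.mul_mem_left _ _ (Ideal.mem_map_of_mem _ (hq i))
  · rw [e' G hG]
    refine sub_mem (add_mem (dvdSeries_sub_genSubst_monomial fun i hi => (hH i).mp hi) ?_)
      (genSubst_mem_dvdSeries _ fun i hi => ?_)
    · rw [genSubst_apply, AddSubmonoidClass.coe_finsetSum]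
      exact sum_mem fun i _ => Ideal.mul_mem_left _ _ (baseChange_pow_mul_mem hdvd N (h i))
    · by_contra h'
      exact (Finset.mem_sdiff.mp hi).2 ((hH i).mp h')
  · rw [e' G hG]
    exact sub_mem (add_mem (sub_mem hfC (genSubst_mem_boundedSeries hτ monotone_const
      (genMonomial_mem_boundedSeries hplus) H hfC)) (genSubst_mem_boundedSeries hτ monotone_const
        (fun i => hb1 _) H hfC)) (genSubst_mem_boundedSeries hτ monotone_const
        (fun i => hb1 _) _ hfC)

theorem extendedIdeal_eq_map (hdvd : π ∣ algebraMap O₀ O ϖ) (J : Ideal (restrictedSeries ϖ d)) :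
    extendedIdeal p π Rp J = (J.map (baseChange p k R Rp d hdvd)).map
      (algebraMap (genRing p π Rp d) (GenRingInv p π Rp d)) := by
  rw [extendedIdeal, Ideal.map_map, Ideal.map]
  congr 1
  ext b
  constructor
  · rintro ⟨g, hg, f, hf, rfl⟩
    obtain rfl : f = baseChange p k R Rp d hdvd g := Subtype.ext hf
    exact ⟨g, hg, rfl⟩
  · rintro ⟨g, hg, rfl⟩
    exact ⟨g, hg, baseChange p k R Rp d hdvd g, rfl, rfl⟩

theorem exists_isApproxProjection_gaussNorm
    (hτ : IsTeichmuller (GenWitt.base p k π R π) (GenWitt.teich p k π R))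
    (hplus : ∀ w ∈ GenWitt.plus p π Rp,
      w ∈ bounded (GenWitt.base p k π R π) (GenWitt.teich p k π R) (fun _ => 1))
    (hdvd : π ∣ algebraMap O₀ O ϖ) {J : Ideal (restrictedSeries ϖ d)}
    {T : (Fin d →₀ ℕ) → restrictedSeries ϖ d}
    (hT : ∀ i n, ∃ q ∈ J, ∃ h,
      restrictedMonomial ϖ i - T i - q = restrictedC ϖ d (ϖ ^ n) * h)
    (hT' : ∀ g ∈ J, ∀ n, ∃ F : Finset (Fin d →₀ ℕ), ∀ G, F ⊆ G → ∃ h,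
      ∑ i ∈ G, restrictedC ϖ d (restrictedCoeff i g) * T i = restrictedC ϖ d (ϖ ^ n) * h) :
    ∃ P, IsApproxProjection (gaussNorm p π) (extendedIdeal p π Rp J) P := by
  have hN := isGaussFamily_gaussNorm (Rp := Rp) (d := d) hτ hplus
  choose U hU using fun G => exists_localized_addMonoidHom hτ
    (genSubst (fun i => baseChange p k R Rp d hdvd (T i)) G)
    (fun f => genSubst_C_mul _ G (C_base_mem_genRing p π Rp d π) f)
  have hb1 := baseChange_mem_boundedSeries (d := d) hplus hdvd
  refine exists_isApproxProjection hN U (fun {t} ht G b => ?_) ?_ fun n b => ?_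
  · obtain ⟨n, f, hf⟩ := exists_isRep b
    have h := gaussNorm_eq hτ hplus ht hf
    rw [(gaussNorm_eq hτ hplus ht (hU G b n f hf)).2 _ h.1]
    exact genSubst_mem_boundedSeries hτ (gaussBound_monotone ht h.1) (fun i => hb1 (T i)) G
      ((h.2 _ h.1).mp le_rfl)
  · have key : ∀ j ∈ extendedIdeal p π Rp J, ∀ b, ∀ t, 0 < t → ∀ δ, 0 < δ → ∃ F, ∀ G, F ⊆ G →
        gaussNorm p π t (U G (b * j)) ≤ δ := by
      classical
      intro j hj
      rw [extendedIdeal_eq_map hdvd, Ideal.map_map] at hj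
      induction hj using Submodule.span_induction with
      | mem j hj =>
        obtain ⟨g, hg, rfl⟩ := hj
        intro b t ht δ hδ
        obtain ⟨n, f, hf⟩ := exists_isRep b
        obtain ⟨F, hF⟩ := exists_genSubst_mul_mem hτ hplus hdvd hT' hg f n ht hδ
        refine ⟨F, fun G hG => ?_⟩
        rw [RingHom.comp_apply,
          (gaussNorm_eq hτ hplus ht (hU G _ _ _ (hf.mul (isRep_algebraMap _)))).2 _ hδ.le]
        exact hF G hG
      | zero =>
        intro b t ht δ hδ
        refine ⟨∅, fun G _ => ?_⟩
        rw [mul_zero, map_zero, hN.map_zero ht]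
        exact hδ.le
      | add x y _ _ hx hy =>
        intro b t ht δ hδ
        obtain ⟨F, hF⟩ := hx b t ht δ hδ
        obtain ⟨F', hF'⟩ := hy b t ht δ hδ
        refine ⟨F ∪ F', fun G hG => ?_⟩
        rw [mul_add, map_add]
        exact (hN.add_le ht _ _).trans (max_le (hF G (Finset.union_subset_left hG))
          (hF' G (Finset.union_subset_right hG)))
      | smul a x _ hx =>
        intro b
        rw [smul_eq_mul, ← mul_assoc]
        exact hx (b * a)
    exact fun j hj t ht δ hδ => by simpa only [one_mul] using key j hj 1 t ht δ hδ
  · obtain ⟨m, f, hf⟩ := exists_isRep b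
    have hδ : (0 : ℝ) < 1 / ((n : ℝ) + 1) := by positivity
    obtain ⟨q, hq, F, hF⟩ := exists_approx_genSubst hτ hplus hdvd hT f m n hδ
    have hq' := isRep_mul_invSelf m q
    refine ⟨b - algebraMap _ _ q * IsLocalization.Away.invSelf (genRingPi p π Rp d) ^ m, ?_,
      F, fun G hG t ht htn => ?_⟩
    · rw [sub_sub_cancel, extendedIdeal_eq_map hdvd]
      exact Ideal.mul_mem_right _ _ (Ideal.mem_map_of_mem _ hq)
    · rw [(gaussNorm_eq hτ hplus ht ((hf.sub hq').sub (hU G b m f hf))).2 _ hδ.le]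
      exact hF G hG t ht htn

end GaussProjection

end DeformedRobba

end

/-- `O` is the ring of integers of `E` with residue field `k`, `O₀` the ring of integers of the
base field `F ⊆ E` (for example `ℤ_[p]`, or `𝔽_p⟦η⟧` in equal characteristic), `(R, R⁺)` a perfect
uniform adic Banach algebra over `k`, and `A` a reduced affinoid algebra over `F` with presentation
`φ : F{T₁, …, T_d} ↠ A`.  The intersection is formed in `Π̃^{[s₂, r₁]}_{R,A}`. -/
theorem mainTheorem11 {p : ℕ} [Fact p.Prime]
    {k : Type*} [Field k] [CharP k p] [PerfectRing k p]
    {O : Type*} [CommRing O] [IsDomain O] [IsDiscreteValuationRing O]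
    [IsAdicComplete (IsLocalRing.maximalIdeal O) O]
    [Algebra (WittVector p k) O]
    (hk : Function.Surjective
      ((IsLocalRing.residue O).comp (algebraMap (WittVector p k) O)))
    {π : O} (hπ : Irreducible π)
    {O₀ : Type*} [CommRing O₀] [IsDomain O₀] [IsDiscreteValuationRing O₀]
    [IsAdicComplete (IsLocalRing.maximalIdeal O₀) O₀]
    [Algebra O₀ O] [IsLocalHom (algebraMap O₀ O)]
    (hinj : Function.Injective (algebraMap O₀ O))
    {ϖ : O₀} (hϖ : Irreducible ϖ)
    {R : Type*} [NormedCommRing R] [IsUltrametricDist R] [CompleteSpace R]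
    [Algebra k R] [CharP R p] [PerfectRing R p]
    (huniform : ∃ C : ℝ, ∀ x : R, ‖x‖ ≤ C * DeformedRobba.specNorm x)
    (Rp : Subalgebra k R) (hopen : IsOpen (Rp : Set R))
    (hbdd : ∀ x ∈ Rp, ∃ C : ℝ, ∀ n : ℕ, ‖x ^ n‖ ≤ C)
    (hint : ∀ x : R, IsIntegral Rp x → x ∈ Rp)
    {d : ℕ} {A : Type*} [CommRing A] [IsReduced A]
    (φ : DeformedRobba.TateAlgebra ϖ d →+* A) (hφ : Function.Surjective φ)
    {s₁ s₂ r₁ r₂ : ℝ} (h0 : 0 < s₁) (h1 : s₁ ≤ s₂) (h2 : s₂ ≤ r₁) (h3 : r₁ ≤ r₂) :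
    Function.Injective (DeformedRobba.restrict p π Rp φ (Set.Icc_subset_Icc_left h1 :
      Set.Icc s₂ r₁ ⊆ Set.Icc s₁ r₁)) ∧
    Function.Injective (DeformedRobba.restrict p π Rp φ (Set.Icc_subset_Icc_right h3 :
      Set.Icc s₂ r₁ ⊆ Set.Icc s₂ r₂)) ∧
    Function.Injective (DeformedRobba.restrict p π Rp φ (Set.Icc_subset_Icc h1 h3 :
      Set.Icc s₂ r₁ ⊆ Set.Icc s₁ r₂)) ∧
    (DeformedRobba.restrict p π Rp φ (Set.Icc_subset_Icc_left h1 :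
      Set.Icc s₂ r₁ ⊆ Set.Icc s₁ r₁)).range ⊓
    (DeformedRobba.restrict p π Rp φ (Set.Icc_subset_Icc_right h3 :
      Set.Icc s₂ r₁ ⊆ Set.Icc s₂ r₂)).range =
    (DeformedRobba.restrict p π Rp φ (Set.Icc_subset_Icc h1 h3 :
      Set.Icc s₂ r₁ ⊆ Set.Icc s₁ r₂)).range := by
  have hα : ∀ c : k, DeformedRobba.specNorm (algebraMap k R c) ≤ 1 := fun c =>
    DeformedRobba.specNorm_le_one (hbdd _ (Rp.algebraMap_mem c))
  have hτ := DeformedRobba.GenWitt.isTeichmuller (R := R) hk hπ hα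
  have hplus : ∀ w ∈ DeformedRobba.GenWitt.plus p π Rp,
      w ∈ DeformedRobba.bounded (DeformedRobba.GenWitt.base p k π R π)
        (DeformedRobba.GenWitt.teich p k π R) (fun _ => 1) :=
    fun w hw => DeformedRobba.GenWitt.plus_le_bounded hk hπ hbdd hint hw
  have hdvd : π ∣ algebraMap O₀ O ϖ := by
    rw [← Ideal.mem_span_singleton, ← hπ.maximalIdeal_eq, IsLocalRing.mem_maximalIdeal]
    exact fun h => hϖ.not_isUnit (isUnit_of_map_unit (algebraMap O₀ O) ϖ h)
  obtain ⟨T, hT, hT'⟩ := DeformedRobba.exists_monomial_projection hϖ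
    (DeformedRobba.integralKer φ) (DeformedRobba.mem_integralKer_of_mul φ)
  have hN := DeformedRobba.isGaussFamily_gaussNorm (Rp := Rp) (d := d) hτ hplus
  obtain ⟨P, hP⟩ := DeformedRobba.exists_isApproxProjection_gaussNorm hτ hplus hdvd hT hT'
  have hs₂ : 0 < s₂ := h0.trans_le h1
  have hne : (Set.Icc s₂ r₁).Nonempty := Set.nonempty_Icc.mpr h2
  exact ⟨hP.restrict_injective hN (fun t ht => h0.trans_le ht.1) _ hne,
    hP.restrict_injective hN (fun t ht => hs₂.trans_le ht.1) _ hne,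
    hP.restrict_injective hN (fun t ht => h0.trans_le ht.1) _ hne,
    hP.range_inf_range hN h0 h1 h2 h3⟩
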